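/- **Structure theorem for the single-copy Brakerski–Koppula–Vazirani–Vidick (BKVV) proof of quantumness.** *Function family.* For each security parameter $\lambda$ let $\mathrm{Gen}_\lambda$ be a distribution on public keys $k\in\{0,1\}^{\kappa(\lambda)}$, and for each key let $G_{k,0},G_{k,1}:\mathcal X_\lambda=\{0,1\}^{n(\lambda)}\to\mathcal Y_\lambda=\{0,1\}^{r(\lambda)}$ be functions. The family is *claw-free*: every family of quantum circuits of polynomial size (gates: arbitrary unitaries on at most three qubits; size: number of qubits plus number of gates; input $k\leftarrow\mathrm{Gen}_\lambda$) outputs only with negligible probability a pair $x_0\ne x_1$ with $G_{k,0}(x_0)=G_{k,1}(x_1)$. (For instance, any trapdoor claw-free family secure against non-uniform quantum polynomial-time adversaries.) We say that $y$ *has preimages* $x_0,x_1$ under $k$ if $G_{k,0}^{-1}(y)=\{x_0\}$, $G_{k,1}^{-1}(y)=\{x_1\}$ and $x_0\neq x_1$. *Prover.* $H:\mathcal X_\lambda\to\{0,1\}$ is a uniformly random oracle. A prover $A=\{A_\lambda\}$ is a family of quantum circuits of polynomial size (oracle calls count towards the size) which on input $k$ makes $q=q(\lambda)$ calls $|x\rangle|e\rangle\mapsto(-1)^{e\cdot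 H(x)}|x\rangle|e\rangle$ to $H$ and outputs $(y,d,m)\in\mathcal Y_\lambda\times\mathcal X_\lambda\times\{0,1\}$. It *wins* if $y$ has preimages $x_0,x_1$ under $k$ and $m=d\cdot(x_0\oplus x_1)\oplus H(x_0)\oplus H(x_1)$. For $l\in\{1,\dots,q\}$, $\mathsf{Ext}_l(A)$ runs $A$ up until right before its $l$-th call to $H$ and outputs the outcome of measuring the query register $x$. **Theorem.** There is a universal function $\Xi':[0,\frac12]\to[0,1]$ such that - if $\varepsilon:\mathbb N\to[0,\frac12]$ is non-negligible, then $1-\Xi'(\varepsilon)$ is non-negligible; - there are constants $c,C>0$ with $\Xi'(\frac12-\mu)\le C\mu^c$ for all $\mu\in[0,\frac12]$; and such that the following holds for every claw-free family and every prover $A$ as above. Let $\mu:\mathbb N\to[0,\frac12]$ be such that $A_\lambda$ wins with probability at least $1-\mu(\lambda)$ (over $k$, $H$ and the measurement) for all $\lambda$, and $\frac12-\mu$ is non-negligible. Then there is a negligible function $\mathsf{negl}$ such that, for all $\lambda$, there are sets $\mathcal Y'_{\lambda,k}\subseteq\mathcal Y_\lambda$, one for each key $k$, with $$\Pr[y\in\mathcal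 Y'_{\lambda,k}: k\leftarrow\mathrm{Gen}_\lambda,\ (y,d,m)\leftarrow A_\lambda^H(k)]\ \ge\ 1-\Xi'(\tfrac12-\mu(\lambda))-\mathsf{negl}(\lambda),$$ and, for every $k$ in the support of $\mathrm{Gen}_\lambda$ and every $y\in\mathcal Y'_{\lambda,k}$: $A_\lambda^H(k)$ outputs $y$ with positive probability, $y$ has preimages $x_0,x_1$ under $k$, and, with $S=\mathcal X_\lambda\setminus\{x_0,x_1\}$, there is a set $\mathcal H_{good}$ of functions $S\to\{0,1\}$ such that $$\Pr[H|_S\in\mathcal H_{good}\mid A_\lambda^H(k)\text{ outputs }y]\ \ge\ 1-\Xi'(\tfrac12-\mu(\lambda))-\mathsf{negl}(\lambda),$$ and for all $\tilde H\in\mathcal H_{good}$ and $b\in\{0,1\}$, $$\mathbb E_{l\leftarrow[q]}\Pr[H|_S=\tilde H\wedge\mathsf{Ext}_l(A_\lambda^H(k))\text{ outputs }x_b]\ \ge\ \frac1{2q}\bigl(1-\Xi'(\tfrac12-\mu(\lambda))-\mathsf{negl}(\lambda)\bigr)\Pr[H|_S=\tilde H\wedge A_\lambda^H(k)\text{ outputs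 }y],$$ where for fixed $k$ probabilities are over $H$ and the measurement (for $q=0$ the last inequality is read as void). -/

import Mathlib

open scoped BigOperators

noncomputable section

/-- Bit strings of length `n`; a bit is an element of `ZMod 2`, so `+` is XOR. -/
abbrev Bits (n : ℕ) : Type := Fin n → ZMod 2

/-- Vectors of amplitudes of an `N`-qubit register, indexed by the computational basis. -/
abbrev QState (N : ℕ) : Type := Bits N → ℂ

/-- A negligible function of the security parameter: `s ^ c * f s → 0` for every `c`. -/
def Negligible (f : ℕ → ℝ) : Prop :=
  Asymptotics.SuperpolynomialDecay Filter.atTop (fun s : ℕ => (s : ℝ)) f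

/-- `f` is bounded by a polynomial. -/
def PolyBounded (f : ℕ → ℕ) : Prop :=
  ∃ p : Polynomial ℕ, ∀ s, f s ≤ p.eval s

/-- The probability that measuring all qubits of the state `ψ` in the computational basis gives
an outcome in `E`. -/
def bornProb {N : ℕ} (ψ : QState N) (E : Set (Bits N)) : ℝ :=
  ∑ z, E.indicator (fun z => ‖ψ z‖ ^ 2) z

/-- An elementary gate on `N` qubits: an arbitrary unitary on at most three of them. -/
structure Gate (N : ℕ) where
  arity : ℕ
  arity_le : arity ≤ 3
  wires : Fin arity ↪ Fin N
  mat : Matrix (Bits arity) (Bits arity) ℂ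
  unitary : mat ∈ Matrix.unitaryGroup (Bits arity) ℂ

/-- The action of a gate, tensored with the identity on the other wires. Here
`Function.extend g.wires b z` is the string `z` with the bits on the wires of `g` replaced
by `b`. -/
def Gate.apply {N : ℕ} (g : Gate N) (ψ : QState N) : QState N :=
  fun z => ∑ b : Bits g.arity, g.mat (z ∘ g.wires) b * ψ (Function.extend g.wires b z)

/-- Apply the gates of a list one after the other, the head first. -/
def applyGates {N : ℕ} (gs : List (Gate N)) (ψ : QState N) : QState N :=
  gs.foldl (fun φ g => g.apply φ) ψ

/-- The basis state that holds the string `k` on the wires `inp` and zero on all other wires. -/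
def initState {N κ : ℕ} (inp : Fin κ ↪ Fin N) (k : Bits κ) : QState N :=
  Pi.single (Function.extend inp k 0) 1

/-- The (phase) oracle call `|x, e⟩ ↦ (-1) ^ (e * H x) |x, e⟩`, where `x` is the content of the
wires `xs` and `e` is the content of the wire `e`. -/
def applyOracle {N n : ℕ} (xs : Fin n ↪ Fin N) (e : Fin N) (H : Bits n → ZMod 2)
    (ψ : QState N) : QState N :=
  fun z => (-1) ^ (z e * H (z ∘ xs)).val * ψ z

/-- A quantum oracle algorithm with input a key in `{0,1}^κ`, oracle `H : {0,1}^n → {0,1}`, and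
output a triple `(y, d, m)` with `y ∈ {0,1}^r`, `d ∈ {0,1}^n`, `m ∈ {0,1}`. It is a circuit that
alternates between layers of elementary gates and calls of the oracle on a query register:
layer `0`, call, layer `1`, call, ..., call, layer `queries`, and then a measurement of the output
wires. -/
structure Prover (κ n r : ℕ) where
  width : ℕ
  keyReg : Fin κ ↪ Fin width
  queryReg : Fin n ↪ Fin width
  phaseWire : Fin width
  phaseWire_ne : ∀ i, queryReg i ≠ phaseWire
  queries : ℕ
  layer : ℕ → List (Gate width)
  yReg : Fin r ↪ Fin width
  dReg : Fin n ↪ Fin width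
  mWire : Fin width

namespace Prover

variable {κ n r : ℕ} (A : Prover κ n r)

/-- The size of the circuit: qubits, oracle calls and elementary gates. -/
def size : ℕ :=
  A.width + A.queries + ∑ l ∈ Finset.range (A.queries + 1), (A.layer l).length

/-- The state of the run on key `k` and oracle `H` after `l` oracle calls and the layer that
follows them. For `l < A.queries` this is the state right before the oracle call number `l + 1`;
for `l = A.queries` it is the final state. -/
def state (k : Bits κ) (H : Bits n → ZMod 2) : ℕ → QState A.width
  | 0 => applyGates (A.layer 0) (initState A.keyReg k)
  | l + 1 => applyGates (A.layer (l + 1))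
      (applyOracle A.queryReg A.phaseWire H (state k H l))

/-- For a uniformly random oracle `H` and key `k`, the probability that measuring the state after
`l` oracle calls gives an outcome `z` such that the event `E H z` holds. -/
def prAt (k : Bits κ) (l : ℕ) (E : (Bits n → ZMod 2) → Bits A.width → Prop) : ℝ :=
  Finset.expect Finset.univ fun H : Bits n → ZMod 2 => bornProb (A.state k H l) {z | E H z}

/-- For a uniformly random oracle `H` and key `k`, the probability of an event `E H y d m` about
the oracle and the output `(y, d, m)`. -/
def prOut (k : Bits κ) (E : (Bits n → ZMod 2) → Bits r → Bits n → ZMod 2 → Prop) : ℝ :=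
  A.prAt k A.queries fun H z => E H (z ∘ A.yReg) (z ∘ A.dReg) (z A.mWire)

/-- For a uniformly random oracle `H` and key `k`, the probability of an event `E H x` about the
oracle and the outcome `x` of running `A` up until right before the oracle call number `l + 1` and
measuring the query register. -/
def prExt (k : Bits κ) (l : ℕ) (E : (Bits n → ZMod 2) → Bits n → Prop) : ℝ :=
  A.prAt k l fun H z => E H (z ∘ A.queryReg)

end Prover

/-- A quantum algorithm without oracle, with input a key in `{0,1}^κ` and output two strings
in `{0,1}^n`. -/
structure Finder (κ n : ℕ) where
  width : ℕ
  keyReg : Fin κ ↪ Fin width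
  gates : List (Gate width)
  outReg : Fin 2 → (Fin n ↪ Fin width)

namespace Finder

variable {κ n : ℕ} (B : Finder κ n)

/-- The size of the circuit: qubits and elementary gates. -/
def size : ℕ := B.width + B.gates.length

/-- The probability that the output on key `k` satisfies `E`. -/
def prOut (k : Bits κ) (E : (Fin 2 → Bits n) → Prop) : ℝ :=
  bornProb (applyGates B.gates (initState B.keyReg k)) {z | E fun b => z ∘ B.outReg b}

end Finder

/-- A keyed family of pairs of functions `G₀, G₁ : {0,1}^n → {0,1}^r`, with a distribution of the
public key for every value `s` of the security parameter. -/
structure FunctionPairs where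
  keyLen : ℕ → ℕ
  domLen : ℕ → ℕ
  ranLen : ℕ → ℕ
  gen : ∀ s, PMF (Bits (keyLen s))
  G : ∀ s, Bits (keyLen s) → Fin 2 → Bits (domLen s) → Bits (ranLen s)

namespace FunctionPairs

variable (F : FunctionPairs) (s : ℕ)

/-- The average over a random key. -/
def keyAvg (f : Bits (F.keyLen s) → ℝ) : ℝ := ∑ k, (F.gen s k).toReal * f k

/-- A claw for the key `k`: two different points with the same image under `G₀` and `G₁`. -/
def IsClaw (k : Bits (F.keyLen s)) (x : Fin 2 → Bits (F.domLen s)) : Prop :=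
  x 0 ≠ x 1 ∧ F.G s k 0 (x 0) = F.G s k 1 (x 1)

/-- No family of quantum circuits of polynomial size finds claws, from the public key, with
non-negligible probability. -/
def ClawFree : Prop :=
  ∀ B : ∀ s, Finder (F.keyLen s) (F.domLen s), PolyBounded (fun s => (B s).size) →
    Negligible fun s => F.keyAvg s fun k => (B s).prOut k (F.IsClaw s k)

/-- `x 0` and `x 1` are the preimages of `y`: `G₀⁻¹(y) = {x 0}`, `G₁⁻¹(y) = {x 1}`, and they are
two different points. If `G₀` and `G₁` are injective, the conditions on fibres say just that
`G₀ (x 0) = y` and `G₁ (x 1) = y`. -/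
def ArePreimages (k : Bits (F.keyLen s)) (y : Bits (F.ranLen s))
    (x : Fin 2 → Bits (F.domLen s)) : Prop :=
  x 0 ≠ x 1 ∧ ∀ b, F.G s k b ⁻¹' {y} = {x b}

/-- The check of the verifier in the single-copy proof of quantumness: `(y, d, m)` is accepted if
`y` has preimages `x₀, x₁` and `m = d · (x₀ ⊕ x₁) ⊕ H(x₀) ⊕ H(x₁)`. -/
def Accepts (k : Bits (F.keyLen s)) (H : Bits (F.domLen s) → ZMod 2) (y : Bits (F.ranLen s))
    (d : Bits (F.domLen s)) (m : ZMod 2) : Prop :=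
  ∃ x : Fin 2 → Bits (F.domLen s), F.ArePreimages s k y x ∧
    m = d ⬝ᵥ (x 0 + x 1) + H (x 0) + H (x 1)

/-- The probability that the prover `A`, given a random public key and a random oracle, makes the
verifier accept. -/
def winProb (A : Prover (F.keyLen s) (F.domLen s) (F.ranLen s)) : ℝ :=
  F.keyAvg s fun k => A.prOut k (F.Accepts s k)

end FunctionPairs

end

/-! Fix the key and regard the state of the run as a function of the oracle `H`. For a point `x`,
split this function into its parts even and odd under flipping `H x`. For two points `x₀ ≠ x₁` this
gives four orthogonal parts: even-even, odd-even, even-odd and odd-odd. By a Fourier computation on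
the four oracles that differ only at `x₀, x₁`, a measurement predicts `H x₀ + H x₁` with advantage
over one half only through the interference of even-even with odd-odd and of odd-even with even-odd
(`sum_bornProb_parity_le`).

The odd-odd part is negligible. An oracle call exchanges the even and odd parts in `H x` exactly on
the basis states that query `x`, and no basis state queries two points at once. So odd-odd weight
arises only from a query at one point on a component already odd in the other, and that component is
a sum over earlier queries at the other point. A circuit that runs the prover, records a query
coherently, continues with the oracle flipped there and measures a later query therefore finds a
claw (`clawWeight_le`, `exists_finder`). The random oracle is made efficient by the polynomial
method: the success weight has degree at most twice the number of calls in the signs of `H`, so its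
average is unchanged over the oracles given by polynomials of bounded degree over a field with `2 ^
n` elements (`KWise.average_eq`, `kWise_polyOracle`). Some coefficients do at least as well as the
average, and they are hard-wired, as nonuniform circuits allow.

A winning prover must then use the odd-even/even-odd interference. If these parts have weights `a,
b` with `a + b ≤ T`, then `2 √a √b` close to `T` forces both `a` and `b` to be close to `T / 2`
(`half_le_of_mul_sqrt`). Since the part odd in `H x` weighs at most the total weight of queries at
`x` (`wnorm_oddPart_run_le`), each preimage is extracted with about half the weight. All this holds
for weights invariant under flips at `x₀, x₁`, in particular after conditioning on `H` outside these
points.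

Quantitatively, the interference falls short of the total weight by at most `Λ = 2μ + 2√η` on
average, where `η` bounds the odd-odd weight. Markov with threshold `√Λ` selects keys and outputs,
and Markov with threshold `u = Λ^(1/4)` selects the classes of oracles; then `√(1 - (1 - u)²)` is
the final loss. -/

noncomputable section

/-! ### Norms, and unitarity of gates and oracle calls -/

/-- The squared norm of a vector of amplitudes. -/
def nsq {N : ℕ} (ψ : QState N) : ℝ := ∑ z, ‖ψ z‖ ^ 2

lemma nsq_nonneg {N : ℕ} (ψ : QState N) : 0 ≤ nsq ψ :=
  Finset.sum_nonneg fun _ _ => sq_nonneg _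

lemma bornProb_nonneg {N : ℕ} (ψ : QState N) (E : Set (Bits N)) : 0 ≤ bornProb ψ E :=
  Finset.sum_nonneg fun _ _ => Set.indicator_nonneg (fun _ _ => sq_nonneg _) _

lemma bornProb_mono {N : ℕ} (ψ : QState N) {E E' : Set (Bits N)} (h : E ⊆ E') :
    bornProb ψ E ≤ bornProb ψ E' :=
  Finset.sum_le_sum fun _ _ =>
    Set.indicator_le_indicator_of_subset h (fun _ => sq_nonneg _) _

lemma bornProb_univ {N : ℕ} (ψ : QState N) : bornProb ψ Set.univ = nsq ψ := by
  simp [bornProb, nsq]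

lemma nsq_indicator {N : ℕ} (ψ : QState N) (E : Set (Bits N)) :
    nsq (E.indicator ψ) = bornProb ψ E := by
  classical
  simp only [nsq, bornProb, Set.indicator_apply]
  exact Finset.sum_congr rfl fun z _ => by split_ifs <;> simp

lemma bornProb_le_nsq {N : ℕ} (ψ : QState N) (E : Set (Bits N)) : bornProb ψ E ≤ nsq ψ := by
  rw [← bornProb_univ]
  exact bornProb_mono ψ (Set.subset_univ E)

lemma extend_extend {N m : ℕ} (w : Fin m ↪ Fin N) (b b' : Bits m) (z : Bits N) :
    Function.extend w b (Function.extend w b' z) = Function.extend w b z := by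
  funext i
  by_cases h : ∃ a, w a = i
  · obtain ⟨a, rfl⟩ := h
    simp [w.injective.extend_apply]
  · simp [Function.extend_apply' _ _ _ h]

lemma extend_comp {N m : ℕ} (w : Fin m ↪ Fin N) (b : Bits m) (z : Bits N) :
    Function.extend w b z ∘ w = b := by
  funext a
  simp [w.injective.extend_apply]

lemma extend_self {N m : ℕ} (w : Fin m ↪ Fin N) (z : Bits N) :
    Function.extend w (z ∘ w) z = z := by
  funext i
  by_cases h : ∃ a, w a = i
  · obtain ⟨a, rfl⟩ := h
    simp [w.injective.extend_apply]
  · simp [Function.extend_apply' _ _ _ h]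

lemma add_extend_zero {N m : ℕ} (w : Fin m ↪ Fin N) (c : Bits m) (z : Bits N) :
    z + Function.extend w c 0 = Function.extend w (z ∘ w + c) z := by
  funext i
  by_cases h : ∃ a, w a = i
  · obtain ⟨a, rfl⟩ := h
    simp [w.injective.extend_apply]
  · simp [Function.extend_apply' _ _ _ h]

/-- A sum over all strings, averaged over the contents of some of the wires. -/
lemma card_smul_sum_eq_sum_extend {N m : ℕ} (w : Fin m ↪ Fin N) (F : Bits N → ℝ) :
    (Fintype.card (Bits m)) • ∑ z, F z = ∑ z, ∑ b : Bits m, F (Function.extend w b z) := by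
  have h1 : ∀ c : Bits m, ∑ z, F z = ∑ z, F (Function.extend w (z ∘ w + c) z) := by
    intro c
    rw [← Equiv.sum_comp (Equiv.addRight (Function.extend w c (0 : Bits N))) F]
    refine Finset.sum_congr rfl fun z _ => ?_
    exact congrArg F (add_extend_zero w c z)
  calc _ = ∑ c : Bits m, ∑ z, F (Function.extend w (z ∘ w + c) z) := by
        rw [← Finset.sum_congr rfl fun c _ => h1 c]; simp
    _ = ∑ z, ∑ c : Bits m, F (Function.extend w (z ∘ w + c) z) := Finset.sum_comm
    _ = _ := by
        refine Finset.sum_congr rfl fun z _ => ?_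
        exact Equiv.sum_comp (Equiv.addLeft (z ∘ w)) fun b => F (Function.extend w b z)

lemma sum_norm_sq_mulVec {ι : Type*} [Fintype ι] [DecidableEq ι] (M : Matrix ι ι ℂ)
    (hM : M ∈ Matrix.unitaryGroup ι ℂ) (v : ι → ℂ) :
    ∑ i, ‖∑ j, M i j * v j‖ ^ 2 = ∑ i, ‖v i‖ ^ 2 := by
  have key : ∀ u : ι → ℂ, ((∑ i, ‖u i‖ ^ 2 : ℝ) : ℂ) = star u ⬝ᵥ u := by
    intro u
    rw [dotProduct, Complex.ofReal_sum]
    refine Finset.sum_congr rfl fun i _ => ?_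
    simp [Complex.conj_mul']
  have : ((∑ i, ‖(M.mulVec v) i‖ ^ 2 : ℝ) : ℂ) = ((∑ i, ‖v i‖ ^ 2 : ℝ) : ℂ) := by
    rw [key, key, Matrix.star_mulVec, ← Matrix.dotProduct_mulVec, Matrix.mulVec_mulVec,
      ← Matrix.star_eq_conjTranspose, Matrix.mem_unitaryGroup_iff'.mp hM, Matrix.one_mulVec]
  exact_mod_cast this

/-- Strings that agree off the wires of the gate form a block, on which the gate acts by its unitary
matrix. Summing the norms of the blocks over all strings counts every amplitude `2 ^ arity` times on
both sides. -/
lemma Gate.nsq_apply {N : ℕ} (g : Gate N) (ψ : QState N) : nsq (g.apply ψ) = nsq ψ := by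
  have hc : (0 : ℝ) < Fintype.card (Bits g.arity) := by exact_mod_cast Fintype.card_pos
  have h := card_smul_sum_eq_sum_extend g.wires fun z => ‖g.apply ψ z‖ ^ 2
  have h' := card_smul_sum_eq_sum_extend g.wires fun z => ‖ψ z‖ ^ 2
  have : ∀ z, ∑ b : Bits g.arity, ‖g.apply ψ (Function.extend g.wires b z)‖ ^ 2 =
      ∑ b : Bits g.arity, ‖ψ (Function.extend g.wires b z)‖ ^ 2 := by
    intro z
    simp only [Gate.apply, extend_comp, extend_extend]
    exact sum_norm_sq_mulVec g.mat g.unitary fun b => ψ (Function.extend g.wires b z)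
  rw [Finset.sum_congr rfl fun z _ => this z, ← h', nsmul_eq_mul, nsmul_eq_mul] at h
  exact mul_left_cancel₀ hc.ne' h

/-- The action of a gate as a linear map. -/
def Gate.lin {N : ℕ} (g : Gate N) : QState N →ₗ[ℂ] QState N where
  toFun := g.apply
  map_add' ψ φ := by
    funext z
    simp [Gate.apply, mul_add, Finset.sum_add_distrib]
  map_smul' c ψ := by
    funext z
    simp only [Gate.apply, Pi.smul_apply, smul_eq_mul, RingHom.id_apply, Finset.mul_sum]
    exact Finset.sum_congr rfl fun b _ => by ring

lemma applyGates_cons {N : ℕ} (g : Gate N) (gs : List (Gate N)) (ψ : QState N) :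
    applyGates (g :: gs) ψ = applyGates gs (g.apply ψ) := rfl

lemma applyGates_append {N : ℕ} (gs gs' : List (Gate N)) (ψ : QState N) :
    applyGates (gs ++ gs') ψ = applyGates gs' (applyGates gs ψ) := by
  simp [applyGates]

lemma nsq_applyGates {N : ℕ} (gs : List (Gate N)) (ψ : QState N) :
    nsq (applyGates gs ψ) = nsq ψ := by
  induction gs generalizing ψ with
  | nil => rfl
  | cons g gs ih => rw [applyGates_cons, ih, g.nsq_apply]

lemma exists_linearMap_applyGates {N : ℕ} (gs : List (Gate N)) :
    ∃ f : QState N →ₗ[ℂ] QState N, ∀ ψ, applyGates gs ψ = f ψ := by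
  induction gs with
  | nil => exact ⟨LinearMap.id, fun _ => rfl⟩
  | cons g gs ih =>
    obtain ⟨f, hf⟩ := ih
    exact ⟨f ∘ₗ g.lin, fun ψ => by rw [applyGates_cons, hf]; rfl⟩

/-- The action of a list of gates as a linear map. -/
def gatesLin {N : ℕ} (gs : List (Gate N)) : QState N →ₗ[ℂ] QState N :=
  (exists_linearMap_applyGates gs).choose

lemma applyGates_eq {N : ℕ} (gs : List (Gate N)) (ψ : QState N) :
    applyGates gs ψ = gatesLin gs ψ :=
  (exists_linearMap_applyGates gs).choose_spec ψ

/-- The sign `(-1) ^ a` of a bit. -/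
def sgn (a : ZMod 2) : ℂ := (-1) ^ a.val

@[simp] lemma sgn_zero : sgn 0 = 1 := by simp [sgn]

@[simp] lemma sgn_one : sgn 1 = -1 := by simp [sgn, ZMod.val_one]

lemma zmod_two_cases (a : ZMod 2) : a = 0 ∨ a = 1 := by
  revert a; decide

lemma sgn_add (a b : ZMod 2) : sgn (a + b) = sgn a * sgn b := by
  rcases zmod_two_cases a with rfl | rfl <;> rcases zmod_two_cases b with rfl | rfl <;>
    simp [show (1 : ZMod 2) + 1 = 0 from rfl]

@[simp] lemma norm_sgn (a : ZMod 2) : ‖sgn a‖ = 1 := by simp [sgn]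

lemma applyOracle_apply {N n : ℕ} (xs : Fin n ↪ Fin N) (e : Fin N) (H : Bits n → ZMod 2)
    (ψ : QState N) (z : Bits N) :
    applyOracle xs e H ψ z = sgn (z e * H (z ∘ xs)) * ψ z := rfl

lemma nsq_applyOracle {N n : ℕ} (xs : Fin n ↪ Fin N) (e : Fin N) (H : Bits n → ZMod 2)
    (ψ : QState N) : nsq (applyOracle xs e H ψ) = nsq ψ := by
  simp [nsq, applyOracle_apply]

lemma nsq_initState {N κ : ℕ} (inp : Fin κ ↪ Fin N) (k : Bits κ) :
    nsq (initState inp k) = 1 := by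
  classical
  simp only [nsq, initState, Pi.single_apply]
  simp [apply_ite]

lemma Prover.nsq_state {κ n r : ℕ} (A : Prover κ n r) (k : Bits κ) (H : Bits n → ZMod 2)
    (l : ℕ) : nsq (A.state k H l) = 1 := by
  induction l with
  | zero => rw [Prover.state, nsq_applyGates, nsq_initState]
  | succ l ih => rw [Prover.state, nsq_applyGates, nsq_applyOracle, ih]

/-! ### Even and odd parts in one value of the oracle -/

/-- The oracle `H` with the value at `x` flipped. -/
def flipAt {n : ℕ} (x : Bits n) (H : Bits n → ZMod 2) : Bits n → ZMod 2 := H + Pi.single x 1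

@[simp] lemma flipAt_flipAt {n : ℕ} (x : Bits n) (H : Bits n → ZMod 2) :
    flipAt x (flipAt x H) = H := by
  rw [flipAt, flipAt, add_assoc, ← Pi.single_add, show (1 : ZMod 2) + 1 = 0 from rfl,
    Pi.single_zero, add_zero]

lemma flipAt_comm {n : ℕ} (x x' : Bits n) (H : Bits n → ZMod 2) :
    flipAt x (flipAt x' H) = flipAt x' (flipAt x H) := add_right_comm _ _ _

lemma flipAt_apply {n : ℕ} (x : Bits n) (H : Bits n → ZMod 2) (x' : Bits n) :
    flipAt x H x' = H x' + if x' = x then 1 else 0 := by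
  simp [flipAt, Pi.single_apply]

/-- Flipping the value at `x` as a permutation of the set of oracles. -/
def flipEquiv {n : ℕ} (x : Bits n) : (Bits n → ZMod 2) ≃ (Bits n → ZMod 2) :=
  (Function.Involutive.toPerm (flipAt x) (flipAt_flipAt x))

/-- The part of `Φ` that is odd in the value of the oracle at `x`. -/
def oddPart {n N : ℕ} (x : Bits n) (Φ : (Bits n → ZMod 2) → QState N) :
    (Bits n → ZMod 2) → QState N :=
  fun H => (1 / 2 : ℂ) • (Φ H - Φ (flipAt x H))

/-- The part of `Φ` that is even in the value of the oracle at `x`. -/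
def evenPart {n N : ℕ} (x : Bits n) (Φ : (Bits n → ZMod 2) → QState N) :
    (Bits n → ZMod 2) → QState N :=
  fun H => (1 / 2 : ℂ) • (Φ H + Φ (flipAt x H))

/-- The average of the squared norm over the oracle, with weights `w`. -/
def wnorm {n N : ℕ} (w : (Bits n → ZMod 2) → ℝ) (Φ : (Bits n → ZMod 2) → QState N) : ℝ :=
  ∑ H, w H * nsq (Φ H)

section Parts

variable {n N N' : ℕ} (x x' : Bits n) (Φ : (Bits n → ZMod 2) → QState N)

lemma oddPart_evenPart_comm : oddPart x (evenPart x' Φ) = evenPart x' (oddPart x Φ) := by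
  funext H z
  simp only [oddPart, evenPart, flipAt_comm x' x, Pi.smul_apply, Pi.sub_apply, Pi.add_apply,
    smul_eq_mul]
  ring

lemma oddPart_linearMap (f : QState N →ₗ[ℂ] QState N') :
    oddPart x (fun H => f (Φ H)) = fun H => f (oddPart x Φ H) := by
  funext H
  simp [oddPart]

lemma oddPart_indicator (E : Set (Bits N)) :
    oddPart x (fun H => E.indicator (Φ H)) = fun H => E.indicator (oddPart x Φ H) := by
  classical
  funext H z
  simp only [oddPart, Pi.smul_apply, Pi.sub_apply, Set.indicator_apply]
  split_ifs <;> simp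

lemma evenPart_indicator (E : Set (Bits N)) :
    evenPart x (fun H => E.indicator (Φ H)) = fun H => E.indicator (evenPart x Φ H) := by
  classical
  funext H z
  simp only [evenPart, Pi.smul_apply, Pi.add_apply, Set.indicator_apply]
  split_ifs <;> simp

variable {x} {w : (Bits n → ZMod 2) → ℝ}

lemma wnorm_nonneg (hw : ∀ H, 0 ≤ w H) : 0 ≤ wnorm w Φ :=
  Finset.sum_nonneg fun H _ => mul_nonneg (hw H) (nsq_nonneg _)

lemma wnorm_flipAt (hx : ∀ H, w (flipAt x H) = w H) :
    wnorm w (fun H => Φ (flipAt x H)) = wnorm w Φ := by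
  rw [wnorm, wnorm, ← Equiv.sum_comp (flipEquiv x) fun H => w H * nsq (Φ H)]
  exact Finset.sum_congr rfl fun H _ => by
    rw [show flipEquiv x H = flipAt x H from rfl, hx]

lemma parallelogram_half (a b : ℂ) :
    ‖(1 / 2 : ℂ) * (a + b)‖ ^ 2 + ‖(1 / 2 : ℂ) * (a - b)‖ ^ 2 = (‖a‖ ^ 2 + ‖b‖ ^ 2) / 2 := by
  rw [norm_mul, norm_mul, mul_pow, mul_pow]
  have := parallelogram_law_with_norm ℝ a b
  norm_num
  nlinarith

/-- The parallelogram law for `H` and its flip. Invariance of the weights is needed because the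
identity holds only after the two oracles of a pair are added with equal weight. -/
lemma wnorm_evenPart_add_oddPart (hx : ∀ H, w (flipAt x H) = w H) :
    wnorm w (evenPart x Φ) + wnorm w (oddPart x Φ) = wnorm w Φ := by
  have h : ∀ H, nsq (evenPart x Φ H) + nsq (oddPart x Φ H) =
      (nsq (Φ H) + nsq (Φ (flipAt x H))) / 2 := by
    intro H
    rw [nsq, nsq, nsq, nsq, ← Finset.sum_add_distrib, ← Finset.sum_add_distrib, Finset.sum_div]
    exact Finset.sum_congr rfl fun z _ => parallelogram_half _ _
  have h2 := wnorm_flipAt Φ hx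
  rw [wnorm, wnorm, ← Finset.sum_add_distrib]
  simp only [← mul_add, h]
  rw [wnorm] at h2
  simp only [mul_div_assoc', mul_add, ← Finset.sum_div, Finset.sum_add_distrib, h2]
  rw [wnorm]; ring

lemma wnorm_evenPart_le (hw : ∀ H, 0 ≤ w H) (hx : ∀ H, w (flipAt x H) = w H) :
    wnorm w (evenPart x Φ) ≤ wnorm w Φ := by
  have := wnorm_evenPart_add_oddPart Φ hx
  have := wnorm_nonneg (oddPart x Φ) hw
  linarith

lemma wnorm_oddPart_le (hw : ∀ H, 0 ≤ w H) (hx : ∀ H, w (flipAt x H) = w H) :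
    wnorm w (oddPart x Φ) ≤ wnorm w Φ := by
  have := wnorm_evenPart_add_oddPart Φ hx
  have := wnorm_nonneg (evenPart x Φ) hw
  linarith

lemma wnorm_indicator_le (hw : ∀ H, 0 ≤ w H) (E : Set (Bits N)) :
    wnorm w (fun H => E.indicator (Φ H)) ≤ wnorm w Φ :=
  Finset.sum_le_sum fun H _ =>
    mul_le_mul_of_nonneg_left ((nsq_indicator _ _).trans_le (bornProb_le_nsq _ _)) (hw H)

end Parts

/-! ### How one oracle call moves weight between even and odd parts -/

section Progress

variable {n N : ℕ} (xs : Fin n ↪ Fin N) (e : Fin N)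

/-- The basis states that query the oracle at `x`. -/
def hits (x : Bits n) : Set (Bits N) := {z | z ∘ xs = x ∧ z e = 1}

lemma sgn_flipAt (x : Bits n) (H : Bits n → ZMod 2) (z : Bits N) [Decidable (z ∈ hits xs e x)] :
    sgn (z e * flipAt x H (z ∘ xs)) =
      (if z ∈ hits xs e x then -1 else 1) * sgn (z e * H (z ∘ xs)) := by
  rw [flipAt_apply, mul_add, sgn_add, mul_comm]
  congr 1
  rcases zmod_two_cases (z e) with h | h <;> by_cases h' : z ∘ xs = x <;> simp [hits, h, h']

open Classical in
/-- The even part on the basis states that query `x`, and the odd part on the other ones. -/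
def swapPart (x : Bits n) (Φ : (Bits n → ZMod 2) → QState N) : (Bits n → ZMod 2) → QState N :=
  fun H z => if z ∈ hits xs e x then evenPart x Φ H z else oddPart x Φ H z

/-- Flipping `H x` changes the sign of the call exactly on the basis states in `hits`. There a sum
over a pair of oracles becomes a difference, so even and odd change places; elsewhere nothing
happens. -/
lemma oddPart_applyOracle (x : Bits n) (Φ : (Bits n → ZMod 2) → QState N) :
    oddPart x (fun H => applyOracle xs e H (Φ H)) =
      fun H => applyOracle xs e H (swapPart xs e x Φ H) := by
  classical
  funext H z
  simp only [oddPart, swapPart, evenPart, Pi.smul_apply, Pi.sub_apply, Pi.add_apply,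
    applyOracle_apply, smul_eq_mul, sgn_flipAt]
  split_ifs <;> ring

lemma nsq_swapPart (x : Bits n) (Φ : (Bits n → ZMod 2) → QState N) (H : Bits n → ZMod 2) :
    nsq (swapPart xs e x Φ H) ≤
      nsq (oddPart x Φ H) + nsq ((hits xs e x).indicator (evenPart x Φ H)) := by
  classical
  rw [nsq, nsq, nsq, ← Finset.sum_add_distrib]
  refine Finset.sum_le_sum fun z _ => ?_
  simp only [swapPart, Set.indicator_apply]
  split_ifs <;> simp

/-- A basis state queries at most one of the two points, so a single call changes at most one of the
two parities. Hence odd-odd weight never comes directly from the even-even part. -/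
lemma nsq_swapPart_swapPart {x x' : Bits n} (hne : x ≠ x') (Φ : (Bits n → ZMod 2) → QState N)
    (H : Bits n → ZMod 2) :
    nsq (swapPart xs e x (swapPart xs e x' Φ) H) ≤
      nsq (oddPart x (oddPart x' Φ) H) +
        nsq ((hits xs e x).indicator (evenPart x (oddPart x' Φ) H)) +
        nsq ((hits xs e x').indicator (evenPart x' (oddPart x Φ) H)) := by
  classical
  rw [← oddPart_evenPart_comm x x', nsq, nsq, nsq, nsq, ← Finset.sum_add_distrib,
    ← Finset.sum_add_distrib]
  refine Finset.sum_le_sum fun z _ => ?_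
  by_cases h : z ∈ hits xs e x
  · have h' : z ∉ hits xs e x' := fun h' => hne (h.1.symm.trans h'.1)
    have : swapPart xs e x (swapPart xs e x' Φ) H z = evenPart x (oddPart x' Φ) H z := by
      simp [swapPart, evenPart, h, h']
    rw [this]
    simp [h, h']
  · by_cases h' : z ∈ hits xs e x'
    · have : swapPart xs e x (swapPart xs e x' Φ) H z = oddPart x (evenPart x' Φ) H z := by
        simp [swapPart, oddPart, h, h']
      rw [this]
      simp [h, h']
    · have : swapPart xs e x (swapPart xs e x' Φ) H z = oddPart x (oddPart x' Φ) H z := by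
        simp [swapPart, oddPart, h, h']
      rw [this]
      simp [h, h']

end Progress

/-! ### Odd weight is bounded by query weight along the run -/

namespace Prover

variable {κ n r : ℕ} (A : Prover κ n r) (k : Bits κ)

/-- The run as a function of the oracle. -/
def run (l : ℕ) : (Bits n → ZMod 2) → QState A.width := fun H => A.state k H l

/-- The basis states in which the oracle call is a query at `x`. -/
def hit (x : Bits n) : Set (Bits A.width) := hits A.queryReg A.phaseWire x

lemma oddPart_run_zero (x : Bits n) : oddPart x (A.run k 0) = 0 := by
  funext H
  simp [oddPart, run, state]

lemma run_succ (l : ℕ) : A.run k (l + 1) = fun H => gatesLin (A.layer (l + 1))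
    (applyOracle A.queryReg A.phaseWire H (A.run k l H)) := by
  funext H
  rw [← applyGates_eq]
  rfl

lemma oddPart_run_succ (x : Bits n) (l : ℕ) : oddPart x (A.run k (l + 1)) =
    fun H => gatesLin (A.layer (l + 1)) (applyOracle A.queryReg A.phaseWire H
      (swapPart A.queryReg A.phaseWire x (A.run k l) H)) := by
  rw [run_succ, oddPart_linearMap, oddPart_applyOracle]

lemma nsq_gatesLin {N : ℕ} (gs : List (Gate N)) (ψ : QState N) :
    nsq (gatesLin gs ψ) = nsq ψ := by rw [← applyGates_eq, nsq_applyGates]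

/-- The initial state does not depend on `H`, so the odd part starts at zero. Each call can add only
the even part sitting on queries at `x`, and the layers preserve the norm. -/
lemma nsq_oddPart_run_le (x : Bits n) (l : ℕ) (H : Bits n → ZMod 2) :
    nsq (oddPart x (A.run k l) H) ≤
      ∑ i ∈ Finset.range l, nsq ((A.hit x).indicator (evenPart x (A.run k i) H)) := by
  induction l with
  | zero => simp [oddPart_run_zero, nsq]
  | succ l ih =>
    rw [oddPart_run_succ, Finset.sum_range_succ, nsq_gatesLin, nsq_applyOracle]
    exact (nsq_swapPart _ _ _ _ _).trans (by gcongr; rfl)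

lemma nsq_oddPart_oddPart_run_le {x x' : Bits n} (hne : x ≠ x') (l : ℕ) (H : Bits n → ZMod 2) :
    nsq (oddPart x (oddPart x' (A.run k l)) H) ≤
      ∑ i ∈ Finset.range l,
        (nsq ((A.hit x).indicator (evenPart x (oddPart x' (A.run k i)) H)) +
          nsq ((A.hit x').indicator (evenPart x' (oddPart x (A.run k i)) H))) := by
  induction l with
  | zero =>
    rw [oddPart_run_zero]
    simp [oddPart, nsq]
  | succ l ih =>
    rw [oddPart_run_succ, oddPart_linearMap, oddPart_applyOracle, Finset.sum_range_succ,
      nsq_gatesLin, nsq_applyOracle]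
    refine (nsq_swapPart_swapPart _ _ hne _ _).trans ?_
    rw [add_assoc]
    exact add_le_add ih le_rfl

variable {w : (Bits n → ZMod 2) → ℝ} {x x' : Bits n}

/-- The odd part in the value at `x` has at most the total weight of the queries at `x`. -/
lemma wnorm_oddPart_run_le (hw : ∀ H, 0 ≤ w H) (hx : ∀ H, w (flipAt x H) = w H) (l : ℕ) :
    wnorm w (oddPart x (A.run k l)) ≤
      ∑ i ∈ Finset.range l, wnorm w (fun H => (A.hit x).indicator (A.run k i H)) := by
  calc wnorm w (oddPart x (A.run k l))
      ≤ ∑ H, ∑ i ∈ Finset.range l,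
          w H * nsq ((A.hit x).indicator (evenPart x (A.run k i) H)) := by
        refine Finset.sum_le_sum fun H _ => ?_
        rw [← Finset.mul_sum]
        exact mul_le_mul_of_nonneg_left (A.nsq_oddPart_run_le k x l H) (hw H)
    _ = ∑ i ∈ Finset.range l,
          wnorm w (evenPart x fun H => (A.hit x).indicator (A.run k i H)) := by
        rw [Finset.sum_comm]
        simp only [evenPart_indicator, wnorm]
    _ ≤ _ := Finset.sum_le_sum fun i _ => wnorm_evenPart_le _ hw hx

/-- The part that is odd in the values at `x` and at `x'` has at most the weight of the queries
at one of these points on the part that is odd in the value at the other one. -/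
lemma wnorm_oddPart_oddPart_run_le (hw : ∀ H, 0 ≤ w H) (hx : ∀ H, w (flipAt x H) = w H)
    (hx' : ∀ H, w (flipAt x' H) = w H) (hne : x ≠ x') (l : ℕ) :
    wnorm w (oddPart x (oddPart x' (A.run k l))) ≤
      ∑ i ∈ Finset.range l,
        (wnorm w (fun H => (A.hit x).indicator (oddPart x' (A.run k i) H)) +
          wnorm w (fun H => (A.hit x').indicator (oddPart x (A.run k i) H))) := by
  calc wnorm w (oddPart x (oddPart x' (A.run k l)))
      ≤ ∑ H, ∑ i ∈ Finset.range l,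
          (w H * nsq ((A.hit x).indicator (evenPart x (oddPart x' (A.run k i)) H)) +
          w H * nsq ((A.hit x').indicator (evenPart x' (oddPart x (A.run k i)) H))) := by
        refine Finset.sum_le_sum fun H _ => ?_
        simp only [← mul_add]
        rw [← Finset.mul_sum]
        exact mul_le_mul_of_nonneg_left (A.nsq_oddPart_oddPart_run_le k hne l H) (hw H)
    _ = ∑ i ∈ Finset.range l,
          (wnorm w (evenPart x fun H => (A.hit x).indicator (oddPart x' (A.run k i) H)) +
          wnorm w (evenPart x' fun H => (A.hit x').indicator (oddPart x (A.run k i) H))) := by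
        rw [Finset.sum_comm]
        simp only [evenPart_indicator, wnorm, Finset.sum_add_distrib]
    _ ≤ _ := Finset.sum_le_sum fun i _ =>
        add_le_add (wnorm_evenPart_le _ hw hx) (wnorm_evenPart_le _ hw hx')

end Prover

/-! ### Predicting the parity of two oracle values -/

section Acceptance

variable {n N : ℕ} {w : (Bits n → ZMod 2) → ℝ}

lemma sum_norm_mul_norm_le (hw : ∀ H, 0 ≤ w H) (Φ Ψ : (Bits n → ZMod 2) → QState N) :
    ∑ H, w H * ∑ z, ‖Φ H z‖ * ‖Ψ H z‖ ≤ √(wnorm w Φ) * √(wnorm w Ψ) := by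
  have h := Real.sum_mul_le_sqrt_mul_sqrt
    (Finset.univ : Finset ((Bits n → ZMod 2) × Bits N))
    (fun p => √(w p.1) * ‖Φ p.1 p.2‖) (fun p => √(w p.1) * ‖Ψ p.1 p.2‖)
  have e : ∀ Θ : (Bits n → ZMod 2) → QState N,
      ∑ p : (Bits n → ZMod 2) × Bits N, (√(w p.1) * ‖Θ p.1 p.2‖) ^ 2 = wnorm w Θ := by
    intro Θ
    rw [Fintype.sum_prod_type, wnorm]
    refine Finset.sum_congr rfl fun H _ => ?_
    rw [nsq, Finset.mul_sum]
    exact Finset.sum_congr rfl fun z _ => by rw [mul_pow, Real.sq_sqrt (hw H)]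
  rw [e, e] at h
  refine le_trans (le_of_eq ?_) h
  rw [Fintype.sum_prod_type]
  refine Finset.sum_congr rfl fun H _ => ?_
  rw [Finset.mul_sum]
  refine Finset.sum_congr rfl fun z _ => ?_
  linear_combination (-‖Φ H z‖ * ‖Ψ H z‖) * Real.mul_self_sqrt (hw H)

lemma norm_add_sq_add_norm_add_sq_le (a b c d : ℂ) :
    ‖a + b‖ ^ 2 + ‖c + d‖ ^ 2 ≤
      ‖a‖ ^ 2 + ‖b‖ ^ 2 + ‖c‖ ^ 2 + ‖d‖ ^ 2 + 2 * (‖a‖ * ‖b‖ + ‖c‖ * ‖d‖) := by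
  have h1 := pow_le_pow_left₀ (norm_nonneg _) (norm_add_le a b) 2
  have h2 := pow_le_pow_left₀ (norm_nonneg _) (norm_add_le c d) 2
  nlinarith

lemma sum_flipAt {x : Bits n} (hx : ∀ H, w (flipAt x H) = w H) (g : (Bits n → ZMod 2) → ℝ) :
    ∑ H, w H * g (flipAt x H) = ∑ H, w H * g H := by
  rw [← Equiv.sum_comp (flipEquiv x) fun H => w H * g H]
  exact Finset.sum_congr rfl fun H _ => by
    rw [show flipEquiv x H = flipAt x H from rfl, hx]

/-- Among the four oracles that differ at two points only, the outcome of a measurement can tell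
the two parities apart only through the even-even, odd-odd and the odd-even, even-odd
interferences. -/
lemma sum_parity_le {x x' : Bits n} (hne : x ≠ x') (Φ : (Bits n → ZMod 2) → QState N)
    (c : ZMod 2) (z : Bits N) (H : Bits n → ZMod 2)
    (g : (Bits n → ZMod 2) → ℝ) (hg : ∀ H, g H = if c = H x + H x' then ‖Φ H z‖ ^ 2 else 0) :
    g H + g (flipAt x H) + (g (flipAt x' H) + g (flipAt x (flipAt x' H))) ≤
      2 * (‖evenPart x (evenPart x' Φ) H z‖ ^ 2 + ‖evenPart x (oddPart x' Φ) H z‖ ^ 2 +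
        ‖oddPart x (evenPart x' Φ) H z‖ ^ 2 + ‖oddPart x (oddPart x' Φ) H z‖ ^ 2) +
      4 * (‖evenPart x (evenPart x' Φ) H z‖ * ‖oddPart x (oddPart x' Φ) H z‖ +
        ‖oddPart x (evenPart x' Φ) H z‖ * ‖evenPart x (oddPart x' Φ) H z‖) := by
  set a := evenPart x (evenPart x' Φ) H z with ha
  set b := evenPart x (oddPart x' Φ) H z with hb
  set c' := oddPart x (evenPart x' Φ) H z with hc
  set d := oddPart x (oddPart x' Φ) H z with hd
  -- Fourier inversion on the group of order four generated by the two flips: each part enters with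
  -- its character as a sign.
  have e1 : Φ H z = (a + d) + (c' + b) := by
    simp only [ha, hb, hc, hd, evenPart, oddPart, Pi.smul_apply, Pi.add_apply, Pi.sub_apply,
      smul_eq_mul]; ring
  have e2 : Φ (flipAt x H) z = (a + -d) + -(c' + -b) := by
    simp only [ha, hb, hc, hd, evenPart, oddPart, Pi.smul_apply, Pi.add_apply, Pi.sub_apply,
      smul_eq_mul, flipAt_comm x' x]; ring
  have e3 : Φ (flipAt x' H) z = (a + -d) + (c' + -b) := by
    simp only [ha, hb, hc, hd, evenPart, oddPart, Pi.smul_apply, Pi.add_apply, Pi.sub_apply,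
      smul_eq_mul, flipAt_comm x' x]; ring
  have e4 : Φ (flipAt x (flipAt x' H)) z = (a + d) + -(c' + b) := by
    simp only [ha, hb, hc, hd, evenPart, oddPart, Pi.smul_apply, Pi.add_apply, Pi.sub_apply,
      smul_eq_mul, flipAt_comm x' x]; ring
  have par : ∀ u v : ℂ, ‖u + v‖ ^ 2 + ‖u + -v‖ ^ 2 = 2 * (‖u‖ ^ 2 + ‖v‖ ^ 2) := by
    intro u v
    have := parallelogram_law_with_norm ℝ u v
    rw [← sub_eq_add_neg]
    nlinarith
  have p1 := par (a + d) (c' + b)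
  have p2 := par (a + -d) (c' + -b)
  have q1 := norm_add_sq_add_norm_add_sq_le a d c' b
  have q2 := norm_add_sq_add_norm_add_sq_le a (-d) c' (-b)
  simp only [norm_neg] at q2
  have two : (1 : ZMod 2) + 1 = 0 := rfl
  rw [hg, hg, hg, hg, e1, e2, e3, e4]
  have v1 : flipAt x H x + flipAt x H x' = H x + H x' + 1 := by
    simp [flipAt_apply, hne.symm]; ring
  have v2 : flipAt x' H x + flipAt x' H x' = H x + H x' + 1 := by
    simp [flipAt_apply, hne]; ring
  have v3 : flipAt x (flipAt x' H) x + flipAt x (flipAt x' H) x' = H x + H x' := by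
    simp only [flipAt_apply, hne, hne.symm, if_true, if_false]
    linear_combination two
  rw [v1, v2, v3]
  -- Either `H` and its double flip count, or the two single flips do. In both cases the cross terms
  -- between `{a, d}` and `{b, c'}` cancel by the parallelogram law.
  have hcc : ∀ c u : ZMod 2, (c = u ∧ c ≠ u + 1) ∨ (c ≠ u ∧ c = u + 1) := by decide
  rcases hcc c (H x + H x') with ⟨h1, h2⟩ | ⟨h1, h2⟩
  · rw [if_pos h1, if_neg h2, if_neg h2, if_pos h1]
    nlinarith
  · rw [if_neg h1, if_pos h2, if_pos h2, if_neg h1]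
    nlinarith

/-- The probability to predict the parity of two values of the oracle. -/
lemma sum_bornProb_parity_le (hw : ∀ H, 0 ≤ w H) {x x' : Bits n}
    (hx : ∀ H, w (flipAt x H) = w H) (hx' : ∀ H, w (flipAt x' H) = w H) (hne : x ≠ x')
    (Φ : (Bits n → ZMod 2) → QState N) (c : Bits N → ZMod 2) :
    ∑ H, w H * bornProb (Φ H) {z | c z = H x + H x'} ≤
      wnorm w Φ / 2 +
      √(wnorm w (evenPart x (evenPart x' Φ))) * √(wnorm w (oddPart x (oddPart x' Φ))) +
      √(wnorm w (oddPart x (evenPart x' Φ))) * √(wnorm w (evenPart x (oddPart x' Φ))) := by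
  classical
  have h1 := sum_norm_mul_norm_le hw (evenPart x (evenPart x' Φ)) (oddPart x (oddPart x' Φ))
  have h2 := sum_norm_mul_norm_le hw (oddPart x (evenPart x' Φ)) (evenPart x (oddPart x' Φ))
  have t1 := wnorm_evenPart_add_oddPart Φ hx'
  have t2 := wnorm_evenPart_add_oddPart (evenPart x' Φ) hx
  have t3 := wnorm_evenPart_add_oddPart (oddPart x' Φ) hx
  have pz : ∀ H, bornProb (Φ H) {z | c z = H x + H x'} +
      bornProb (Φ (flipAt x H)) {z | c z = flipAt x H x + flipAt x H x'} +
      (bornProb (Φ (flipAt x' H)) {z | c z = flipAt x' H x + flipAt x' H x'} +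
      bornProb (Φ (flipAt x (flipAt x' H)))
        {z | c z = flipAt x (flipAt x' H) x + flipAt x (flipAt x' H) x'}) ≤
      2 * (nsq (evenPart x (evenPart x' Φ) H) + nsq (evenPart x (oddPart x' Φ) H) +
        nsq (oddPart x (evenPart x' Φ) H) + nsq (oddPart x (oddPart x' Φ) H)) +
      4 * (∑ z, ‖evenPart x (evenPart x' Φ) H z‖ * ‖oddPart x (oddPart x' Φ) H z‖ +
        ∑ z, ‖oddPart x (evenPart x' Φ) H z‖ * ‖evenPart x (oddPart x' Φ) H z‖) := by
    intro H
    simp only [bornProb, nsq, ← Finset.sum_add_distrib, Finset.mul_sum]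
    refine Finset.sum_le_sum fun z _ => ?_
    exact sum_parity_le hne Φ (c z) z H
      (fun H => Set.indicator {z | c z = H x + H x'} (fun z => ‖Φ H z‖ ^ 2) z)
      (fun H => by simp [Set.indicator_apply])
  set g : (Bits n → ZMod 2) → ℝ := fun H => bornProb (Φ H) {z | c z = H x + H x'} with hg
  have s1 := sum_flipAt hx g
  have s2 := sum_flipAt hx' g
  have s3 : ∑ H, w H * g (flipAt x (flipAt x' H)) = ∑ H, w H * g H := by
    rw [sum_flipAt hx' fun H => g (flipAt x H), s1]
  -- By invariance of the weights the left side is four times the wanted sum, so the constants `2`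
  -- and `4` become `1 / 2` and `1`.
  have tot : ∑ H, w H * (g H + g (flipAt x H) + (g (flipAt x' H) + g (flipAt x (flipAt x' H)))) ≤
      ∑ H, w H * (2 * (nsq (evenPart x (evenPart x' Φ) H) + nsq (evenPart x (oddPart x' Φ) H) +
        nsq (oddPart x (evenPart x' Φ) H) + nsq (oddPart x (oddPart x' Φ) H)) +
      4 * (∑ z, ‖evenPart x (evenPart x' Φ) H z‖ * ‖oddPart x (oddPart x' Φ) H z‖ +
        ∑ z, ‖oddPart x (evenPart x' Φ) H z‖ * ‖evenPart x (oddPart x' Φ) H z‖)) :=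
    Finset.sum_le_sum fun H _ => mul_le_mul_of_nonneg_left (pz H) (hw H)
  simp only [mul_add, Finset.sum_add_distrib, mul_left_comm (w _) (2 : ℝ),
    mul_left_comm (w _) (4 : ℝ), ← Finset.mul_sum] at tot
  rw [s1, s2, s3] at tot
  simp only [wnorm] at *
  linarith

end Acceptance

/-! ### The loss function and its estimates -/

/-- The fourth root of `Λ`, capped at `1`. -/
def capRoot (Λ : ℝ) : ℝ := √√(min 1 Λ)

/-- The loss in the extraction probability of a prover whose loss in the prediction of the parity
is `Λ`. -/
def extractionLoss (Λ : ℝ) : ℝ := √(1 - (1 - capRoot Λ) ^ 2)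

lemma capRoot_nonneg (Λ : ℝ) : 0 ≤ capRoot Λ := Real.sqrt_nonneg _

lemma capRoot_le_one (Λ : ℝ) : capRoot Λ ≤ 1 := by
  exact Real.sqrt_le_one.mpr (Real.sqrt_le_one.mpr (min_le_left _ _))

lemma extractionLoss_le_one (Λ : ℝ) : extractionLoss Λ ≤ 1 := by
  refine Real.sqrt_le_one.mpr ?_
  nlinarith [sq_nonneg (1 - capRoot Λ)]

lemma extractionLoss_of_one_le {Λ : ℝ} (h : 1 ≤ Λ) : extractionLoss Λ = 1 := by
  simp [extractionLoss, capRoot, min_eq_left h]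

lemma capRoot_le_extractionLoss (Λ : ℝ) : capRoot Λ ≤ extractionLoss Λ := by
  apply Real.le_sqrt_of_sq_le
  nlinarith [capRoot_nonneg Λ, capRoot_le_one Λ]

lemma capRoot_of_le_one {Λ : ℝ} (h : Λ ≤ 1) : capRoot Λ = √√Λ := by
  rw [capRoot, min_eq_right h]

/-- The losses `√Λ` and `√√Λ` of the two Markov steps are below the extraction loss, so one function
serves all three bounds of the theorem. -/
lemma sqrt_le_extractionLoss {Λ : ℝ} (h : Λ ≤ 1) : √Λ ≤ extractionLoss Λ := by
  refine le_trans ?_ (capRoot_le_extractionLoss Λ)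
  rw [capRoot_of_le_one h]
  apply Real.le_sqrt_of_sq_le
  have h1 : √Λ ≤ 1 := Real.sqrt_le_one.mpr h
  nlinarith [Real.sqrt_nonneg Λ]

lemma Real.sqrt_add_le_add_sqrt' {a b : ℝ} (ha : 0 ≤ a) (hb : 0 ≤ b) : √(a + b) ≤ √a + √b := by
  rw [Real.sqrt_le_left (by positivity)]
  nlinarith [Real.sq_sqrt ha, Real.sq_sqrt hb, Real.sqrt_nonneg a, Real.sqrt_nonneg b,
    mul_nonneg (Real.sqrt_nonneg a) (Real.sqrt_nonneg b)]

lemma capRoot_add_le {a t : ℝ} (ha : 0 ≤ a) (ht : 0 ≤ t) :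
    capRoot (a + t) ≤ capRoot a + √√t := by
  have h1 : min 1 (a + t) ≤ min 1 a + t := by
    rcases le_total 1 a with h | h
    · rw [min_eq_left h]; linarith [min_le_left 1 (a + t)]
    · rw [min_eq_right h]; exact min_le_right _ _
  calc capRoot (a + t) ≤ √√(min 1 a + t) := Real.sqrt_le_sqrt (Real.sqrt_le_sqrt h1)
    _ ≤ √(√(min 1 a) + √t) :=
        Real.sqrt_le_sqrt (Real.sqrt_add_le_add_sqrt' (le_min zero_le_one ha) ht)
    _ ≤ _ := Real.sqrt_add_le_add_sqrt' (Real.sqrt_nonneg _) (Real.sqrt_nonneg _)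

/-- Splits the cryptographic error `t` off the loss caused by `μ`. Since `1 - (1 - u)² = 2u - u²`,
an increase of `u` by `√√t` raises the radicand by at most `2√√t`. -/
lemma extractionLoss_add_le {a t : ℝ} (ha : 0 ≤ a) (ht : 0 ≤ t) :
    extractionLoss (a + t) ≤ extractionLoss a + √(2 * √√t) := by
  have h := capRoot_add_le ha ht
  have h0 := capRoot_nonneg a
  have h1 := capRoot_le_one a
  have h2 := capRoot_nonneg (a + t)
  have h3 := capRoot_le_one (a + t)
  have h4 := Real.sqrt_nonneg √t
  refine le_trans (Real.sqrt_le_sqrt ?_)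
    (Real.sqrt_add_le_add_sqrt' (by nlinarith) (by positivity))
  nlinarith [mul_nonneg h0 h4]

/-- Two Taylor-type bounds: `(1 - 2ε)^(1/4) ≤ 1 - ε/2` and `√(1 - ε²/4) ≤ 1 - ε²/8`. The polynomial
lower bound is what carries non-negligibility from `ε` to one minus the loss. -/
lemma extractionLoss_le {Λ : ℝ} {ε : ℝ} (h : Λ = 1 - 2 * ε) (hε : ε ∈ Set.Icc (0 : ℝ) (1 / 2)) :
    ε ^ 2 / 8 ≤ 1 - extractionLoss Λ := by
  obtain ⟨h0, h1⟩ := hε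
  have hu : capRoot Λ ≤ 1 - ε / 2 := by
    rw [capRoot_of_le_one (by linarith), Real.sqrt_le_left (by linarith),
      Real.sqrt_le_left (by positivity)]
    nlinarith [sq_nonneg ε, mul_nonneg h0 (sq_nonneg ε), sq_nonneg (ε ^ 2)]
  have : extractionLoss Λ ≤ 1 - ε ^ 2 / 8 := by
    rw [extractionLoss, Real.sqrt_le_left (by nlinarith)]
    nlinarith [capRoot_nonneg Λ, sq_nonneg (ε ^ 2)]
  linarith

/-- From `1 - (1 - u)² ≤ 2u` with `u ≤ (2m)^(1/4)`: one more square root gives the exponent `1/8`.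
The constant `4` is crude. -/
lemma extractionLoss_le_rpow {m : ℝ} (h0 : 0 ≤ m) :
    extractionLoss (2 * m) ≤ 4 * m ^ (1 / 8 : ℝ) := by
  have hu : capRoot (2 * m) ≤ √√(2 * m) :=
    Real.sqrt_le_sqrt (Real.sqrt_le_sqrt (min_le_right _ _))
  have h1 : extractionLoss (2 * m) ≤ √(2 * √√(2 * m)) := by
    refine Real.sqrt_le_sqrt ?_
    nlinarith [sq_nonneg (capRoot (2 * m))]
  have e : √√√m = m ^ (1 / 8 : ℝ) := by
    rw [Real.sqrt_eq_rpow, Real.sqrt_eq_rpow, Real.sqrt_eq_rpow, ← Real.rpow_mul h0,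
      ← Real.rpow_mul h0]
    norm_num
  have h2 : √(2 : ℝ) ≤ 2 := by
    rw [Real.sqrt_le_left (by norm_num)]; norm_num
  have h3 : √√(2 : ℝ) ≤ 2 := (Real.sqrt_le_sqrt h2).trans h2
  have h4 : √√√(2 : ℝ) ≤ 2 := (Real.sqrt_le_sqrt h3).trans h2
  calc extractionLoss (2 * m) ≤ √(2 * √√(2 * m)) := h1
    _ = √2 * (√√√2 * √√√m) := by
        rw [Real.sqrt_mul (by norm_num), Real.sqrt_mul (by norm_num),
          Real.sqrt_mul (Real.sqrt_nonneg _), Real.sqrt_mul (Real.sqrt_nonneg _)]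
    _ ≤ 2 * (2 * √√√m) := by gcongr
    _ = _ := by rw [e]; ring

/-- From the product of two weights to the weights. -/
lemma half_le_of_mul_sqrt {a b T u : ℝ} (ha : 0 ≤ a) (hb : 0 ≤ b) (hT : a + b ≤ T)
    (hu : u ≤ 1) (h : (1 - u) * T ≤ 2 * (√a * √b)) :
    (1 - √(1 - (1 - u) ^ 2)) * T ≤ 2 * a := by
  have hT0 : 0 ≤ T := by linarith
  have h1 : ((1 - u) * T) ^ 2 ≤ 4 * (a * b) := by
    have := pow_le_pow_left₀ (mul_nonneg (by linarith) hT0) h 2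
    calc _ ≤ _ := this
      _ = 4 * ((√a) ^ 2 * (√b) ^ 2) := by ring
      _ = _ := by rw [Real.sq_sqrt ha, Real.sq_sqrt hb]
  -- `(T - 2a)² = T² - 4a(T - a) ≤ T² - 4ab`, and `4ab ≥ (1 - u)² T²` by `h1`.
  have h2 : (T - 2 * a) ^ 2 ≤ (1 - (1 - u) ^ 2) * T ^ 2 := by nlinarith
  have h3 : T - 2 * a ≤ √((1 - (1 - u) ^ 2) * T ^ 2) := Real.le_sqrt_of_sq_le h2
  rw [Real.sqrt_mul' _ (sq_nonneg T), Real.sqrt_sq hT0] at h3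
  linarith

/-! ### Negligible functions, and a Markov inequality -/

lemma Negligible.of_abs_le {f g : ℕ → ℝ} (hg : Negligible g) (h : ∀ s, |f s| ≤ |g s|) :
    Negligible f :=
  Asymptotics.SuperpolynomialDecay.trans_abs_le hg h

/-- `s ^ c * √(f s) = √(s ^ (2c) * f s)`, and the root is continuous at zero. No sign condition is
needed as `√` vanishes on negative numbers. -/
lemma Negligible.sqrt {f : ℕ → ℝ} (hf : Negligible f) : Negligible fun s => √(f s) := by
  intro c
  have h := hf (2 * c)
  have h2 := (Real.continuous_sqrt.tendsto 0).comp h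
  rw [Real.sqrt_zero] at h2
  refine h2.congr fun s => ?_
  simp only [Function.comp_apply]
  rw [pow_mul', Real.sqrt_mul (by positivity), Real.sqrt_sq (by positivity)]

lemma Negligible.const_mul {f : ℕ → ℝ} (hf : Negligible f) (c : ℝ) :
    Negligible fun s => c * f s :=
  Asymptotics.SuperpolynomialDecay.const_mul hf c

lemma Negligible.pow_mul {f : ℕ → ℝ} (hf : Negligible f) {p : ℕ → ℕ} (hp : PolyBounded p)
    (d : ℕ) : Negligible fun s => (p s : ℝ) ^ d * f s := by
  obtain ⟨P, hP⟩ := hp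
  have h := Asymptotics.SuperpolynomialDecay.polynomial_mul hf ((P.map (Nat.castRingHom ℝ)) ^ d)
  refine Negligible.of_abs_le h fun s => ?_
  rw [abs_mul, abs_mul]
  have e : Polynomial.eval (s : ℝ) (P.map (Nat.castRingHom ℝ)) = ((P.eval s : ℕ) : ℝ) := by
    simp
  rw [Polynomial.eval_pow, e, abs_pow, abs_pow, Nat.abs_cast, Nat.abs_cast]
  gcongr
  exact_mod_cast hP s

lemma negligible_two_pow : Negligible fun s => (1 / 2 : ℝ) ^ s := by
  intro c
  exact tendsto_pow_const_mul_const_pow_of_lt_one c (by norm_num) (by norm_num)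

/-- Summing up a weighted Markov inequality: outside a set where the loss is at most `τ * T`, the
total weight is at most `τ`. -/
lemma sum_mul_le_of_loss {ι : Type*} (s : Finset ι) (T L : ι → ℝ) (P : ι → Prop) [DecidablePred P]
    {τ M : ℝ} (hτ : 0 < τ) (hL : ∀ i ∈ s, 0 ≤ L i) (hP : ∀ i ∈ s, ¬ P i → τ * T i ≤ L i)
    (hM : ∑ i ∈ s, L i ≤ τ * M) : ∑ i ∈ s with ¬ P i, T i ≤ M := by
  have : τ * ∑ i ∈ s with ¬ P i, T i ≤ τ * M := by
    rw [Finset.mul_sum]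
    refine le_trans (Finset.sum_le_sum fun i hi => hP i ?_ ?_) (le_trans
      (Finset.sum_le_sum_of_subset_of_nonneg (Finset.filter_subset _ _) fun i hi _ => hL i hi) hM)
    · exact (Finset.mem_filter.mp hi).1
    · exact (Finset.mem_filter.mp hi).2
  exact le_of_mul_le_mul_left this hτ

/-! ### Conditioning on the oracle outside the two preimages -/

/-- The weights of the uniform distribution of the oracle. -/
def unifWeight (n : ℕ) : (Bits n → ZMod 2) → ℝ :=
  fun _ => (Fintype.card (Bits n → ZMod 2) : ℝ)⁻¹

open Classical in
/-- The weights of the uniform distribution restricted to the oracles with a given restriction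
to `S`. -/
def classWeight {n : ℕ} (S : Set (Bits n)) (h : S → ZMod 2) : (Bits n → ZMod 2) → ℝ :=
  fun H => if S.domRestrict H = h then (Fintype.card (Bits n → ZMod 2) : ℝ)⁻¹ else 0

section Weights

variable {n N : ℕ}

lemma unifWeight_nonneg (H : Bits n → ZMod 2) : 0 ≤ unifWeight n H := by
  simp [unifWeight]

lemma classWeight_nonneg (S : Set (Bits n)) (h : S → ZMod 2) (H : Bits n → ZMod 2) :
    0 ≤ classWeight S h H := by
  rw [classWeight]; split_ifs <;> simp

/-- This invariance lets every estimate on even and odd parts be applied within a single class, for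
flips at the two preimages. -/
lemma classWeight_flipAt {S : Set (Bits n)} (h : S → ZMod 2) {x : Bits n} (hx : x ∉ S)
    (H : Bits n → ZMod 2) : classWeight S h (flipAt x H) = classWeight S h H := by
  have : S.domRestrict (flipAt x H) = S.domRestrict H := by
    funext a
    have : (a : Bits n) ≠ x := fun e => hx (e ▸ a.2)
    simp [flipAt_apply, this]
  rw [classWeight, classWeight, this]

lemma sum_classWeight (S : Set (Bits n)) [Fintype (S → ZMod 2)] (g : (Bits n → ZMod 2) → ℝ) :
    ∑ h, ∑ H, classWeight S h H * g H = ∑ H, unifWeight n H * g H := by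
  classical
  rw [Finset.sum_comm]
  refine Finset.sum_congr rfl fun H _ => ?_
  rw [← Finset.sum_mul]
  simp [classWeight, unifWeight]

lemma sum_wnorm_classWeight (S : Set (Bits n)) [Fintype (S → ZMod 2)]
    (Φ : (Bits n → ZMod 2) → QState N) :
    ∑ h, wnorm (classWeight S h) Φ = wnorm (unifWeight n) Φ :=
  sum_classWeight S _

lemma sum_bornProb_fiber {β : Type*} [Fintype β] (ψ : QState N) (E : Set (Bits N))
    (f : Bits N → β) : ∑ y, bornProb ψ (E ∩ {z | f z = y}) = bornProb ψ E := by
  classical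
  simp only [bornProb, Set.indicator_apply]
  rw [Finset.sum_comm]
  refine Finset.sum_congr rfl fun z _ => ?_
  by_cases hz : z ∈ E <;> simp [hz]

end Weights

/-! ### Output probabilities and weights of the four parts -/

namespace Prover

variable {κ n r : ℕ} (A : Prover κ n r) (k : Bits κ)

lemma prAt_eq_sum (l : ℕ) (E : (Bits n → ZMod 2) → Bits A.width → Prop) :
    A.prAt k l E = ∑ H, unifWeight n H * bornProb (A.run k l H) {z | E H z} := by
  rw [prAt, Fintype.expect_eq_sum_div_card, div_eq_inv_mul, Finset.mul_sum]
  rfl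

lemma prAt_nonneg (l : ℕ) (E : (Bits n → ZMod 2) → Bits A.width → Prop) :
    0 ≤ A.prAt k l E := by
  rw [prAt_eq_sum]
  exact Finset.sum_nonneg fun H _ => mul_nonneg (unifWeight_nonneg H) (bornProb_nonneg _ _)

lemma prOut_nonneg (E : (Bits n → ZMod 2) → Bits r → Bits n → ZMod 2 → Prop) :
    0 ≤ A.prOut k E := prAt_nonneg _ _ _ _

lemma sum_prOut_fiber (E : (Bits n → ZMod 2) → Bits r → Bits n → ZMod 2 → Prop) :
    ∑ y, A.prOut k (fun H y' d m => E H y' d m ∧ y' = y) = A.prOut k E := by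
  simp only [prOut, prAt_eq_sum]
  rw [Finset.sum_comm]
  refine Finset.sum_congr rfl fun H _ => ?_
  rw [← Finset.mul_sum]
  congr 1
  exact sum_bornProb_fiber _ {z | E H (z ∘ A.yReg) (z ∘ A.dReg) (z A.mWire)}
    (fun z => z ∘ A.yReg)

/-- The part of the final state with the output `y`. -/
def outPart (y : Bits r) : (Bits n → ZMod 2) → QState A.width :=
  fun H => ({z | z ∘ A.yReg = y} : Set (Bits A.width)).indicator (A.run k A.queries H)

/-- The probability of the output `y`. -/
def outProb (y : Bits r) : ℝ := A.prOut k fun _ y' _ _ => y' = y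

lemma outProb_eq (y : Bits r) : A.outProb k y = wnorm (unifWeight n) (A.outPart k y) := by
  simp only [outProb, prOut, prAt_eq_sum, wnorm, outPart, nsq_indicator]

lemma sum_outProb : ∑ y, A.outProb k y = 1 := by
  have h := A.sum_prOut_fiber k fun _ _ _ _ => True
  simp only [true_and] at h
  rw [show ∑ y, A.outProb k y = _ from h, prOut, prAt_eq_sum]
  have : ∀ H, bornProb (A.run k A.queries H) {z | True} = 1 := fun H => by
    rw [Set.ofPred_true, bornProb_univ]
    exact A.nsq_state k H _
  rw [Finset.sum_congr rfl fun H _ => congrArg _ (this H)]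
  simp [unifWeight]

lemma outProb_nonneg (y : Bits r) : 0 ≤ A.outProb k y := prOut_nonneg _ _ _

lemma prOut_mem (Y : Set (Bits r)) [DecidablePred (· ∈ Y)] :
    A.prOut k (fun _ y _ _ => y ∈ Y) = ∑ y with y ∈ Y, A.outProb k y := by
  rw [← sum_prOut_fiber, Finset.sum_filter]
  refine Finset.sum_congr rfl fun y _ => ?_
  split_ifs with h
  · refine congrArg (A.prOut k) ?_
    funext H y' d m
    exact propext ⟨fun h' => h'.2, fun h' => ⟨h' ▸ h, h'⟩⟩
  · have : (fun (H : Bits n → ZMod 2) y' (d : Bits n) (m : ZMod 2) => y' ∈ Y ∧ y' = y) =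
        fun _ _ _ _ => False := by
      funext H y' d m
      exact propext ⟨fun h' => h (h'.2 ▸ h'.1), False.elim⟩
    rw [this]
    simp [prOut, prAt_eq_sum, bornProb]

lemma prOut_class (S : Set (Bits n)) (h : S → ZMod 2) (y : Bits r) :
    A.prOut k (fun H y' _ _ => S.domRestrict H = h ∧ y' = y) =
      wnorm (classWeight S h) (A.outPart k y) := by
  simp only [prOut, prAt_eq_sum, wnorm, outPart, nsq_indicator]
  refine Finset.sum_congr rfl fun H _ => ?_
  by_cases hH : S.domRestrict H = h
  · simp [hH, unifWeight, classWeight]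
  · simp [hH, classWeight, bornProb]

lemma prOut_class_mem (S : Set (Bits n)) [Fintype (S → ZMod 2)] (C : Set (S → ZMod 2)) [DecidablePred (· ∈ C)]
    (y : Bits r) :
    A.prOut k (fun H y' _ _ => S.domRestrict H ∈ C ∧ y' = y) =
      ∑ h with h ∈ C, wnorm (classWeight S h) (A.outPart k y) := by
  classical
  simp only [prOut, prAt_eq_sum, wnorm, outPart, nsq_indicator]
  rw [Finset.sum_comm]
  refine Finset.sum_congr rfl fun H _ => ?_
  rw [← Finset.sum_mul]
  by_cases hH : S.domRestrict H ∈ C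
  · simp [hH, unifWeight, classWeight]
  · simp [hH, classWeight, bornProb]

/-- Only an inequality, because `hit` also demands that the phase wire is set, while the extractor
looks at the query register alone. -/
lemma wnorm_hit_le_prExt (l : ℕ) (S : Set (Bits n)) (h : S → ZMod 2) (x : Bits n) :
    wnorm (classWeight S h) (fun H => (A.hit x).indicator (A.run k l H)) ≤
      A.prExt k l fun H x' => S.domRestrict H = h ∧ x' = x := by
  simp only [prExt, prAt_eq_sum, wnorm, nsq_indicator]
  refine Finset.sum_le_sum fun H _ => ?_
  by_cases hH : S.domRestrict H = h
  · simp only [classWeight, hH, if_true, unifWeight, true_and]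
    exact mul_le_mul_of_nonneg_left (bornProb_mono _ fun z hz => hz.1) (by positivity)
  · simp [hH, classWeight, bornProb]

/-- The weight of the outputs `y` on the part of the final state that is odd in the values of the
oracle at both points. -/
def clawWeight (y : Bits r) (x : Fin 2 → Bits n) : ℝ :=
  wnorm (unifWeight n) (oddPart (x 0) (oddPart (x 1) (A.outPart k y)))

/-- The weight of the oracles of a class and the output `y` on the part of the final state that is
odd in the value at `x b` and even in the value at the other point. -/
def pointWeight (y : Bits r) (x : Fin 2 → Bits n) (b : Fin 2)
    (h : ({x 0, x 1}ᶜ : Set (Bits n)) → ZMod 2) : ℝ :=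
  wnorm (classWeight _ h) (oddPart (x b) (evenPart (x (1 - b)) (A.outPart k y)))

lemma notMem_compl_pair (x : Fin 2 → Bits n) (b : Fin 2) :
    x b ∉ ({x 0, x 1}ᶜ : Set (Bits n)) := by
  fin_cases b <;> simp

variable (y : Bits r) (x : Fin 2 → Bits n)

lemma pointWeight_nonneg (b : Fin 2) (h : ({x 0, x 1}ᶜ : Set (Bits n)) → ZMod 2) :
    0 ≤ A.pointWeight k y x b h := wnorm_nonneg _ (classWeight_nonneg _ h)

/-- Projecting to the output `y` and to the even part at the other point only decreases the weight;
what remains is odd in the value at `x b` and is paid for by queries there. -/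
lemma pointWeight_le_sum_prExt (b : Fin 2) (h : ({x 0, x 1}ᶜ : Set (Bits n)) → ZMod 2) :
    A.pointWeight k y x b h ≤ ∑ l ∈ Finset.range A.queries,
      A.prExt k l fun H x' => ({x 0, x 1}ᶜ : Set (Bits n)).domRestrict H = h ∧ x' = x b := by
  have hw := classWeight_nonneg ({x 0, x 1}ᶜ : Set (Bits n)) h
  have hx := fun b => classWeight_flipAt h (notMem_compl_pair x b)
  refine le_trans ?_ (Finset.sum_le_sum fun l _ => A.wnorm_hit_le_prExt k l _ h (x b))
  refine le_trans ?_ (A.wnorm_oddPart_run_le k hw (hx b) A.queries)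
  rw [pointWeight, oddPart_evenPart_comm]
  refine (wnorm_evenPart_le _ hw (hx _)).trans ?_
  unfold outPart
  rw [oddPart_indicator]
  exact wnorm_indicator_le _ hw _

/-- The first part lies in the even part at `x 1` and the second in the odd part at `x 1`, and these
two are orthogonal. -/
lemma pointWeight_add_le (h : ({x 0, x 1}ᶜ : Set (Bits n)) → ZMod 2) :
    A.pointWeight k y x 0 h + A.pointWeight k y x 1 h ≤
      wnorm (classWeight _ h) (A.outPart k y) := by
  have hw := classWeight_nonneg ({x 0, x 1}ᶜ : Set (Bits n)) h
  have hx := fun b => classWeight_flipAt h (notMem_compl_pair x b)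
  have h1 : A.pointWeight k y x 0 h ≤ wnorm (classWeight _ h) (evenPart (x 1) (A.outPart k y)) :=
    wnorm_oddPart_le _ hw (hx 0)
  have h2 : A.pointWeight k y x 1 h ≤ wnorm (classWeight _ h) (oddPart (x 1) (A.outPart k y)) := by
    rw [pointWeight, oddPart_evenPart_comm]
    exact wnorm_evenPart_le _ hw (hx _)
  have := wnorm_evenPart_add_oddPart (A.outPart k y) (hx 1)
  linarith

/-- The parity bound in each class, summed. The odd-odd terms are merged by Cauchy–Schwarz, as
claw-freeness controls them only on average over `H`; the other products stay separate, since good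
classes are selected one by one. -/
lemma prOut_accept_le (hne : x 0 ≠ x 1) :
    A.prOut k (fun H y' d m => m = d ⬝ᵥ (x 0 + x 1) + H (x 0) + H (x 1) ∧ y' = y) ≤
      A.outProb k y / 2 + √(A.outProb k y) * √(A.clawWeight k y x) +
        ∑ h, √(A.pointWeight k y x 0 h) * √(A.pointWeight k y x 1 h) := by
  have hw := classWeight_nonneg ({x 0, x 1}ᶜ : Set (Bits n))
  have hx := fun h b => classWeight_flipAt h (notMem_compl_pair x b)
  set c : Bits A.width → ZMod 2 := fun z => z A.mWire - (z ∘ A.dReg) ⬝ᵥ (x 0 + x 1) with hc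
  have e : A.prOut k (fun H y' d m => m = d ⬝ᵥ (x 0 + x 1) + H (x 0) + H (x 1) ∧ y' = y) =
      ∑ h, ∑ H, classWeight ({x 0, x 1}ᶜ : Set (Bits n)) h H *
        bornProb (A.outPart k y H) {z | c z = H (x 0) + H (x 1)} := by
    classical
    rw [sum_classWeight, prOut, prAt_eq_sum]
    refine Finset.sum_congr rfl fun H _ => ?_
    congr 1
    simp only [bornProb, outPart, Set.indicator_apply, Set.mem_ofPred_eq, hc, sub_eq_iff_eq_add']
    refine Finset.sum_congr rfl fun z _ => ?_
    by_cases h1 : z ∘ A.yReg = y <;> simp [h1, add_assoc]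
  have ub : ∀ h, ∑ H, classWeight ({x 0, x 1}ᶜ : Set (Bits n)) h H *
        bornProb (A.outPart k y H) {z | c z = H (x 0) + H (x 1)} ≤
      wnorm (classWeight _ h) (A.outPart k y) / 2 +
      √(wnorm (classWeight _ h) (A.outPart k y)) *
        √(wnorm (classWeight _ h) (oddPart (x 0) (oddPart (x 1) (A.outPart k y)))) +
      √(A.pointWeight k y x 0 h) * √(A.pointWeight k y x 1 h) := by
    intro h
    refine (sum_bornProb_parity_le (hw h) (hx h 0) (hx h 1) hne (A.outPart k y) c).trans ?_
    have h1 : wnorm (classWeight _ h) (evenPart (x 0) (evenPart (x 1) (A.outPart k y))) ≤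
        wnorm (classWeight _ h) (A.outPart k y) :=
      (wnorm_evenPart_le _ (hw h) (hx h 0)).trans (wnorm_evenPart_le _ (hw h) (hx h 1))
    rw [← oddPart_evenPart_comm (x 1) (x 0)]
    exact add_le_add (add_le_add le_rfl
      (mul_le_mul_of_nonneg_right (Real.sqrt_le_sqrt h1) (Real.sqrt_nonneg _))) le_rfl
  rw [e]
  refine (Finset.sum_le_sum fun h _ => ub h).trans ?_
  rw [Finset.sum_add_distrib, Finset.sum_add_distrib, ← Finset.sum_div, sum_wnorm_classWeight,
    ← outProb_eq]
  gcongr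
  refine (Real.sum_sqrt_mul_sqrt_le _ (fun h => wnorm_nonneg _ (hw h))
    (fun h => wnorm_nonneg _ (hw h))).trans_eq ?_
  rw [sum_wnorm_classWeight, sum_wnorm_classWeight, ← outProb_eq]
  rfl

end Prover

/-! ### From the winning probability to good outputs and good classes -/

namespace FunctionPairs

variable (F : FunctionPairs) (s : ℕ)

lemma sum_gen : ∑ k, (F.gen s k).toReal = 1 := by
  rw [← ENNReal.toReal_sum fun k _ => (F.gen s).apply_ne_top k, ← tsum_fintype (L := .unconditional _), PMF.tsum_coe,
    ENNReal.toReal_one]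

lemma keyAvg_mono {f g : Bits (F.keyLen s) → ℝ} (h : ∀ k, f k ≤ g k) :
    F.keyAvg s f ≤ F.keyAvg s g :=
  Finset.sum_le_sum fun k _ => mul_le_mul_of_nonneg_left (h k) ENNReal.toReal_nonneg

lemma keyAvg_const (c : ℝ) : F.keyAvg s (fun _ => c) = c := by
  rw [keyAvg, ← Finset.sum_mul, sum_gen, one_mul]

lemma keyAvg_sqrt_le {f : Bits (F.keyLen s) → ℝ} (hf : ∀ k, 0 ≤ f k) :
    F.keyAvg s (fun k => √(f k)) ≤ √(F.keyAvg s f) := by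
  have h := Real.sum_sqrt_mul_sqrt_le (Finset.univ : Finset (Bits (F.keyLen s)))
    (f := fun k => (F.gen s k).toReal) (g := fun k => (F.gen s k).toReal * f k)
    (fun _ => ENNReal.toReal_nonneg) (fun k => mul_nonneg ENNReal.toReal_nonneg (hf k))
  rw [sum_gen, Real.sqrt_one, one_mul] at h
  refine le_trans (le_of_eq (Finset.sum_congr rfl fun k _ => ?_)) h
  rw [Real.sqrt_mul ENNReal.toReal_nonneg, ← mul_assoc, Real.mul_self_sqrt ENNReal.toReal_nonneg]

lemma ArePreimages.unique {F : FunctionPairs} {s : ℕ} {k : Bits (F.keyLen s)}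
    {y : Bits (F.ranLen s)} {x x' : Fin 2 → Bits (F.domLen s)} (h : F.ArePreimages s k y x)
    (h' : F.ArePreimages s k y x') : x = x' :=
  funext fun b => Set.singleton_injective ((h.2 b).symm.trans (h'.2 b))

/-- The preimages of `y`, if it has preimages. -/
def preim (k : Bits (F.keyLen s)) (y : Bits (F.ranLen s)) : Fin 2 → Bits (F.domLen s) :=
  Classical.epsilon (F.ArePreimages s k y)

lemma ArePreimages.eq_preim {F : FunctionPairs} {s : ℕ} {k : Bits (F.keyLen s)}
    {y : Bits (F.ranLen s)} {x : Fin 2 → Bits (F.domLen s)} (h : F.ArePreimages s k y x) :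
    x = F.preim s k y :=
  h.unique (Classical.epsilon_spec ⟨x, h⟩)

/-- The key `k` and the output `y` are such that `y` has preimages. -/
def HasPreim (k : Bits (F.keyLen s)) (y : Bits (F.ranLen s)) : Prop :=
  F.ArePreimages s k y (F.preim s k y)

variable (A : Prover (F.keyLen s) (F.domLen s) (F.ranLen s))

open Classical in
/-- The weight of the final states, over all outputs `y` with preimages, on the part that is odd in
the values of the oracle at both preimages. -/
def clawMass (k : Bits (F.keyLen s)) : ℝ :=
  ∑ y, if F.HasPreim s k y then A.clawWeight k y (F.preim s k y) else 0

/-- The weight in the output `y` that contributes to the prediction of the parity. -/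
def parityWeight (k : Bits (F.keyLen s)) (y : Bits (F.ranLen s)) : ℝ :=
  ∑ h, 2 * (√(A.pointWeight k y (F.preim s k y) 0 h) * √(A.pointWeight k y (F.preim s k y) 1 h))

open Classical in
/-- The weight in the output `y` that does not contribute to the prediction of the parity. -/
def parityLoss (k : Bits (F.keyLen s)) (y : Bits (F.ranLen s)) : ℝ :=
  A.outProb k y - if F.HasPreim s k y then F.parityWeight s A k y else 0

lemma two_mul_sqrt_mul_sqrt_le {a b : ℝ} (ha : 0 ≤ a) (hb : 0 ≤ b) : 2 * (√a * √b) ≤ a + b := by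
  nlinarith [Real.sq_sqrt ha, Real.sq_sqrt hb, sq_nonneg (√a - √b)]

lemma parity_le_class (k : Bits (F.keyLen s)) (y : Bits (F.ranLen s))
    (x : Fin 2 → Bits (F.domLen s)) (h : ({x 0, x 1}ᶜ : Set (Bits (F.domLen s))) → ZMod 2) :
    2 * (√(A.pointWeight k y x 0 h) * √(A.pointWeight k y x 1 h)) ≤
      wnorm (classWeight _ h) (A.outPart k y) :=
  (two_mul_sqrt_mul_sqrt_le (A.pointWeight_nonneg k y x 0 h)
    (A.pointWeight_nonneg k y x 1 h)).trans (A.pointWeight_add_le k y x h)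

lemma parityWeight_le (k : Bits (F.keyLen s)) (y : Bits (F.ranLen s)) :
    F.parityWeight s A k y ≤ A.outProb k y := by
  rw [Prover.outProb_eq, ← sum_wnorm_classWeight ({F.preim s k y 0, F.preim s k y 1}ᶜ)]
  exact Finset.sum_le_sum fun h _ => F.parity_le_class s A k y _ h

lemma parityLoss_nonneg (k : Bits (F.keyLen s)) (y : Bits (F.ranLen s)) :
    0 ≤ F.parityLoss s A k y := by
  rw [parityLoss]
  split_ifs
  · exact sub_nonneg.mpr (F.parityWeight_le s A k y)
  · simpa using A.outProb_nonneg k y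

open Classical in
lemma clawMass_summand_nonneg (k : Bits (F.keyLen s)) (y : Bits (F.ranLen s)) :
    0 ≤ if F.HasPreim s k y then A.clawWeight k y (F.preim s k y) else 0 := by
  split_ifs
  · exact wnorm_nonneg _ unifWeight_nonneg
  · exact le_rfl

lemma clawMass_nonneg (k : Bits (F.keyLen s)) : 0 ≤ F.clawMass s A k :=
  Finset.sum_nonneg fun y _ => F.clawMass_summand_nonneg s A k y

open Classical in
lemma prOut_accepts_fiber_le (k : Bits (F.keyLen s)) (y : Bits (F.ranLen s)) :
    2 * A.prOut k (fun H y' d m => F.Accepts s k H y' d m ∧ y' = y) ≤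
      2 * A.outProb k y - F.parityLoss s A k y + 2 * (√(A.outProb k y) *
        √(if F.HasPreim s k y then A.clawWeight k y (F.preim s k y) else 0)) := by
  by_cases hy : F.HasPreim s k y
  · have e : (fun (H : Bits (F.domLen s) → ZMod 2) y' d m => F.Accepts s k H y' d m ∧ y' = y) =
        fun H y' d m => m = d ⬝ᵥ (F.preim s k y 0 + F.preim s k y 1) + H (F.preim s k y 0) +
          H (F.preim s k y 1) ∧ y' = y := by
      funext H y' d m
      refine propext ⟨?_, ?_⟩
      · rintro ⟨⟨x, hx, hm⟩, rfl⟩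
        rw [hx.eq_preim] at hm
        exact ⟨hm, rfl⟩
      · rintro ⟨hm, rfl⟩
        exact ⟨⟨_, hy, hm⟩, rfl⟩
    have h := A.prOut_accept_le k y (F.preim s k y) hy.1
    rw [e, parityLoss, if_pos hy, if_pos hy, parityWeight, ← Finset.mul_sum]
    linarith
  · have e : (fun (H : Bits (F.domLen s) → ZMod 2) y' d m => F.Accepts s k H y' d m ∧ y' = y) =
        fun _ _ _ _ => False := by
      funext H y' d m
      refine propext ⟨?_, False.elim⟩
      rintro ⟨⟨x, hx, hm⟩, rfl⟩
      have h := hx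
      rw [hx.eq_preim] at h
      exact hy h
    rw [e, parityLoss, if_neg hy, if_neg hy]
    have h := A.outProb_nonneg k y
    simp [Prover.prOut, Prover.prAt_eq_sum, bornProb]
    linarith

/-- Summing over `y`, Cauchy–Schwarz bounds the odd-odd terms by the root of the total claw mass,
because the output probabilities add up to one. -/
lemma prOut_accepts_le (k : Bits (F.keyLen s)) :
    ∑ y, F.parityLoss s A k y ≤
      2 - 2 * A.prOut k (F.Accepts s k) + 2 * √(F.clawMass s A k) := by
  classical
  have h := Finset.sum_le_sum fun y (_ : y ∈ (Finset.univ : Finset (Bits (F.ranLen s)))) =>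
    F.prOut_accepts_fiber_le s A k y
  have cs := Real.sum_sqrt_mul_sqrt_le (Finset.univ : Finset (Bits (F.ranLen s)))
    (fun y => A.outProb_nonneg k y) (F.clawMass_summand_nonneg s A k)
  rw [A.sum_outProb, Real.sqrt_one, one_mul] at cs
  rw [← Finset.mul_sum, A.sum_prOut_fiber k (F.Accepts s k), Finset.sum_add_distrib,
    Finset.sum_sub_distrib, ← Finset.mul_sum, A.sum_outProb, ← Finset.mul_sum] at h
  have : √(F.clawMass s A k) = √(∑ y, if F.HasPreim s k y then
    A.clawWeight k y (F.preim s k y) else 0) := rfl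
  linarith

/-- Concavity of the root moves the average over keys inside. The bound is the quantity called `Λ`
in the Markov steps. -/
lemma keyAvg_parityLoss_le {m η : ℝ} (hwin : 1 - m ≤ F.winProb s A)
    (hη : F.keyAvg s (F.clawMass s A) ≤ η) :
    F.keyAvg s (fun k => ∑ y, F.parityLoss s A k y) ≤ 2 * m + 2 * √η := by
  have h1 := F.keyAvg_mono s (F.prOut_accepts_le s A)
  have h2 := (F.keyAvg_sqrt_le s (F.clawMass_nonneg s A)).trans (Real.sqrt_le_sqrt hη)
  have e : F.keyAvg s (fun k => 2 - 2 * A.prOut k (F.Accepts s k) + 2 * √(F.clawMass s A k)) =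
      2 - 2 * F.winProb s A + 2 * F.keyAvg s (fun k => √(F.clawMass s A k)) := by
    have h3 : ∑ k, (F.gen s k).toReal * 2 = 2 := F.keyAvg_const s 2
    simp only [winProb, keyAvg, Finset.mul_sum]
    refine Eq.trans ?_ (congrArg (fun t => t - _ + _) h3)
    rw [← Finset.sum_sub_distrib, ← Finset.sum_add_distrib]
    exact Finset.sum_congr rfl fun k _ => by ring
  linarith

/-- The outputs with preimages for which the loss is at most `τ`. -/
def goodOutputs (τ : ℝ) (k : Bits (F.keyLen s)) : Set (Bits (F.ranLen s)) :=
  {y | 0 < A.outProb k y ∧ F.HasPreim s k y ∧ F.parityLoss s A k y ≤ τ * A.outProb k y}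

lemma le_keyAvg_goodOutputs {τ : ℝ} (hτ : 0 < τ) (hτ1 : τ ≤ 1)
    (hL : F.keyAvg s (fun k => ∑ y, F.parityLoss s A k y) ≤ τ * τ) :
    1 - τ ≤ F.keyAvg s (fun k => A.prOut k fun _ y _ _ => y ∈ F.goodOutputs s A τ k) := by
  classical
  have h := sum_mul_le_of_loss (Finset.univ : Finset (Bits (F.keyLen s) × Bits (F.ranLen s)))
    (fun p => (F.gen s p.1).toReal * A.outProb p.1 p.2)
    (fun p => (F.gen s p.1).toReal * F.parityLoss s A p.1 p.2)
    (fun p => p.2 ∈ F.goodOutputs s A τ p.1) (M := τ) hτ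
    (fun p _ => mul_nonneg ENNReal.toReal_nonneg (F.parityLoss_nonneg s A p.1 p.2)) ?_ ?_
  · have h1 := Finset.sum_filter_add_sum_filter_not
      (Finset.univ : Finset (Bits (F.keyLen s) × Bits (F.ranLen s)))
      (fun p => p.2 ∈ F.goodOutputs s A τ p.1)
      (fun p => (F.gen s p.1).toReal * A.outProb p.1 p.2)
    have h2 : ∑ p : Bits (F.keyLen s) × Bits (F.ranLen s),
        (F.gen s p.1).toReal * A.outProb p.1 p.2 = 1 := by
      rw [Fintype.sum_prod_type]
      simp only [← Finset.mul_sum, A.sum_outProb, mul_one]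
      exact F.sum_gen s
    have h3 : F.keyAvg s (fun k => A.prOut k fun _ y _ _ => y ∈ F.goodOutputs s A τ k) =
        ∑ p : Bits (F.keyLen s) × Bits (F.ranLen s) with p.2 ∈ F.goodOutputs s A τ p.1,
          (F.gen s p.1).toReal * A.outProb p.1 p.2 := by
      rw [Finset.sum_filter, Fintype.sum_prod_type]
      refine Finset.sum_congr rfl fun k _ => ?_
      beta_reduce
      rw [A.prOut_mem, Finset.sum_filter, Finset.mul_sum]
      exact Finset.sum_congr rfl fun y _ => by rw [mul_ite, mul_zero]
    linarith
  · rintro ⟨k, y⟩ - hp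
    have hT := A.outProb_nonneg k y
    have hg : 0 ≤ (F.gen s k).toReal := ENNReal.toReal_nonneg
    -- A bad pair has large loss for any of the three reasons: for probability zero it is trivial,
    -- and without preimages the loss is all of `outProb`, at least `τ` times it since `τ ≤ 1`.
    have : τ * A.outProb k y ≤ F.parityLoss s A k y := by
      by_contra hlt
      push Not at hlt
      refine hp ⟨?_, ?_, hlt.le⟩
      · refine hT.lt_of_ne fun h0 => ?_
        rw [← h0, mul_zero] at hlt
        exact hlt.not_ge (F.parityLoss_nonneg s A k y)
      · by_contra hn
        rw [parityLoss, if_neg hn, sub_zero] at hlt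
        nlinarith
    show τ * ((F.gen s k).toReal * A.outProb k y) ≤ (F.gen s k).toReal * F.parityLoss s A k y
    nlinarith
  · rw [Fintype.sum_prod_type]
    simpa only [keyAvg, Finset.mul_sum] using hL

/-- In a class whose interference is nearly maximal, both mixed parts carry nearly half the weight,
and the queries at each point pay for them. Without queries both sides are zero. -/
lemma le_expect_prExt (k : Bits (F.keyLen s)) (y : Bits (F.ranLen s))
    (x : Fin 2 → Bits (F.domLen s)) (h : ({x 0, x 1}ᶜ : Set (Bits (F.domLen s))) → ZMod 2)
    {u : ℝ} (hu : u ≤ 1) (hh : (1 - u) * wnorm (classWeight _ h) (A.outPart k y) ≤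
      2 * (√(A.pointWeight k y x 0 h) * √(A.pointWeight k y x 1 h))) (b : Fin 2) :
    1 / (2 * (A.queries : ℝ)) * (1 - √(1 - (1 - u) ^ 2)) *
        A.prOut k (fun H y' _ _ => Set.domRestrict {x 0, x 1}ᶜ H = h ∧ y' = y) ≤
      Finset.expect (Finset.range A.queries) fun l =>
        A.prExt k l fun H x' => Set.domRestrict {x 0, x 1}ᶜ H = h ∧ x' = x b := by
  have h0 := A.pointWeight_nonneg k y x 0 h
  have h1 := A.pointWeight_nonneg k y x 1 h
  have hle := A.pointWeight_add_le k y x h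
  have key : (1 - √(1 - (1 - u) ^ 2)) * wnorm (classWeight _ h) (A.outPart k y) ≤
      2 * A.pointWeight k y x b h := by
    fin_cases b
    · exact half_le_of_mul_sqrt h0 h1 hle hu hh
    · exact half_le_of_mul_sqrt h1 h0 (by rwa [add_comm]) hu (by rwa [mul_comm (√_)])
  rw [A.prOut_class, Finset.expect_eq_sum_div_card, Finset.card_range]
  calc _ = (A.queries : ℝ)⁻¹ *
        ((1 - √(1 - (1 - u) ^ 2)) * wnorm (classWeight _ h) (A.outPart k y) / 2) := by
        rw [one_div, mul_inv]; ring
    _ ≤ (A.queries : ℝ)⁻¹ * A.pointWeight k y x b h := by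
        gcongr; linarith
    _ ≤ (A.queries : ℝ)⁻¹ * _ :=
        mul_le_mul_of_nonneg_left (A.pointWeight_le_sum_prExt k y x b h) (by positivity)
    _ = _ := by rw [div_eq_inv_mul]

/-- The structure of a successful prover in terms of its loss in the prediction of the parity. -/
lemma exists_goodOutputs {m η : ℝ} (hm : 0 ≤ m) (hwin : 1 - m ≤ F.winProb s A) (hη0 : 0 < η)
    (hη : F.keyAvg s (F.clawMass s A) ≤ η) :
    ∃ Y : Bits (F.keyLen s) → Set (Bits (F.ranLen s)),
      1 - extractionLoss (2 * m + 2 * √η) ≤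
        F.keyAvg s (fun k => A.prOut k fun _ y _ _ => y ∈ Y k) ∧
      ∀ k, ∀ y ∈ Y k,
        0 < A.prOut k (fun _ y' _ _ => y' = y) ∧
        ∃ x : Fin 2 → Bits (F.domLen s), F.ArePreimages s k y x ∧
        ∃ Hgood : Set (({x 0, x 1}ᶜ : Set (Bits (F.domLen s))) → ZMod 2),
          1 - extractionLoss (2 * m + 2 * √η) ≤
            A.prOut k (fun H y' _ _ => Set.domRestrict {x 0, x 1}ᶜ H ∈ Hgood ∧ y' = y) /
              A.prOut k (fun _ y' _ _ => y' = y) ∧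
          ∀ H' ∈ Hgood, ∀ b : Fin 2,
            1 / (2 * (A.queries : ℝ)) * (1 - extractionLoss (2 * m + 2 * √η)) *
                A.prOut k (fun H y' _ _ => Set.domRestrict {x 0, x 1}ᶜ H = H' ∧ y' = y) ≤
              Finset.expect (Finset.range A.queries) fun l =>
                A.prExt k l fun H x' => Set.domRestrict {x 0, x 1}ᶜ H = H' ∧ x' = x b := by
  classical
  set Λ := 2 * m + 2 * √η with hΛ
  have hΛ0 : 0 < Λ := by have := Real.sqrt_pos.mpr hη0; positivity
  -- For `Λ ≥ 1` the loss is `1`, and no good outputs are claimed.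
  rcases le_or_gt 1 Λ with h1 | h1
  · refine ⟨fun _ => ∅, ?_, fun k y hy => absurd hy (Set.notMem_empty y)⟩
    rw [extractionLoss_of_one_le h1, sub_self]
    exact Finset.sum_nonneg fun k _ => mul_nonneg ENNReal.toReal_nonneg (A.prOut_nonneg k _)
  · have hL := F.keyAvg_parityLoss_le s A hwin hη
    have hτ : 0 < √Λ := Real.sqrt_pos.mpr hΛ0
    have hv : 0 < √√Λ := Real.sqrt_pos.mpr hτ
    have hcap := capRoot_of_le_one h1.le
    -- An average loss of `√Λ * √Λ` leaves bad outputs of weight at most `√Λ`.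
    refine ⟨F.goodOutputs s A √Λ, ?_, ?_⟩
    · have h2 := F.le_keyAvg_goodOutputs s A hτ (Real.sqrt_le_one.mpr h1.le)
        (by rwa [Real.mul_self_sqrt hΛ0.le])
      have := sqrt_le_extractionLoss h1.le
      linarith
    · rintro k y ⟨hT, hpre, hloss⟩
      refine ⟨hT, F.preim s k y, hpre, ?_⟩
      set x := F.preim s k y with hx
      -- The second Markov step: a good output has loss at most `√√Λ * √√Λ` relative to its
      -- probability.
      refine ⟨{h | (1 - √√Λ) * wnorm (classWeight _ h) (A.outPart k y) ≤
        2 * (√(A.pointWeight k y x 0 h) * √(A.pointWeight k y x 1 h))}, ?_, ?_⟩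
      · rw [parityLoss, if_pos hpre] at hloss
        change 0 < A.prOut k _ at hT
        rw [le_div_iff₀ hT, A.prOut_class_mem]
        change 0 < A.outProb k y at hT
        have h := sum_mul_le_of_loss
          (Finset.univ : Finset (({x 0, x 1}ᶜ : Set (Bits (F.domLen s))) → ZMod 2))
          (fun h => wnorm (classWeight _ h) (A.outPart k y))
          (fun h => wnorm (classWeight _ h) (A.outPart k y) -
            2 * (√(A.pointWeight k y x 0 h) * √(A.pointWeight k y x 1 h)))
          (fun h => h ∈ {h | (1 - √√Λ) * wnorm (classWeight _ h) (A.outPart k y) ≤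
            2 * (√(A.pointWeight k y x 0 h) * √(A.pointWeight k y x 1 h))})
          (M := √√Λ * A.outProb k y) hv
          (fun h _ => sub_nonneg.mpr (F.parity_le_class s A k y x h)) ?_ ?_
        · have h2 := Finset.sum_filter_add_sum_filter_not
            (Finset.univ : Finset (({x 0, x 1}ᶜ : Set (Bits (F.domLen s))) → ZMod 2))
            (fun h => h ∈ {h | (1 - √√Λ) * wnorm (classWeight _ h) (A.outPart k y) ≤
              2 * (√(A.pointWeight k y x 0 h) * √(A.pointWeight k y x 1 h))})
            (fun h => wnorm (classWeight _ h) (A.outPart k y))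
          rw [sum_wnorm_classWeight, ← A.outProb_eq] at h2
          have h3 := capRoot_le_extractionLoss Λ
          rw [hcap] at h3
          have h4 := mul_le_mul_of_nonneg_right h3 hT.le
          change (1 - extractionLoss Λ) * A.outProb k y ≤ _
          linarith
        · intro h _ hh
          rw [Set.mem_ofPred_eq, not_le] at hh
          linarith
        · rw [Finset.sum_sub_distrib, sum_wnorm_classWeight, ← A.outProb_eq, ← mul_assoc,
            Real.mul_self_sqrt (Real.sqrt_nonneg _)]
          exact hloss
      · intro h hh b
        have := F.le_expect_prExt s A k y x h (Real.sqrt_le_one.mpr (Real.sqrt_le_one.mpr h1.le))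
          hh b
        rwa [extractionLoss, hcap]

end FunctionPairs

/-! ### Odd-odd weight comes from pairs of queries at a claw -/

/-- The oracle call as a linear map. -/
def oracleLin {N n : ℕ} (xs : Fin n ↪ Fin N) (e : Fin N) (H : Bits n → ZMod 2) :
    QState N →ₗ[ℂ] QState N where
  toFun := applyOracle xs e H
  map_add' ψ φ := by
    funext z
    simp [applyOracle_apply, mul_add]
  map_smul' c ψ := by
    funext z
    simp only [applyOracle_apply, Pi.smul_apply, smul_eq_mul, RingHom.id_apply]
    ring

namespace Prover

variable {κ n r : ℕ} (A : Prover κ n r) (k : Bits κ)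

/-- One oracle call and the layer number `l` after it, as a linear map. -/
def step (l : ℕ) (H : Bits n → ZMod 2) : QState A.width →ₗ[ℂ] QState A.width :=
  gatesLin (A.layer l) ∘ₗ oracleLin A.queryReg A.phaseWire H

lemma run_succ' (l : ℕ) (H : Bits n → ZMod 2) :
    A.run k (l + 1) H = A.step (l + 1) H (A.run k l H) := by
  rw [run_succ]; rfl

/-- Project the state before the call number `j + 1` to the queries at `x`, and go on for `i`
calls with the oracle flipped at `x`. -/
def resume (x : Bits n) (j : ℕ) (H : Bits n → ZMod 2) : ℕ → QState A.width
  | 0 => (A.hit x).indicator (A.run k j H)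
  | i + 1 => A.step (j + i + 1) (flipAt x H) (resume x j H i)

/-- The calls with and without the flip differ by the reflection `1 - 2P`, where `P` projects to the
queries at `x`. -/
lemma applyOracle_sub_flipAt (x : Bits n) (H : Bits n → ZMod 2) (ψ : QState A.width) :
    oracleLin A.queryReg A.phaseWire H ψ =
      oracleLin A.queryReg A.phaseWire (flipAt x H) (ψ - (2 : ℂ) • (A.hit x).indicator ψ) := by
  classical
  funext z
  change sgn _ * _ = sgn _ * _
  rw [sgn_flipAt, Pi.sub_apply, Pi.smul_apply, Set.indicator_apply]
  change _ = (if z ∈ A.hit x then _ else _) * _ * _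
  split_ifs
  · simp only [smul_eq_mul]; ring
  · simp

/-- The part of the state that is odd in the value at `x` is a sum over the queries at `x`. -/
lemma oddPart_run_eq_sum (x : Bits n) (l : ℕ) (H : Bits n → ZMod 2) :
    oddPart x (A.run k l) H = -∑ j ∈ Finset.range l, A.resume k x j H (l - j) := by
  induction l with
  | zero => rw [oddPart_run_zero]; simp
  | succ l ih =>
    -- Both runs are advanced with the flipped oracle. The factor `1 / 2` of the odd part cancels
    -- the `2` of the reflection, so the error is exactly one projected state.
    have h1 : oddPart x (A.run k (l + 1)) H =
        A.step (l + 1) (flipAt x H) (oddPart x (A.run k l) H) -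
          A.step (l + 1) (flipAt x H) ((A.hit x).indicator (A.run k l H)) := by
      rw [oddPart, oddPart, run_succ', run_succ', ← map_sub]
      conv_lhs => rw [step, LinearMap.comp_apply, A.applyOracle_sub_flipAt x H]
      change (1 / 2 : ℂ) • (A.step (l + 1) (flipAt x H) _ - _) = _
      rw [← map_sub, ← map_smul]
      congr 1
      funext z
      simp only [Pi.smul_apply, Pi.sub_apply, smul_eq_mul]
      ring
    rw [h1, ih, Finset.sum_range_succ, map_neg, map_sum, neg_add, ← sub_eq_add_neg]
    congr 1
    · congr 1
      refine Finset.sum_congr rfl fun j hj => ?_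
      have hj' := Finset.mem_range.mp hj
      rw [Nat.sub_add_comm hj'.le, resume, show j + (l - j) + 1 = l + 1 by omega]
    · rw [show l + 1 - l = 0 + 1 by omega, resume, resume, add_zero]

lemma nsq_indicator_sum_le {N : ℕ} (E : Set (Bits N)) (l : ℕ) (f : ℕ → QState N) :
    nsq (E.indicator (-∑ j ∈ Finset.range l, f j)) ≤
      l * ∑ j ∈ Finset.range l, nsq (E.indicator (f j)) := by
  classical
  simp only [nsq]
  rw [Finset.sum_comm, Finset.mul_sum]
  refine Finset.sum_le_sum fun z _ => ?_
  simp only [Set.indicator_apply]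
  split_ifs
  · rw [Pi.neg_apply, norm_neg, Finset.sum_apply]
    have h1 := pow_le_pow_left₀ (norm_nonneg _) (norm_sum_le (Finset.range l) fun j => f j z) 2
    refine h1.trans ?_
    have := sq_sum_le_card_mul_sum_sq (s := Finset.range l) (f := fun j => ‖f j z‖)
    rwa [Finset.card_range] at this
  · simp

/-- The weight of the runs that query `x` before the call number `j + 1`, and `x'` another `i`
calls later, with the oracle flipped at `x` in between. -/
def twoQueryWeight (x x' : Bits n) (j i : ℕ) (H : Bits n → ZMod 2) : ℝ :=
  nsq ((A.hit x').indicator (A.resume k x j H i))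

lemma wnorm_hit_oddPart_le (x x' : Bits n) (l : ℕ) :
    wnorm (unifWeight n) (fun H => (A.hit x').indicator (oddPart x (A.run k l) H)) ≤
      l * ∑ j ∈ Finset.range l, ∑ H, unifWeight n H * A.twoQueryWeight k x x' j (l - j) H := by
  rw [Finset.sum_comm, Finset.mul_sum]
  refine Finset.sum_le_sum fun H _ => ?_
  beta_reduce
  rw [oddPart_run_eq_sum, ← Finset.mul_sum, mul_left_comm]
  exact mul_le_mul_of_nonneg_left (nsq_indicator_sum_le _ _ _) (unifWeight_nonneg H)

/-- Odd-odd weight requires a query at one point on the part odd in the other value; expanding that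
part as a sum over earlier queries gives pairs of queries, at the cost of a factor `l` from
Cauchy–Schwarz. -/
lemma clawWeight_le (y : Bits r) (x : Fin 2 → Bits n) (hne : x 0 ≠ x 1) :
    A.clawWeight k y x ≤ ∑ l ∈ Finset.range A.queries, ∑ b : Fin 2, l * ∑ j ∈ Finset.range l,
      ∑ H, unifWeight n H * A.twoQueryWeight k (x b) (x (1 - b)) j (l - j) H := by
  have h1 : A.clawWeight k y x ≤
      wnorm (unifWeight n) (oddPart (x 0) (oddPart (x 1) (A.run k A.queries))) := by
    rw [clawWeight]
    unfold outPart
    rw [oddPart_indicator, oddPart_indicator]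
    exact wnorm_indicator_le _ unifWeight_nonneg _
  refine h1.trans ((A.wnorm_oddPart_oddPart_run_le k unifWeight_nonneg (fun _ => rfl)
    (fun _ => rfl) hne _).trans (Finset.sum_le_sum fun l _ => ?_))
  rw [Fin.sum_univ_two, add_comm]
  exact add_le_add (A.wnorm_hit_oddPart_le k (x 0) (x 1) l) (A.wnorm_hit_oddPart_le k (x 1) (x 0) l)

end Prover

namespace FunctionPairs

variable (F : FunctionPairs) (s : ℕ) (A : Prover (F.keyLen s) (F.domLen s) (F.ranLen s))

open Classical in
/-- The weight of the runs with the oracle `H` that query one point of a claw and, `i` calls later,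
the other one. -/
def findWeight (k : Bits (F.keyLen s)) (b : Fin 2) (j i : ℕ)
    (H : Bits (F.domLen s) → ZMod 2) : ℝ :=
  ∑ x : Fin 2 → Bits (F.domLen s),
    if F.IsClaw s k x then A.twoQueryWeight k (x b) (x (1 - b)) j i H else 0

lemma HasPreim.isClaw {F : FunctionPairs} {s : ℕ} {k : Bits (F.keyLen s)} {y : Bits (F.ranLen s)}
    (h : F.HasPreim s k y) : F.G s k 0 (F.preim s k y 0) = y ∧ F.IsClaw s k (F.preim s k y) := by
  have hb : ∀ b, F.G s k b (F.preim s k y b) = y := fun b => by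
    have : F.preim s k y b ∈ F.G s k b ⁻¹' {y} := by rw [h.2 b]; rfl
    exact this
  exact ⟨hb 0, h.1, (hb 0).trans (hb 1).symm⟩

open Classical in
-- Different outputs have different preimage pairs, since `y` is recovered as the image of the first
-- point. So a sum over outputs is part of a sum over claws.
lemma sum_preim_le (k : Bits (F.keyLen s)) (f : (Fin 2 → Bits (F.domLen s)) → ℝ)
    (hf : ∀ x, 0 ≤ f x) :
    (∑ y, if F.HasPreim s k y then f (F.preim s k y) else 0) ≤
      ∑ x, if F.IsClaw s k x then f x else 0 := by
  rw [← Finset.sum_filter, ← Finset.sum_filter]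
  have hinj : Set.InjOn (F.preim s k)
      (Finset.univ.filter (F.HasPreim s k) : Finset (Bits (F.ranLen s))) := by
    intro y hy y' hy' h
    have h1 := (Finset.mem_filter.mp hy).2.isClaw.1
    have h2 := (Finset.mem_filter.mp hy').2.isClaw.1
    rw [← h1, ← h2, h]
  rw [← Finset.sum_image hinj]
  refine Finset.sum_le_sum_of_subset_of_nonneg ?_ fun x _ _ => hf x
  intro x hx
  obtain ⟨y, hy, rfl⟩ := Finset.mem_image.mp hx
  exact Finset.mem_filter.mpr ⟨Finset.mem_univ _, (Finset.mem_filter.mp hy).2.isClaw.2⟩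

lemma clawMass_le (k : Bits (F.keyLen s)) :
    F.clawMass s A k ≤ ∑ l ∈ Finset.range A.queries, ∑ b : Fin 2, l * ∑ j ∈ Finset.range l,
      ∑ H, unifWeight _ H * F.findWeight s A k b j (l - j) H := by
  classical
  have h0 : ∀ x : Fin 2 → Bits (F.domLen s),
      0 ≤ ∑ l ∈ Finset.range A.queries, ∑ b : Fin 2, (l : ℝ) * ∑ j ∈ Finset.range l,
        ∑ H, unifWeight _ H * A.twoQueryWeight k (x b) (x (1 - b)) j (l - j) H := fun x =>
    Finset.sum_nonneg fun l _ => Finset.sum_nonneg fun b _ => mul_nonneg (Nat.cast_nonneg _)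
      (Finset.sum_nonneg fun j _ => Finset.sum_nonneg fun H _ =>
        mul_nonneg (unifWeight_nonneg H) (nsq_nonneg _))
  have h1 : F.clawMass s A k ≤ ∑ y, if F.HasPreim s k y then
      (fun x : Fin 2 → Bits (F.domLen s) => ∑ l ∈ Finset.range A.queries, ∑ b : Fin 2, (l : ℝ) *
        ∑ j ∈ Finset.range l, ∑ H, unifWeight _ H *
          A.twoQueryWeight k (x b) (x (1 - b)) j (l - j) H) (F.preim s k y) else 0 := by
    refine Finset.sum_le_sum fun y _ => ?_
    split_ifs with hy
    · exact A.clawWeight_le k y _ hy.1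
    · exact le_rfl
  refine (h1.trans (F.sum_preim_le s k _ h0)).trans_eq ?_
  simp only [findWeight, ← Finset.sum_filter, Finset.mul_sum]
  rw [Finset.sum_comm]
  refine Finset.sum_congr rfl fun l _ => ?_
  rw [Finset.sum_comm]
  refine Finset.sum_congr rfl fun b _ => ?_
  rw [Finset.sum_comm]
  refine Finset.sum_congr rfl fun j _ => ?_
  rw [Finset.sum_comm]

/-- If every pair of queries finds claws with probability at most `ε`, then there is little weight
on the part of the final state that is odd in the values at both preimages. -/
lemma keyAvg_clawMass_le {ε : ℝ} (hε0 : 0 ≤ ε)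
    (hε : ∀ b j i, j + i < A.queries →
      F.keyAvg s (fun k => ∑ H, unifWeight _ H * F.findWeight s A k b j i H) ≤ ε) :
    F.keyAvg s (F.clawMass s A) ≤ 2 * A.queries ^ 3 * ε := by
  refine (F.keyAvg_mono s (F.clawMass_le s A)).trans ?_
  have e : F.keyAvg s (fun k => ∑ l ∈ Finset.range A.queries, ∑ b : Fin 2, (l : ℝ) *
      ∑ j ∈ Finset.range l, ∑ H, unifWeight _ H * F.findWeight s A k b j (l - j) H) =
      ∑ l ∈ Finset.range A.queries, ∑ b : Fin 2, (l : ℝ) * ∑ j ∈ Finset.range l,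
        F.keyAvg s (fun k => ∑ H, unifWeight _ H * F.findWeight s A k b j (l - j) H) := by
    simp only [keyAvg]
    simp only [Finset.mul_sum (s := Finset.range _), Finset.mul_sum (s := (Finset.univ : Finset (Fin 2)))]
    rw [Finset.sum_comm]
    refine Finset.sum_congr rfl fun l _ => ?_
    rw [Finset.sum_comm]
    refine Finset.sum_congr rfl fun b _ => ?_
    rw [Finset.sum_comm]
    refine Finset.sum_congr rfl fun j _ => ?_
    rw [Finset.mul_sum]
    refine Finset.sum_congr rfl fun k _ => ?_
    ring
  rw [e]
  set q := A.queries
  have hq : ∀ l ∈ Finset.range q, (l : ℝ) ≤ q := fun l hl => by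
    exact_mod_cast (Finset.mem_range.mp hl).le
  -- One factor `q` for the choice of `l`, one for the Cauchy–Schwarz factor `l`, one for the choice
  -- of `j`, and `2` for the order of the points.
  calc _ ≤ ∑ l ∈ Finset.range q, ∑ b : Fin 2, (q : ℝ) * (q * ε) := by
        refine Finset.sum_le_sum fun l hl => Finset.sum_le_sum fun b _ => ?_
        have h1 : ∑ j ∈ Finset.range l,
            F.keyAvg s (fun k => ∑ H, unifWeight _ H * F.findWeight s A k b j (l - j) H) ≤
            q * ε := by
          refine (Finset.sum_le_card_nsmul _ _ ε fun j hj => hε b j (l - j) ?_).trans ?_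
          · have := Finset.mem_range.mp hl
            have := Finset.mem_range.mp hj
            omega
          · rw [Finset.card_range, nsmul_eq_mul]
            exact mul_le_mul_of_nonneg_right (hq l hl) hε0
        exact (mul_le_mul_of_nonneg_left h1 (Nat.cast_nonneg l)).trans
          (mul_le_mul_of_nonneg_right (hq l hl) (by positivity))
    _ = _ := by
        rw [Finset.sum_const, Finset.card_range]
        simp
        ring

end FunctionPairs

/-! ### The polynomial method: amplitudes have low degree in the oracle -/

/-- The product of the signs of the values of the oracle at the points of a list. -/
def signProd {n : ℕ} (w : List (Bits n)) : (Bits n → ZMod 2) → ℂ :=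
  fun H => (w.map fun x => sgn (H x)).prod

/-- The functions of the oracle that are polynomials of degree at most `d` in the signs of its
values. -/
def lowDeg (n d : ℕ) : Submodule ℂ ((Bits n → ZMod 2) → ℂ) :=
  Submodule.span ℂ {f | ∃ w : List (Bits n), w.length ≤ d ∧ f = signProd w}

section LowDeg

variable {n N N' d d' : ℕ}

lemma signProd_mem {w : List (Bits n)} (h : w.length ≤ d) : signProd w ∈ lowDeg n d :=
  Submodule.subset_span ⟨w, h, rfl⟩

lemma const_mem_lowDeg (c : ℂ) : (fun _ => c) ∈ lowDeg n d := by
  have := (lowDeg n d).smul_mem c (signProd_mem (w := []) (Nat.zero_le _))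
  convert this using 1
  funext H
  simp [signProd]

lemma mul_mem_lowDeg {f g : (Bits n → ZMod 2) → ℂ} (hf : f ∈ lowDeg n d) (hg : g ∈ lowDeg n d') :
    (fun H => f H * g H) ∈ lowDeg n (d + d') := by
  have h := Submodule.mul_mem_mul hf hg
  rw [lowDeg, lowDeg, Submodule.span_mul_span] at h
  refine Submodule.span_mono ?_ h
  rintro _ ⟨_, ⟨w, hw, rfl⟩, _, ⟨w', hw', rfl⟩, rfl⟩
  refine ⟨w ++ w', ?_, ?_⟩
  · rw [List.length_append]; omega
  · funext H
    simp [signProd]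

lemma conj_sgn (a : ZMod 2) : (starRingEnd ℂ) (sgn a) = sgn a := by simp [sgn]

lemma conj_mem_lowDeg {f : (Bits n → ZMod 2) → ℂ} (hf : f ∈ lowDeg n d) :
    (fun H => (starRingEnd ℂ) (f H)) ∈ lowDeg n d := by
  induction hf using Submodule.span_induction with
  | mem f hf =>
    obtain ⟨w, hw, rfl⟩ := hf
    convert signProd_mem hw using 1
    funext H
    simp [signProd, map_list_prod, Function.comp_def, conj_sgn]
  | zero =>
    simp only [Pi.zero_apply, map_zero]
    exact (lowDeg n d).zero_mem
  | add f g _ _ h1 h2 =>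
    simp only [Pi.add_apply, map_add]
    exact (lowDeg n d).add_mem h1 h2
  | smul c f _ h =>
    simp only [Pi.smul_apply, smul_eq_mul, map_mul]
    exact (lowDeg n d).smul_mem ((starRingEnd ℂ) c) h

lemma sum_mem_lowDeg {ι : Type*} (s : Finset ι) {f : ι → (Bits n → ZMod 2) → ℂ}
    (h : ∀ i ∈ s, f i ∈ lowDeg n d) : (fun H => ∑ i ∈ s, f i H) ∈ lowDeg n d := by
  have := (lowDeg n d).sum_mem h
  convert this using 1
  funext H
  simp

lemma linearMap_mem_lowDeg {Φ : (Bits n → ZMod 2) → QState N}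
    (hΦ : ∀ z, (fun H => Φ H z) ∈ lowDeg n d) (f : QState N →ₗ[ℂ] QState N') (z : Bits N') :
    (fun H => f (Φ H) z) ∈ lowDeg n d := by
  have : (fun H => f (Φ H) z) = fun H => ∑ z', f (Pi.single z' 1) z * Φ H z' := by
    funext H
    rw [LinearMap.pi_apply_eq_sum_univ f (Φ H)]
    simp only [Finset.sum_apply, Pi.smul_apply, smul_eq_mul]
    refine Finset.sum_congr rfl fun z' _ => ?_
    rw [mul_comm]
    congr 1
    refine congrArg (fun v => f v z) (funext fun i => ?_)
    simp [Pi.single_apply, eq_comm]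
  rw [this]
  exact sum_mem_lowDeg _ fun z' _ => by
    simpa using mul_mem_lowDeg (d := 0) (const_mem_lowDeg (f (Pi.single z' 1) z)) (hΦ z')

/-- At a fixed basis state the phase is either `1` or the sign of one oracle value, so a call raises
the degree by at most one. -/
lemma oracle_mem_lowDeg (xs : Fin n ↪ Fin N) (e : Fin N) {Φ : (Bits n → ZMod 2) → QState N}
    (hΦ : ∀ z, (fun H => Φ H z) ∈ lowDeg n d) (z : Bits N) :
    (fun H => oracleLin xs e H (Φ H) z) ∈ lowDeg n (d + 1) := by
  rw [add_comm]
  refine mul_mem_lowDeg (f := fun H => sgn (z e * H (z ∘ xs))) ?_ (hΦ z)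
  rcases zmod_two_cases (z e) with h | h
  · simpa [h] using const_mem_lowDeg 1
  · convert signProd_mem (d := 1) (w := [z ∘ xs]) (by simp) using 1
    funext H
    simp [signProd, h]

lemma oracle_flipAt_mem_lowDeg (xs : Fin n ↪ Fin N) (e : Fin N) (x : Bits n)
    {Φ : (Bits n → ZMod 2) → QState N}
    (hΦ : ∀ z, (fun H => Φ H z) ∈ lowDeg n d) (z : Bits N) :
    (fun H => oracleLin xs e (flipAt x H) (Φ H) z) ∈ lowDeg n (d + 1) := by
  classical
  have h := (lowDeg n (d + 1)).smul_mem (if z ∈ hits xs e x then -1 else 1)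
    (oracle_mem_lowDeg xs e hΦ z)
  convert h using 1
  funext H
  change sgn _ * _ = _ * (sgn _ * _)
  rw [sgn_flipAt, mul_assoc]

lemma nsq_mem_lowDeg {Φ : (Bits n → ZMod 2) → QState N}
    (hΦ : ∀ z, (fun H => Φ H z) ∈ lowDeg n d) :
    (fun H => ((nsq (Φ H) : ℝ) : ℂ)) ∈ lowDeg n (d + d) := by
  have : (fun H => ((nsq (Φ H) : ℝ) : ℂ)) =
      fun H => ∑ z, Φ H z * (starRingEnd ℂ) (Φ H z) := by
    funext H
    simp [nsq, Complex.mul_conj']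
  rw [this]
  exact sum_mem_lowDeg _ fun z _ => mul_mem_lowDeg (hΦ z) (conj_mem_lowDeg (hΦ z))

end LowDeg

namespace Prover

variable {κ n r : ℕ} (A : Prover κ n r) (k : Bits κ)

lemma run_mem_lowDeg (l : ℕ) (z : Bits A.width) : (fun H => A.run k l H z) ∈ lowDeg n l := by
  induction l generalizing z with
  | zero => exact const_mem_lowDeg _
  | succ l ih =>
    simp only [run_succ']
    exact linearMap_mem_lowDeg (oracle_mem_lowDeg A.queryReg A.phaseWire ih) _ z

lemma resume_mem_lowDeg (x : Bits n) (j i : ℕ) (z : Bits A.width) :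
    (fun H => A.resume k x j H i z) ∈ lowDeg n (j + i) := by
  classical
  induction i generalizing z with
  | zero =>
    simp only [resume, Set.indicator_apply]
    split_ifs
    · exact A.run_mem_lowDeg k j z
    · exact const_mem_lowDeg 0
  | succ i ih =>
    exact linearMap_mem_lowDeg (oracle_flipAt_mem_lowDeg A.queryReg A.phaseWire x ih) _ z

lemma twoQueryWeight_mem_lowDeg (x x' : Bits n) (j i : ℕ) :
    (fun H => (A.twoQueryWeight k x x' j i H : ℂ)) ∈ lowDeg n (j + i + (j + i)) := by
  classical
  refine nsq_mem_lowDeg fun z => ?_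
  simp only [Set.indicator_apply]
  split_ifs
  · exact A.resume_mem_lowDeg k x j i z
  · exact const_mem_lowDeg 0

end Prover

lemma FunctionPairs.findWeight_mem_lowDeg (F : FunctionPairs) (s : ℕ)
    (A : Prover (F.keyLen s) (F.domLen s) (F.ranLen s)) (k : Bits (F.keyLen s)) (b : Fin 2)
    (j i : ℕ) :
    (fun H => (F.findWeight s A k b j i H : ℂ)) ∈ lowDeg (F.domLen s) (j + i + (j + i)) := by
  classical
  simp only [findWeight, Complex.ofReal_sum]
  refine sum_mem_lowDeg _ fun x _ => ?_
  split_ifs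
  · exact A.twoQueryWeight_mem_lowDeg k _ _ j i
  · exact const_mem_lowDeg _

/-! ### Averages over independent families, and polynomial oracles -/

section Characters

lemma sum_sgn_eq_zero {V : Type*} [Fintype V] [AddGroup V] (f : V → ZMod 2)
    (hf : ∀ a b, f (a + b) = f a + f b) {a : V} (ha : f a ≠ 0) : ∑ v, sgn (f v) = 0 := by
  have h1 : f a = 1 := (zmod_two_cases (f a)).resolve_left ha
  have h := Equiv.sum_comp (Equiv.addLeft a) fun v => sgn (f v)
  simp only [Equiv.coe_addLeft, hf, h1, sgn_add, sgn_one, neg_mul, one_mul,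
    Finset.sum_neg_distrib] at h
  linear_combination (-1 / 2 : ℂ) * h

variable {n : ℕ}

/-- Repeated points cancel in pairs, so a product of signs is a character whose support is no larger
than the length of the list. -/
lemma exists_signProd_eq (w : List (Bits n)) :
    ∃ v : Bits n → ZMod 2, (Finset.univ.filter fun x => v x ≠ 0).card ≤ w.length ∧
      ∀ H, signProd w H = sgn (∑ x, v x * H x) := by
  induction w with
  | nil => exact ⟨0, by simp, fun H => by simp [signProd]⟩
  | cons a w ih =>
    obtain ⟨v, hv, h⟩ := ih
    refine ⟨v + Pi.single a 1, ?_, fun H => ?_⟩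
    · refine (Finset.card_le_card (t := insert a (Finset.univ.filter fun x => v x ≠ 0))
        fun x hx => ?_).trans ((Finset.card_insert_le _ _).trans (by simpa using hv))
      by_cases hxa : x = a
      · simp [hxa]
      · simp [hxa] at hx ⊢
        exact hx
    · rw [show signProd (a :: w) H = sgn (H a) * signProd w H by simp [signProd], h, ← sgn_add]
      simp [add_mul, Finset.sum_add_distrib, Pi.single_apply, add_comm]

/-- A family of oracles `H c`, depending linearly on `c`, such that the characters of at most `d`
values are nontrivial on it. -/
def KWise {V : Type*} [AddGroup V] (d : ℕ) (Hc : V → Bits n → ZMod 2) : Prop :=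
  (∀ a b x, Hc (a + b) x = Hc a x + Hc b x) ∧
    ∀ v : Bits n → ZMod 2, v ≠ 0 → (Finset.univ.filter fun x => v x ≠ 0).card ≤ d →
      ∃ c, ∑ x, v x * Hc c x ≠ 0

lemma kWise_id (d : ℕ) : KWise d (fun H : Bits n → ZMod 2 => H) := by
  refine ⟨fun _ _ _ => rfl, fun v hv _ => ?_⟩
  obtain ⟨x, hx⟩ := Function.ne_iff.mp hv
  refine ⟨Pi.single x 1, ?_⟩
  simpa [Pi.single_apply] using hx

open Classical in
lemma KWise.sum_signProd {V : Type*} [Fintype V] [AddGroup V] {d : ℕ} {Hc : V → Bits n → ZMod 2}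
    (h : KWise d Hc) {v : Bits n → ZMod 2} (hv : (Finset.univ.filter fun x => v x ≠ 0).card ≤ d) :
    ∑ c, sgn (∑ x, v x * Hc c x) = if v = 0 then (Fintype.card V : ℂ) else 0 := by
  split_ifs with h0
  · simp [h0]
  · obtain ⟨c, hc⟩ := h.2 v h0 hv
    exact sum_sgn_eq_zero (fun c => ∑ x, v x * Hc c x)
      (fun a b => by simp only [h.1, mul_add, Finset.sum_add_distrib]) hc

/-- A function of low degree has the same average over a `d`-wise independent family as over all
oracles. -/
lemma KWise.average_eq {V : Type*} [Fintype V] [AddGroup V] {d : ℕ} {Hc : V → Bits n → ZMod 2}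
    (h : KWise d Hc) {f : (Bits n → ZMod 2) → ℂ} (hf : f ∈ lowDeg n d) :
    (Fintype.card V : ℂ) * ∑ H, f H = Fintype.card (Bits n → ZMod 2) * ∑ c, f (Hc c) := by
  classical
  induction hf using Submodule.span_induction with
  | mem f hf =>
    obtain ⟨w, hw, rfl⟩ := hf
    obtain ⟨v, hv, e⟩ := exists_signProd_eq w
    simp only [e]
    rw [h.sum_signProd (hv.trans hw), (kWise_id d).sum_signProd (hv.trans hw)]
    split_ifs <;> ring
  | zero => simp
  | add f g _ _ h1 h2 =>
    simp only [Pi.add_apply, Finset.sum_add_distrib, mul_add, h1, h2]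
  | smul c f _ h1 =>
    simp only [Pi.smul_apply, smul_eq_mul, ← Finset.mul_sum]
    linear_combination c * h1

end Characters

section PolynomialOracle

variable {n : ℕ} {K : Type*} [Field K] [Algebra (ZMod 2) K]

/-- The oracle with the values of one coordinate of the polynomial with coefficients `c` over a
field with `2 ^ n` elements. -/
def polyOracle (φ : K ≃ₗ[ZMod 2] Bits n) (i₀ : Fin n) {D : ℕ} (c : Fin D → K) : Bits n → ZMod 2 :=
  fun x => φ (∑ i : Fin D, c i * φ.symm x ^ (i : ℕ)) i₀

/-- Interpolation: a polynomial of degree below `D` can vanish on all but one of at most `D` points.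
Hence a nonzero `v` with small support has some nonzero power sum `∑ v x • x ^ i`, and a suitable
coefficient of `X ^ i` makes the character nontrivial. -/
lemma kWise_polyOracle (φ : K ≃ₗ[ZMod 2] Bits n) (i₀ : Fin n) (D : ℕ) :
    KWise D (polyOracle φ i₀ : (Fin D → K) → Bits n → ZMod 2) := by
  classical
  refine ⟨fun a b x => ?_, fun v hv hcard => ?_⟩
  · simp [polyOracle, add_mul, Finset.sum_add_distrib]
  obtain ⟨x₀, hx₀⟩ := Function.ne_iff.mp hv
  rw [Pi.zero_apply] at hx₀
  set S := Finset.univ.filter fun x => v x ≠ 0 with hS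
  have hx₀S : x₀ ∈ S := by simp [hS, hx₀]
  set p : Polynomial K := ∏ x ∈ S.erase x₀, (Polynomial.X - Polynomial.C (φ.symm x)) with hp
  have hdeg : p.natDegree < D := by
    rw [hp, Polynomial.natDegree_prod_of_monic _ _ fun x _ => Polynomial.monic_X_sub_C _]
    simp only [Polynomial.natDegree_X_sub_C, Finset.sum_const, smul_eq_mul, mul_one]
    rw [Finset.card_erase_of_mem hx₀S]
    have := Finset.card_pos.mpr ⟨x₀, hx₀S⟩
    omega
  have hne : ∃ i : Fin D, ∑ x, v x • φ.symm x ^ (i : ℕ) ≠ 0 := by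
    by_contra! hall
    have h1 : ∑ x, v x • p.eval (φ.symm x) = 0 := by
      simp only [Polynomial.eval_eq_sum_range' hdeg, Finset.smul_sum]
      rw [Finset.sum_comm]
      refine Finset.sum_eq_zero fun i hi => ?_
      have := hall ⟨i, Finset.mem_range.mp hi⟩
      simp only [← mul_smul_comm, ← Finset.mul_sum]
      rw [show ∑ x, v x • φ.symm x ^ i = 0 from this, mul_zero]
    rw [Finset.sum_eq_single x₀] at h1
    · rcases smul_eq_zero.mp h1 with h2 | h2
      · exact hx₀ h2
      · rw [hp, Polynomial.eval_prod, Finset.prod_eq_zero_iff] at h2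
        obtain ⟨x, hx, h3⟩ := h2
        simp only [Polynomial.eval_sub, Polynomial.eval_X, Polynomial.eval_C, sub_eq_zero] at h3
        exact (Finset.ne_of_mem_erase hx) (φ.symm.injective h3).symm
    · intro x _ hx
      by_cases hvx : v x = 0
      · rw [hvx, zero_smul]
      · rw [hp, Polynomial.eval_prod, Finset.prod_eq_zero (i := x), smul_zero]
        · exact Finset.mem_erase.mpr ⟨hx, by simp [hS, hvx]⟩
        · simp
    · exact fun h => absurd (Finset.mem_univ _) h
  obtain ⟨i, hi⟩ := hne
  set t := ∑ x, v x • φ.symm x ^ (i : ℕ) with ht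
  -- Dividing by the power sum `t` makes the weighted sum of values the field element whose
  -- coordinate `i₀` is `1`.
  refine ⟨Pi.single i (φ.symm (Pi.single i₀ 1) / t), ?_⟩
  have : ∑ x, v x * polyOracle φ i₀ (Pi.single i (φ.symm (Pi.single i₀ 1) / t)) x =
      φ (φ.symm (Pi.single i₀ 1) / t * t) i₀ := by
    rw [ht, Finset.mul_sum, map_sum, Finset.sum_apply]
    refine Finset.sum_congr rfl fun x _ => ?_
    rw [mul_smul_comm, map_smul, Pi.smul_apply, smul_eq_mul, polyOracle,
      Finset.sum_eq_single i (fun i' _ h => by rw [Pi.single_eq_of_ne h, zero_mul])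
        (fun h => absurd (Finset.mem_univ _) h), Pi.single_eq_same]
  rw [this, div_mul_cancel₀ _ hi, LinearEquiv.apply_symm_apply, Pi.single_eq_same]
  exact one_ne_zero

end PolynomialOracle

/-- There is an oracle in a `d`-wise independent family that does at least as well as the average
over all oracles, for a combination of functions of low degree. -/
lemma KWise.exists_le {n : ℕ} {V : Type*} [Fintype V] [AddGroup V] {d : ℕ}
    {Hc : V → Bits n → ZMod 2} (h : KWise d Hc) {f : (Bits n → ZMod 2) → ℝ}
    (hf : (fun H => (f H : ℂ)) ∈ lowDeg n d) : ∃ c, ∑ H, unifWeight n H * f H ≤ f (Hc c) := by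
  have h1 : (Fintype.card V : ℝ) * ∑ H, f H =
      Fintype.card (Bits n → ZMod 2) * ∑ c, f (Hc c) := by
    exact_mod_cast h.average_eq hf
  have hV : (0 : ℝ) < Fintype.card V := by exact_mod_cast Fintype.card_pos
  have hB : (0 : ℝ) < Fintype.card (Bits n → ZMod 2) := by exact_mod_cast Fintype.card_pos
  obtain ⟨c, -, hc⟩ := Finset.exists_le_of_sum_le (s := (Finset.univ : Finset V))
    (f := fun _ => ∑ H, unifWeight n H * f H) (g := fun c => f (Hc c)) ⟨0, Finset.mem_univ _⟩ (by
      rw [Finset.sum_const, Finset.card_univ, nsmul_eq_mul]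
      simp only [unifWeight]
      rw [← Finset.mul_sum, mul_left_comm, h1, inv_mul_cancel_left₀ hB.ne'])
  exact ⟨c, hc⟩

/-! ### Reversible and diagonal gates -/

section Gates

variable {N : ℕ}

lemma exists_gate_of_involutive {m : ℕ} (hm : m ≤ 3) (w : Fin m ↪ Fin N) (π : Bits m → Bits m)
    (hπ : Function.Involutive π) :
    ∃ g : Gate N, ∀ ψ z, g.apply ψ z = ψ (Function.extend w (π (z ∘ w)) z) := by
  classical
  refine ⟨⟨m, hm, w, Matrix.of fun b b' => if b' = π b then 1 else 0, ?_⟩, fun ψ z => ?_⟩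
  · rw [Matrix.mem_unitaryGroup_iff]
    ext b b'
    simp [Matrix.mul_apply, Matrix.star_apply, Matrix.one_apply, hπ.injective.eq_iff,
      @eq_comm _ b']
  · simp [Gate.apply]

lemma exists_gate_diagonal {m : ℕ} (hm : m ≤ 3) (w : Fin m ↪ Fin N) (d : Bits m → ZMod 2) :
    ∃ g : Gate N, ∀ ψ z, g.apply ψ z = sgn (d (z ∘ w)) * ψ z := by
  classical
  refine ⟨⟨m, hm, w, Matrix.diagonal fun b => sgn (d b), ?_⟩, fun ψ z => ?_⟩
  · rw [Matrix.mem_unitaryGroup_iff, Matrix.star_eq_conjTranspose, Matrix.diagonal_conjTranspose,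
      Matrix.diagonal_mul_diagonal, ← Matrix.diagonal_one]
    congr 1
    funext b
    simp [Complex.mul_conj']
  · simp only [Gate.apply, Matrix.diagonal_apply, ite_mul, zero_mul]
    rw [Finset.sum_ite_eq, if_pos (Finset.mem_univ _), extend_self]

/-- Add to the bit on the wire `t` a function of the bits on the wires `a` and `b`. -/
def addOp (t a b : Fin N) (f : ZMod 2 → ZMod 2 → ZMod 2) (z : Bits N) : Bits N :=
  Function.update z t (z t + f (z a) (z b))

lemma addOp_involutive {t a b : Fin N} (ha : a ≠ t) (hb : b ≠ t) (f : ZMod 2 → ZMod 2 → ZMod 2) :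
    Function.Involutive (addOp t a b f) := by
  intro z
  have h2 : ∀ u : ZMod 2, u + u = 0 := by decide
  simp [addOp, Function.update_of_ne ha, Function.update_of_ne hb, add_assoc, h2]

lemma exists_gate_addOp {t a b : Fin N} (ha : a ≠ t) (hb : b ≠ t) (f : ZMod 2 → ZMod 2 → ZMod 2) :
    ∃ g : Gate N, ∀ ψ, g.apply ψ = ψ ∘ addOp t a b f := by
  -- The wires of a gate are distinct, so equal controls need a gate on two wires.
  by_cases hab : a = b
  · subst hab
    have hinj : Function.Injective ![t, a] := by
      intro i j h
      fin_cases i <;> fin_cases j <;> simp_all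
    obtain ⟨g, hg⟩ := exists_gate_of_involutive (by norm_num) ⟨![t, a], hinj⟩
      (addOp 0 1 1 f) (addOp_involutive (by simp) (by simp) f)
    refine ⟨g, fun ψ => funext fun z => ?_⟩
    rw [hg, Function.comp_apply]
    congr 1
    funext i
    by_cases hi : ∃ j, (⟨![t, a], hinj⟩ : Fin 2 ↪ Fin N) j = i
    · obtain ⟨j, rfl⟩ := hi
      rw [(Function.Embedding.injective _).extend_apply]
      fin_cases j
      · simp [addOp]
      · simp [addOp, ha]
    · rw [Function.extend_apply' _ _ _ hi]
      have : i ≠ t := fun h => hi ⟨0, h.symm⟩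
      simp [addOp, this]
  · have hinj : Function.Injective ![t, a, b] := by
      intro i j h
      fin_cases i <;> fin_cases j <;> simp_all
    obtain ⟨g, hg⟩ := exists_gate_of_involutive le_rfl ⟨![t, a, b], hinj⟩
      (addOp 0 1 2 f) (addOp_involutive (by simp) (by simp) f)
    refine ⟨g, fun ψ => funext fun z => ?_⟩
    rw [hg, Function.comp_apply]
    congr 1
    funext i
    by_cases hi : ∃ j, (⟨![t, a, b], hinj⟩ : Fin 3 ↪ Fin N) j = i
    · obtain ⟨j, rfl⟩ := hi
      rw [(Function.Embedding.injective _).extend_apply]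
      fin_cases j
      · simp [addOp]
      · simp [addOp, ha]
      · simp [addOp, hb]
    · rw [Function.extend_apply' _ _ _ hi]
      have : i ≠ t := fun h => hi ⟨0, h.symm⟩
      simp [addOp, this]

lemma exists_gate_sign {e t : Fin N} (h : e ≠ t) :
    ∃ g : Gate N, ∀ ψ z, g.apply ψ z = sgn (z e * z t) * ψ z := by
  have hinj : Function.Injective ![e, t] := by
    intro i j h
    fin_cases i <;> fin_cases j <;> simp_all
  exact exists_gate_diagonal (by norm_num) ⟨![e, t], hinj⟩ fun b => b 0 * b 1

end Gates

/-! ### Straight-line programs for the polynomial oracle -/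

section Derivations

variable {V : ℕ}

/-- `f` is an input bit or a function of the list. -/
def Avail (L : List (Bits V → ZMod 2)) (f : Bits V → ZMod 2) : Prop :=
  f ∈ L ∨ ∃ i, f = fun x => x i

/-- A straight-line program: every function of the list is computed from two functions that come
after it, or input bits. -/
inductive Deriv : List (Bits V → ZMod 2) → Prop
  | nil : Deriv []
  | op {L : List (Bits V → ZMod 2)} {f g : Bits V → ZMod 2} (φ : ZMod 2 → ZMod 2 → ZMod 2) :
      Deriv L → Avail L f → Avail L g → Deriv ((fun x => φ (f x) (g x)) :: L)

lemma Deriv.append {L L' : List (Bits V → ZMod 2)} (h : Deriv L) (h' : Deriv L') :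
    Deriv (L ++ L') := by
  induction h with
  | nil => exact h'
  | op φ _ hf hg ih =>
    exact Deriv.op φ ih (hf.imp_left fun h => List.mem_append_left _ h)
      (hg.imp_left fun h => List.mem_append_left _ h)

/-- The values of the program `σ` on a string with zero ancillas: the inputs are kept, the
ancillas hold the functions of the list `L`, the other ancillas are still zero. -/
structure Computes {s : ℕ} (L : List (Bits V → ZMod 2)) (σ : Bits (V + s) → Bits (V + s)) :
    Prop where
  input : ∀ x i, σ (Fin.append x 0) (Fin.castAdd s i) = x i
  fresh : ∀ x (t : Fin s), L.length ≤ t → σ (Fin.append x 0) (Fin.natAdd V t) = 0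
  value : ∀ f ∈ L, ∃ t : Fin s, (t : ℕ) < L.length ∧
    ∀ x, σ (Fin.append x 0) (Fin.natAdd V t) = f x

lemma Computes.wire {s : ℕ} {L : List (Bits V → ZMod 2)} {σ : Bits (V + s) → Bits (V + s)}
    (h : Computes L σ) {f : Bits V → ZMod 2} (hf : Avail L f) {t : Fin s} (ht : L.length ≤ t) :
    ∃ a, a ≠ Fin.natAdd V t ∧ ∀ x, σ (Fin.append x 0) a = f x := by
  rcases hf with hf | ⟨i, rfl⟩
  · obtain ⟨t', ht', h'⟩ := h.value f hf
    refine ⟨_, fun e => ?_, h'⟩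
    have := congrArg Fin.val e
    simp only [Fin.val_natAdd] at this
    omega
  · refine ⟨Fin.castAdd s i, fun e => ?_, fun x => h.input x i⟩
    have := congrArg Fin.val e
    simp only [Fin.val_natAdd, Fin.val_castAdd] at this
    omega

/-- A straight-line program is implemented by a circuit of reversible gates. -/
lemma Deriv.exists_circuit {L : List (Bits V → ZMod 2)} (hL : Deriv L) {s : ℕ}
    (hs : L.length ≤ s) :
    ∃ (C C' : List (Gate (V + s))) (σ τ : Bits (V + s) → Bits (V + s)),
      C.length = L.length ∧ C'.length = L.length ∧ (∀ ψ, applyGates C ψ = ψ ∘ τ) ∧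
      (∀ ψ, applyGates C' ψ = ψ ∘ σ) ∧ (∀ z, τ (σ z) = z) ∧ Computes L σ := by
  induction hL with
  | nil =>
    refine ⟨[], [], id, id, rfl, rfl, fun _ => rfl, fun _ => rfl, fun _ => rfl, ?_, ?_, ?_⟩
    · intro x i
      simp
    · intro x t _
      simp
    · simp
  | @op L f g φ _ hf hg ih =>
    rw [List.length_cons] at hs
    obtain ⟨C, C', σ, τ, hC, hC', hτ, hσ, hinv, hcomp⟩ := ih (by omega)
    set t : Fin s := ⟨L.length, by omega⟩ with ht
    obtain ⟨a, ha, hfa⟩ := hcomp.wire hf (t := t) le_rfl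
    obtain ⟨b, hb, hgb⟩ := hcomp.wire hg (t := t) le_rfl
    obtain ⟨G, hG⟩ := exists_gate_addOp ha hb φ
    have hne : ∀ i : Fin s, i ≠ t → Fin.natAdd V i ≠ Fin.natAdd V t := fun i hi e =>
      hi (Fin.natAdd_injective _ _ e)
    have hne' : ∀ i : Fin V, Fin.castAdd s i ≠ Fin.natAdd V t := fun i e => by
      have := congrArg Fin.val e
      simp only [Fin.val_natAdd, Fin.val_castAdd] at this
      omega
    -- Gates act on amplitudes by pullback: `C` carries the basis state `z` to `σ z`, and `C'`
    -- undoes it. The new gate is last in the computation and first in the uncomputation.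
    refine ⟨C ++ [G], G :: C', addOp (Fin.natAdd V t) a b φ ∘ σ,
      τ ∘ addOp (Fin.natAdd V t) a b φ, by simp [hC], by simp [hC'], fun ψ => ?_, fun ψ => ?_,
      fun z => ?_, ⟨fun x i => ?_, fun x i hi => ?_, fun f' hf' => ?_⟩⟩
    · rw [applyGates_append, hτ, applyGates_cons, hG]
      rfl
    · rw [applyGates_cons, hG, hσ]
      rfl
    · simp only [Function.comp_apply]
      rw [addOp_involutive ha hb φ, hinv]
    · simp only [Function.comp_apply, addOp]
      rw [Function.update_of_ne (hne' i), hcomp.input]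
    · rw [List.length_cons] at hi
      simp only [Function.comp_apply, addOp]
      rw [Function.update_of_ne (hne i fun e => by rw [e] at hi; simp [ht] at hi),
        hcomp.fresh x i (by omega)]
    · rcases List.mem_cons.mp hf' with rfl | hf'
      · refine ⟨t, by simp [ht], fun x => ?_⟩
        simp only [Function.comp_apply, addOp]
        rw [Function.update_self, hcomp.fresh x t le_rfl, hfa, hgb, zero_add]
      · obtain ⟨i, hi, h⟩ := hcomp.value f' hf'
        refine ⟨i, by simp; omega, fun x => ?_⟩
        simp only [Function.comp_apply, addOp]
        rw [Function.update_of_ne (hne i fun e => by rw [e] at hi; simp [ht] at hi), h]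

/-- The phase oracle of a function with a straight-line program. -/
lemma Deriv.exists_phase {L : List (Bits V → ZMod 2)} (hL : Deriv L) {f : Bits V → ZMod 2}
    (hf : f ∈ L) (e : Fin V) :
    ∃ C : List (Gate (V + L.length)), C.length = 2 * L.length + 1 ∧
      ∀ ψ x, applyGates C ψ (Fin.append x 0) = sgn (x e * f x) * ψ (Fin.append x 0) := by
  obtain ⟨C, C', σ, τ, hC, hC', hτ, hσ, hinv, hcomp⟩ := hL.exists_circuit le_rfl
  obtain ⟨t, -, ht⟩ := hcomp.value f hf
  have hne : Fin.castAdd L.length e ≠ Fin.natAdd V t := fun e => by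
    have := congrArg Fin.val e
    simp only [Fin.val_natAdd, Fin.val_castAdd] at this
    omega
  obtain ⟨g, hg⟩ := exists_gate_sign hne
  -- Compute the value into an ancilla, apply the sign, uncompute.
  refine ⟨C ++ g :: C', ?_, fun ψ x => ?_⟩
  · rw [List.length_append, List.length_cons]
    omega
  · rw [applyGates_append, applyGates_cons, hσ, hτ, Function.comp_apply, hg, hcomp.input, ht,
      Function.comp_apply, hinv]

/-- The functions of the set `S` have a straight-line program of length `m`. -/
def Comp (m : ℕ) (S : Set (Bits V → ZMod 2)) : Prop :=
  ∃ L, Deriv L ∧ L.length ≤ m ∧ ∀ f ∈ S, Avail L f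

variable {m m' : ℕ} {S S' : Set (Bits V → ZMod 2)}

lemma Comp.mono (h : Comp m S) (hm : m ≤ m') (hS : S' ⊆ S) : Comp m' S' := by
  obtain ⟨L, h1, h2, h3⟩ := h
  exact ⟨L, h1, h2.trans hm, fun f hf => h3 f (hS hf)⟩

lemma comp_coords : Comp (V := V) 0 (Set.range fun i x => x i) := by
  refine ⟨[], Deriv.nil, le_rfl, ?_⟩
  rintro _ ⟨i, rfl⟩
  exact Or.inr ⟨i, rfl⟩

lemma Comp.op (h : Comp m S) {f g : Bits V → ZMod 2} (hf : f ∈ S) (hg : g ∈ S)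
    (φ : ZMod 2 → ZMod 2 → ZMod 2) : Comp (m + 1) (insert (fun x => φ (f x) (g x)) S) := by
  obtain ⟨L, h1, h2, h3⟩ := h
  refine ⟨_, Deriv.op φ h1 (h3 f hf) (h3 g hg), by simpa using h2, fun f' hf' => ?_⟩
  rcases hf' with rfl | hf'
  · exact Or.inl List.mem_cons_self
  · exact (h3 f' hf').imp_left fun h => List.mem_cons_of_mem _ h

lemma Comp.union (h : Comp m S) (h' : Comp m' S') : Comp (m + m') (S ∪ S') := by
  obtain ⟨L, h1, h2, h3⟩ := h
  obtain ⟨L', h1', h2', h3'⟩ := h'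
  refine ⟨L ++ L', h1.append h1', by rw [List.length_append]; omega, fun f hf => ?_⟩
  rcases hf with hf | hf
  · exact (h3 f hf).imp_left fun h => List.mem_append_left _ h
  · exact (h3' f hf).imp_left fun h => List.mem_append_right _ h

/-- A sum of functions of pairs of computed functions. -/
lemma Comp.sum (h : Comp m S) (hS : S.Nonempty) {ι : Type*} (I : Finset ι)
    {u v : ι → Bits V → ZMod 2} (hu : ∀ i, u i ∈ S) (hv : ∀ i, v i ∈ S)
    (φ : ι → ZMod 2 → ZMod 2 → ZMod 2) (c : ZMod 2) :
    Comp (m + (2 * I.card + 1)) (insert (fun x => c + ∑ i ∈ I, φ i (u i x) (v i x)) S) := by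
  classical
  induction I using Finset.induction_on with
  | empty =>
    obtain ⟨f, hf⟩ := hS
    simpa using h.op hf hf fun _ _ => c
  | insert i I hi ih =>
    have h1 := ih.op (Set.mem_insert_of_mem _ (hu i)) (Set.mem_insert_of_mem _ (hv i)) (φ i)
    have h2 := h1.op (Set.mem_insert_of_mem _ (Set.mem_insert _ _)) (Set.mem_insert _ _)
      fun a b => a + b
    refine h2.mono (by rw [Finset.card_insert_of_notMem hi]; omega) ?_
    rintro f (rfl | hf)
    · refine Or.inl (funext fun x => ?_)
      rw [Finset.sum_insert hi]
      ring
    · exact Or.inr (Or.inr (Or.inr hf))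

lemma Comp.family {d : ℕ} {ι : Type*} (I : Finset ι) {t : ι → Bits V → ZMod 2}
    (ht : ∀ i m' S', S ⊆ S' → Comp m' S' → Comp (m' + d) (insert (t i) S')) (h : Comp m S) :
    Comp (m + I.card * d) (S ∪ {f | ∃ i ∈ I, f = t i}) := by
  classical
  induction I using Finset.induction_on with
  | empty => simpa using h
  | insert i I hi ih =>
    refine (ht i _ _ Set.subset_union_left ih).mono
      (by rw [Finset.card_insert_of_notMem hi, add_mul]; omega) ?_
    rintro f (hf | ⟨j, hj, rfl⟩)
    · exact Or.inr (Or.inl hf)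
    · rcases Finset.mem_insert.mp hj with rfl | hj
      · exact Or.inl rfl
      · exact Or.inr (Or.inr ⟨j, hj, rfl⟩)

/-- The comparison of two registers. -/
lemma comp_eq {n : ℕ} (a b : Fin n → Fin V) (hV : 0 < V) :
    Comp (2 * n + 1) {fun x : Bits V => if x ∘ a = x ∘ b then 1 else 0} := by
  classical
  have key : ∀ I : Finset (Fin n), Comp (2 * I.card + 1)
      (insert (fun x : Bits V => if ∀ i ∈ I, x (a i) = x (b i) then 1 else 0)
        (Set.range fun i x => x i)) := by
    intro I
    induction I using Finset.induction_on with
    | empty =>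
      have h := comp_coords.op (V := V) ⟨⟨0, hV⟩, rfl⟩ ⟨⟨0, hV⟩, rfl⟩ fun _ _ => 1
      simpa using h
    | insert i I hi ih =>
      have h1 := ih.op (Set.mem_insert_of_mem _ ⟨a i, rfl⟩) (Set.mem_insert_of_mem _ ⟨b i, rfl⟩)
        fun u v => if u = v then 1 else 0
      have h2 := h1.op (Set.mem_insert _ _) (Set.mem_insert_of_mem _ (Set.mem_insert _ _))
        fun u v => u * v
      refine h2.mono (by rw [Finset.card_insert_of_notMem hi]; omega) ?_
      rintro f (rfl | hf)
      · refine Or.inl (funext fun x => ?_)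
        simp only [Finset.forall_mem_insert, ← ite_and, ite_mul, one_mul, zero_mul]
      · exact Or.inr (Or.inr (Or.inr hf))
  refine (key Finset.univ).mono (by simp) ?_
  rintro f rfl
  refine Or.inl (funext fun x => ?_)
  simp [funext_iff]

section Polynomial

variable {n : ℕ} {K : Type*} [Field K] [Algebra (ZMod 2) K] (φ : K ≃ₗ[ZMod 2] Bits n)

/-- Multiplication in the field is bilinear over `ZMod 2`, so each coordinate of a product is a sum
of `n * n` terms, each a product of two bits times a structure constant. -/
lemma coord_mul_eq (u : K) (y : Bits n) (k : Fin n) :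
    φ (u * φ.symm y) k = ∑ p : Fin n × Fin n,
      φ (φ.symm (Pi.single p.1 1) * φ.symm (Pi.single p.2 1)) k * (φ u p.1 * y p.2) := by
  have hsum : ∀ b : Bits n, φ.symm b = ∑ i, b i • φ.symm (Pi.single i 1) := by
    intro b
    conv_lhs => rw [pi_eq_sum_univ' b, map_sum]
    refine Finset.sum_congr rfl fun i _ => ?_
    rw [map_smul]
  conv_lhs => rw [← φ.symm_apply_apply u, hsum (φ u), hsum y, Finset.sum_mul_sum]
  rw [map_sum, Finset.sum_apply, Fintype.sum_prod_type]
  refine Finset.sum_congr rfl fun i _ => ?_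
  rw [map_sum, Finset.sum_apply]
  refine Finset.sum_congr rfl fun j _ => ?_
  rw [smul_mul_smul_comm, map_smul, Pi.smul_apply, smul_eq_mul, mul_comm]

/-- Horner's scheme. Each of the `D` rounds computes `n` coordinates, each with two operations per
term of the bilinear form and one for the new coefficient. -/
lemma comp_polynomial (xs : Fin n → Fin V) (hV : 0 < V) (D : ℕ) (c : Fin D → K) :
    Comp (1 + D * (n * (2 * (n * n) + 1))) ((Set.range fun i (x : Bits V) => x i) ∪
      {f | ∃ k, f = fun x => φ (∑ i : Fin D, c i * φ.symm (x ∘ xs) ^ (i : ℕ)) k}) := by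
  induction D with
  | zero =>
    have h := comp_coords.op (V := V) ⟨⟨0, hV⟩, rfl⟩ ⟨⟨0, hV⟩, rfl⟩ fun _ _ => 0
    refine h.mono (by omega) ?_
    rintro f (hf | ⟨k, rfl⟩)
    · exact Or.inr hf
    · exact Or.inl (funext fun x => by simp)
  | succ D ih =>
    have h := Comp.family (d := 2 * (n * n) + 1) Finset.univ
      (t := fun k x => φ (∑ i : Fin (D + 1), c i * φ.symm (x ∘ xs) ^ (i : ℕ)) k) ?_
      (ih fun i => c i.succ)
    · refine h.mono (by rw [Finset.card_univ, Fintype.card_fin, add_one_mul]; omega) ?_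
      rintro f (hf | ⟨k, rfl⟩)
      · exact Or.inl (Or.inl hf)
      · exact Or.inr ⟨k, Finset.mem_univ _, rfl⟩
    · intro k m' S' hS h
      have h1 := h.sum ⟨_, hS (Or.inl ⟨⟨0, hV⟩, rfl⟩)⟩ (Finset.univ : Finset (Fin n × Fin n))
        (u := fun p x => φ (∑ i : Fin D, c i.succ * φ.symm (x ∘ xs) ^ (i : ℕ)) p.1)
        (v := fun p x => x (xs p.2)) (fun p => hS (Or.inr ⟨p.1, rfl⟩))
        (fun p => hS (Or.inl ⟨xs p.2, rfl⟩))
        (fun p a b => φ (φ.symm (Pi.single p.1 1) * φ.symm (Pi.single p.2 1)) k * (a * b))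
        (φ (c 0) k)
      refine h1.mono (by simp) ?_
      rintro f (rfl | hf)
      · refine Or.inl (funext fun x => ?_)
        have := coord_mul_eq φ (∑ i : Fin D, c i.succ * φ.symm (x ∘ xs) ^ (i : ℕ)) (x ∘ xs) k
        simp only [Function.comp_apply] at this
        rw [← this, ← Pi.add_apply, ← map_add, Fin.sum_univ_succ, Finset.sum_mul]
        simp [pow_succ, mul_assoc]
      · exact Or.inr hf

/-- The oracle of a polynomial, flipped at the point in the register `cs` if the flag is set, has
a straight-line program of polynomial length. -/
lemma exists_deriv_polyOracle (i₀ : Fin n) (xs cs : Fin n → Fin V) (flag : Fin V) {D : ℕ}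
    (c : Fin D → K) :
    ∃ (L : List (Bits V → ZMod 2)) (f : Bits V → ZMod 2), Deriv L ∧ f ∈ L ∧
      L.length ≤ D * (n * (2 * (n * n) + 1)) + 2 * n + 4 ∧
      ∀ x, f x = polyOracle φ i₀ c (x ∘ xs) + x flag * if x ∘ xs = x ∘ cs then 1 else 0 := by
  have hV : 0 < V := flag.pos
  have h := ((comp_polynomial φ xs hV D c).union (comp_eq xs cs hV)).op
    (Or.inl (Or.inl ⟨flag, rfl⟩)) (Or.inr rfl) fun a b => a * b
  obtain ⟨L, h1, h2, h3⟩ := h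
  refine ⟨_, _, Deriv.op (fun a b => a + b) h1 (h3 _ (Or.inr (Or.inl (Or.inr ⟨i₀, rfl⟩))))
    (h3 _ (Or.inl rfl)), List.mem_cons_self, ?_, fun x => rfl⟩
  rw [List.length_cons]
  omega

end Polynomial

end Derivations

/-! ### Running a circuit beside a register and ancillas -/

section Lift

variable {w v s : ℕ}

lemma extend_trans_castAdd {m : ℕ} (e : Fin m ↪ Fin w) (b : Bits m) (x : Bits w) (a : Bits v) :
    Function.extend (e.trans (Fin.castAddEmb v)) b (Fin.append x a) =
      (Fin.append (Function.extend e b x) a : Bits (w + v)) := by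
  funext i
  refine Fin.addCases (fun i => ?_) (fun i => ?_) i
  · rw [Fin.append_left]
    by_cases h : ∃ j, e j = i
    · obtain ⟨j, rfl⟩ := h
      rw [e.injective.extend_apply]
      exact (e.trans (Fin.castAddEmb v)).injective.extend_apply _ _ j
    · rw [Function.extend_apply' _ _ _ h, Function.extend_apply', Fin.append_left]
      rintro ⟨j, hj⟩
      exact h ⟨j, Fin.castAdd_injective _ _ hj⟩
  · rw [Fin.append_right, Function.extend_apply', Fin.append_right]
    rintro ⟨j, hj⟩
    have h1 := congrArg Fin.val hj
    have h2 : ((e.trans (Fin.castAddEmb v)) j : ℕ) < w := (e j).isLt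
    rw [h1, Fin.val_natAdd] at h2
    omega

lemma append_comp_trans_castAdd {m : ℕ} (e : Fin m ↪ Fin w) (x : Bits w) (a : Bits v) :
    (Fin.append x a : Bits (w + v)) ∘ (e.trans (Fin.castAddEmb v)) = x ∘ e := by
  funext i
  exact Fin.append_left x a (e i)

/-- The embedding of the wires of a circuit into a larger one. -/
def mainWires (w v s : ℕ) : Fin w ↪ Fin (w + v + s) :=
  (Fin.castAddEmb v).trans (Fin.castAddEmb s)

/-- A gate on the first wires of a larger circuit. -/
def Gate.lift (v s : ℕ) (g : Gate w) : Gate (w + v + s) where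
  arity := g.arity
  arity_le := g.arity_le
  wires := g.wires.trans (mainWires w v s)
  mat := g.mat
  unitary := g.unitary

/-- The state of the first `w` wires, for given contents `c` of the next `v` wires, and zero on the
last `s` wires. -/
def slice (Ψ : QState (w + v + s)) (c : Bits v) : QState w :=
  fun x => Ψ (Fin.append (Fin.append x c) 0)

lemma slice_lift (g : Gate w) (Ψ : QState (w + v + s)) (c : Bits v) :
    slice ((g.lift v s).apply Ψ) c = g.apply (slice Ψ c) := by
  funext x
  change ∑ b : Bits g.arity,
    g.mat (Fin.append (Fin.append x c) 0 ∘
      ((g.wires.trans (Fin.castAddEmb v)).trans (Fin.castAddEmb s))) b *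
      Ψ (Function.extend ((g.wires.trans (Fin.castAddEmb v)).trans (Fin.castAddEmb s)) b
        (Fin.append (Fin.append x c) 0)) = _
  rw [append_comp_trans_castAdd, append_comp_trans_castAdd]
  simp only [extend_trans_castAdd]
  rfl

lemma slice_applyGates_lift (gs : List (Gate w)) (Ψ : QState (w + v + s)) (c : Bits v) :
    slice (applyGates (gs.map (Gate.lift v s)) Ψ) c = applyGates gs (slice Ψ c) := by
  induction gs generalizing Ψ with
  | nil => rfl
  | cons g gs ih => rw [List.map_cons, applyGates_cons, ih, slice_lift, applyGates_cons]

lemma slice_initState {κ : ℕ} (inp : Fin κ ↪ Fin w) (k : Bits κ) (c : Bits v) :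
    slice (initState (inp.trans (mainWires w v s)) k) c =
      if c = 0 then initState inp k else 0 := by
  classical
  have h0 : (0 : Bits (w + v + s)) = Fin.append (Fin.append (0 : Bits w) (0 : Bits v)) 0 := by
    funext i
    refine Fin.addCases (fun i => ?_) (fun i => ?_) i
    · rw [Fin.append_left]
      refine Fin.addCases (fun i => ?_) (fun i => ?_) i <;> simp
    · simp
  funext x
  simp only [slice, initState, mainWires]
  rw [h0, ← Function.Embedding.trans_assoc, extend_trans_castAdd, extend_trans_castAdd]
  by_cases hc : c = 0
  · subst hc
    simp only [Pi.single_apply, if_true]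
    congr 1
    refine propext ⟨fun h => ?_, fun h => by rw [h]⟩
    funext i
    have := congrFun h (Fin.castAdd s (Fin.castAdd v i))
    simpa only [Fin.append_left] using this
  · rw [if_neg hc, Pi.zero_apply, Pi.single_apply, if_neg]
    intro h
    refine hc (funext fun i => ?_)
    have := congrFun h (Fin.castAdd s (Fin.natAdd w i))
    simpa only [Fin.append_left, Fin.append_right] using this

lemma applyGates_zero {N : ℕ} (gs : List (Gate N)) : applyGates gs 0 = 0 := by
  rw [applyGates_eq, map_zero]

/-- A circuit that adds the contents of the wires `src` to the second register. -/
lemma exists_copy (src : Fin v → Fin w) : ∃ C : List (Gate (w + v + s)), C.length = v ∧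
    ∀ Ψ c x, slice (applyGates C Ψ) c x = slice Ψ (c + x ∘ src) x := by
  have hg : ∀ i : Fin v, ∃ g : Gate (w + v + s), ∀ Ψ, g.apply Ψ =
      Ψ ∘ addOp (Fin.castAdd s (Fin.natAdd w i)) (Fin.castAdd s (Fin.castAdd v (src i)))
        (Fin.castAdd s (Fin.castAdd v (src i))) fun a _ => a := by
    intro i
    have : Fin.castAdd s (Fin.castAdd v (src i)) ≠ Fin.castAdd s (Fin.natAdd w i) := by
      intro h
      have := congrArg Fin.val h
      simp only [Fin.val_natAdd, Fin.val_castAdd] at this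
      omega
    exact exists_gate_addOp this this _
  choose g hg using hg
  have key : ∀ (l : List (Fin v)) (Ψ : QState (w + v + s)) (c : Bits v) (x : Bits w),
      slice (applyGates (l.map g) Ψ) c x =
        slice Ψ (c + (l.map fun i => Pi.single i (x (src i))).sum) x := by
    intro l
    induction l with
    | nil => intro Ψ c x; simp [applyGates]
    | cons i l ih =>
      intro Ψ c x
      rw [List.map_cons, applyGates_cons, ih, hg]
      simp only [slice, Function.comp_apply, addOp, Fin.append_left, Fin.append_right]
      congr 1
      funext t
      refine Fin.addCases (fun t => ?_) (fun t => ?_) t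
      · rw [Fin.append_left]
        refine Fin.addCases (fun t => ?_) (fun t => ?_) t
        · rw [Function.update_of_ne, Fin.append_left, Fin.append_left, Fin.append_left]
          intro h
          have := congrArg Fin.val h
          simp only [Fin.val_natAdd, Fin.val_castAdd] at this
          omega
        · rw [Fin.append_right]
          by_cases ht : t = i
          · subst ht
            rw [Function.update_self]
            simp only [List.map_cons, List.sum_cons, Pi.add_apply, Pi.single_eq_same]
            ring
          · rw [Function.update_of_ne, Fin.append_left, Fin.append_right]
            · simp [ht]
            · intro h
              exact ht (Fin.natAdd_injective _ _ (Fin.castAdd_injective _ _ h))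
      · rw [Fin.append_right, Function.update_of_ne, Fin.append_right]
        intro h
        have := congrArg Fin.val h
        simp only [Fin.val_natAdd, Fin.val_castAdd] at this
        omega
  refine ⟨(List.finRange v).map g, by simp, fun Ψ c x => ?_⟩
  rw [key]
  congr 2
  rw [← List.ofFn_eq_map, List.sum_ofFn]
  funext i
  simp [Finset.sum_apply, Pi.single_apply]

end Lift

/-! ### The claw finder -/

namespace Prover

variable {κ n r : ℕ} (A : Prover κ n r)

/-- The wires of the oracle call: the query register and the phase wire. -/
def callWires : Fin (n + 1) → Fin A.width := Fin.snoc (α := fun _ => Fin A.width) A.queryReg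
  A.phaseWire

/-- If the second register was zero, then after the call wires are copied into it, its content `(x,
1)` is compatible exactly with the basis states that query `x`. The copy thus performs the
projection in `resume` coherently for all `x` at once. -/
lemma add_callWires_eq_zero_iff (x : Bits n) (z : Bits A.width) :
    (Fin.snoc (α := fun _ => ZMod 2) x 1 : Bits (n + 1)) + z ∘ A.callWires = 0 ↔ z ∈ A.hit x := by
  have h2 : ∀ a b : ZMod 2, a + b = 0 ↔ b = a := by decide
  rw [funext_iff, Fin.forall_fin_succ']
  simp only [Pi.add_apply, Function.comp_apply, callWires, Fin.snoc_castSucc, Fin.snoc_last,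
    Pi.zero_apply, h2]
  rw [hit, hits, Set.mem_ofPred_eq, funext_iff]
  rfl

variable {s : ℕ} (O : List (Gate (A.width + (n + 1) + s)))

/-- The run up to the call number `j + 1`, with the circuit `O` in place of the oracle. -/
def simRun : ℕ → List (Gate (A.width + (n + 1) + s))
  | 0 => (A.layer 0).map (Gate.lift (n + 1) s)
  | j + 1 => simRun j ++ (O ++ (A.layer (j + 1)).map (Gate.lift (n + 1) s))

/-- The run from the call number `j + 1` on, for `i` calls, with the circuit `O` in place of the
oracle. -/
def simResume (j : ℕ) : ℕ → List (Gate (A.width + (n + 1) + s))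
  | 0 => []
  | i + 1 => simResume j i ++ (O ++ (A.layer (j + i + 1)).map (Gate.lift (n + 1) s))

lemma length_simRun (j : ℕ) : (A.simRun O j).length =
    ∑ l ∈ Finset.range (j + 1), (A.layer l).length + j * O.length := by
  induction j with
  | zero => simp [simRun]
  | succ j ih =>
    rw [simRun, List.length_append, List.length_append, List.length_map, ih,
      Finset.sum_range_succ _ (j + 1)]
    ring

lemma length_simRun_add_simResume (j i : ℕ) :
    (A.simRun O j).length + (A.simResume O j i).length =
      ∑ l ∈ Finset.range (j + i + 1), (A.layer l).length + (j + i) * O.length := by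
  induction i with
  | zero => simp [simResume, length_simRun]
  | succ i ih =>
    rw [simResume, List.length_append, List.length_append, List.length_map, ← add_assoc, ih,
      ← add_assoc, ← add_assoc j i 1, Finset.sum_range_succ _ (j + i + 1)]
    ring

variable {O} {H : Bits n → ZMod 2}

/-- `O` acts as the oracle `H` if the flag is not set, and as the oracle `H` flipped at the point
in the second register if the flag is set. -/
def Simulates (O : List (Gate (A.width + (n + 1) + s))) (H : Bits n → ZMod 2) : Prop :=
  (∀ Ψ, slice (applyGates O Ψ) 0 = oracleLin A.queryReg A.phaseWire H (slice Ψ 0)) ∧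
  (∀ Ψ c, slice Ψ c = 0 → slice (applyGates O Ψ) c = 0) ∧
  ∀ Ψ x, slice (applyGates O Ψ) (Fin.snoc (α := fun _ => ZMod 2) x 1) =
    oracleLin A.queryReg A.phaseWire (flipAt x H) (slice Ψ (Fin.snoc (α := fun _ => ZMod 2) x 1))

lemma slice_simRun (hO : A.Simulates O H) (k : Bits κ) (j : ℕ) (c : Bits (n + 1)) :
    slice (applyGates (A.simRun O j)
      (initState (A.keyReg.trans (mainWires A.width (n + 1) s)) k)) c =
      if c = 0 then A.run k j H else 0 := by
  induction j generalizing c with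
  | zero =>
    rw [simRun, slice_applyGates_lift, slice_initState]
    split_ifs
    · rfl
    · exact applyGates_zero _
  | succ j ih =>
    rw [simRun, applyGates_append, applyGates_append, slice_applyGates_lift]
    by_cases hc : c = 0
    · subst hc
      rw [hO.1, ih, if_pos rfl, if_pos rfl, applyGates_eq, run_succ']
      rfl
    · rw [hO.2.1 _ c (by rw [ih, if_neg hc]), if_neg hc, applyGates_zero]

lemma slice_simResume (hO : A.Simulates O H) (k : Bits κ) (x : Bits n) (j i : ℕ)
    (Ψ : QState (A.width + (n + 1) + s))
    (hΨ : slice Ψ (Fin.snoc (α := fun _ => ZMod 2) x 1) = (A.hit x).indicator (A.run k j H)) :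
    slice (applyGates (A.simResume O j i) Ψ) (Fin.snoc (α := fun _ => ZMod 2) x 1) =
      A.resume k x j H i := by
  induction i with
  | zero => exact hΨ
  | succ i ih =>
    rw [simResume, applyGates_append, applyGates_append, slice_applyGates_lift, hO.2.2, ih,
      applyGates_eq]
    rfl

/-- The point `x b` is read from the second register and the other one from the query register. The
two-query amplitudes for different pairs sit on different basis states, so their weights add up to
part of one outcome probability. -/
lemma sum_twoQueryWeight_le (k : Bits κ) (b : Fin 2) (j i : ℕ)
    (Ψ : QState (A.width + (n + 1) + s))
    (hΨ : ∀ x, slice Ψ (Fin.snoc (α := fun _ => ZMod 2) x 1) = A.resume k x j H i)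
    (P : (Fin 2 → Bits n) → Prop) [DecidablePred P] :
    (∑ x, if P x then A.twoQueryWeight k (x b) (x (1 - b)) j i H else 0) ≤
      bornProb Ψ {z | P fun b' => if b' = b
        then fun t => z (Fin.castAdd s (Fin.natAdd A.width (Fin.castSucc t)))
        else fun t => z (Fin.castAdd s (Fin.castAdd (n + 1) (A.queryReg t)))} := by
  classical
  set out : Bits (A.width + (n + 1) + s) → Fin 2 → Bits n := fun z b' => if b' = b
        then fun t => z (Fin.castAdd s (Fin.natAdd A.width (Fin.castSucc t)))
        else fun t => z (Fin.castAdd s (Fin.castAdd (n + 1) (A.queryReg t))) with hout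
  set m : (Fin 2 → Bits n) × Bits A.width → Bits (A.width + (n + 1) + s) := fun p =>
    Fin.append (Fin.append p.2 (Fin.snoc (α := fun _ => ZMod 2) (p.1 b) 1)) 0 with hm
  set T : Finset ((Fin 2 → Bits n) × Bits A.width) :=
    Finset.univ.filter fun p => P p.1 ∧ p.2 ∘ A.queryReg = p.1 (1 - b) with hT
  have hom : ∀ p ∈ T, out (m p) = p.1 := by
    intro p hp
    funext b'
    by_cases hb : b' = b
    · subst hb
      simp only [hout, hm, if_true, Fin.append_left, Fin.append_right, Fin.snoc_castSucc]
    · have hb' : b' = 1 - b := by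
        have : ∀ b b' : Fin 2, b' ≠ b → b' = 1 - b := by decide
        exact this b b' hb
      simp only [hout, hm, if_neg hb, Fin.append_left]
      rw [hb', ← (Finset.mem_filter.mp hp).2.2]
      rfl
  have hinj : Set.InjOn m T := by
    intro p hp p' hp' h
    refine Prod.ext ?_ ?_
    · rw [← hom p hp, ← hom p' hp', h]
    · funext t
      have := congrFun h (Fin.castAdd s (Fin.castAdd (n + 1) t))
      simpa only [hm, Fin.append_left] using this
  have h1 : (∑ x, if P x then A.twoQueryWeight k (x b) (x (1 - b)) j i H else 0) ≤
      ∑ p ∈ T, ‖Ψ (m p)‖ ^ 2 := by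
    rw [hT, Finset.sum_filter, Fintype.sum_prod_type]
    refine Finset.sum_le_sum fun x _ => ?_
    split_ifs with hx
    · refine Finset.sum_le_sum fun z _ => ?_
      rw [Set.indicator_apply]
      split_ifs with hz hz'
      · rw [← hΨ]
        exact le_rfl
      · exact absurd ⟨hx, hz.1⟩ hz'
      · simp
      · simp
    · exact Finset.sum_nonneg fun z _ => by split_ifs; exacts [sq_nonneg _, le_rfl]
  refine h1.trans ?_
  rw [← Finset.sum_image (f := fun z => ‖Ψ z‖ ^ 2) hinj, bornProb]
  simp only [Set.indicator_apply]
  rw [← Finset.sum_filter]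
  refine Finset.sum_le_sum_of_subset_of_nonneg (fun z hz => ?_) fun _ _ _ => sq_nonneg _
  obtain ⟨p, hp, rfl⟩ := Finset.mem_image.mp hz
  refine Finset.mem_filter.mpr ⟨Finset.mem_univ _, ?_⟩
  change P (out (m p))
  rw [hom p hp]
  exact (Finset.mem_filter.mp hp).2.1

/-- A claw finder that runs the prover, measures the query before the call number `j + 1`, flips
the oracle at that point, and measures the query after `i` more calls. -/
lemma exists_finder (hO : A.Simulates O H) (b : Fin 2) (j i : ℕ) :
    ∃ B : Finder κ n, B.size = A.width + (n + 1) + s +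
        (∑ l ∈ Finset.range (j + i + 1), (A.layer l).length + (j + i) * O.length + (n + 1)) ∧
      ∀ (k : Bits κ) (P : (Fin 2 → Bits n) → Prop) [DecidablePred P],
        (∑ x, if P x then A.twoQueryWeight k (x b) (x (1 - b)) j i H else 0) ≤ B.prOut k P := by
  obtain ⟨C, hC, hcopy⟩ := exists_copy (s := s) A.callWires
  refine ⟨⟨A.width + (n + 1) + s, A.keyReg.trans (mainWires A.width (n + 1) s),
    A.simRun O j ++ (C ++ A.simResume O j i), fun b' => if b' = b then
      (Fin.castSuccEmb.trans (Fin.natAddEmb A.width)).trans (Fin.castAddEmb s)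
      else A.queryReg.trans (mainWires A.width (n + 1) s)⟩, ?_, fun k P _ => ?_⟩
  · have := A.length_simRun_add_simResume O j i
    simp only [Finder.size, List.length_append, hC]
    omega
  · refine (A.sum_twoQueryWeight_le k b j i (applyGates (A.simRun O j ++ (C ++ A.simResume O j i))
      (initState (A.keyReg.trans (mainWires A.width (n + 1) s)) k)) (fun x => ?_) P).trans_eq ?_
    · rw [applyGates_append, applyGates_append]
      refine A.slice_simResume hO k x j i _ ?_
      funext z
      classical
      rw [hcopy, A.slice_simRun hO, Set.indicator_apply]
      by_cases hz : z ∈ A.hit x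
      · rw [if_pos hz, if_pos ((A.add_callWires_eq_zero_iff x z).mpr hz)]
      · rw [if_neg hz, if_neg fun h => hz ((A.add_callWires_eq_zero_iff x z).mp h)]
        rfl
    · rw [Finder.prOut]
      congr 1
      refine congrArg Set.ofPred (funext fun z => congrArg P (funext fun b' => ?_))
      by_cases hb : b' = b
      · simp only [if_pos hb]
        rfl
      · simp only [if_neg hb]
        rfl

end Prover

namespace Prover

variable {κ n r : ℕ} (A : Prover κ n r)

lemma width_le_size : A.width ≤ A.size := by
  rw [size]; omega

lemma queries_le_size : A.queries ≤ A.size := by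
  rw [size]; omega

lemma le_width : n ≤ A.width := by
  simpa using Fintype.card_le_of_embedding A.queryReg

/-- There is a circuit that simulates a polynomial oracle and its flips. -/
lemma exists_simulates {K : Type*} [Field K] [Algebra (ZMod 2) K] (φ : K ≃ₗ[ZMod 2] Bits n)
    (i₀ : Fin n) {D : ℕ} (c : Fin D → K) :
    ∃ (s : ℕ) (O : List (Gate (A.width + (n + 1) + s))),
      s ≤ D * (n * (2 * (n * n) + 1)) + 2 * n + 4 ∧ O.length = 2 * s + 1 ∧
      A.Simulates O (polyOracle φ i₀ c) := by
  obtain ⟨L, f, hL, hf, hlen, hval⟩ := exists_deriv_polyOracle φ i₀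
    (fun t => Fin.castAdd (n + 1) (A.queryReg t))
    (fun t => Fin.natAdd A.width (Fin.castSucc t)) (Fin.natAdd A.width (Fin.last n)) c
  obtain ⟨O, hO, hphase⟩ := hL.exists_phase hf (Fin.castAdd (n + 1) A.phaseWire)
  -- The last bit of the second register is the flag: it is zero before the copy and switches on the
  -- flip at the recorded point afterwards.
  have key : ∀ Ψ (c' : Bits (n + 1)) x, slice (applyGates O Ψ) c' x =
      sgn (x A.phaseWire * (polyOracle φ i₀ c (x ∘ A.queryReg) + c' (Fin.last n) *
        if x ∘ A.queryReg = c' ∘ Fin.castSucc then 1 else 0)) * slice Ψ c' x := by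
    intro Ψ c' x
    rw [slice, hphase, hval, Fin.append_left, Fin.append_right]
    have e1 : (Fin.append x c' : Bits (A.width + (n + 1))) ∘
        (fun t => Fin.castAdd (n + 1) (A.queryReg t)) = x ∘ A.queryReg :=
      funext fun t => Fin.append_left _ _ _
    have e2 : (Fin.append x c' : Bits (A.width + (n + 1))) ∘
        (fun t => Fin.natAdd A.width (Fin.castSucc t)) = c' ∘ Fin.castSucc :=
      funext fun t => Fin.append_right _ _ _
    rw [e1, e2]
    rfl
  refine ⟨L.length, O, hlen, hO, fun Ψ => ?_, fun Ψ c' h => ?_, fun Ψ x => ?_⟩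
  · funext z
    rw [key, Pi.zero_apply, zero_mul, add_zero]
    rfl
  · funext z
    rw [key, h, Pi.zero_apply, mul_zero]
  · funext z
    rw [key, Fin.snoc_last, one_mul]
    have : (Fin.snoc (α := fun _ => ZMod 2) x 1 : Bits (n + 1)) ∘ Fin.castSucc = x :=
      funext fun t => Fin.snoc_castSucc (α := fun _ => ZMod 2) _ _ _
    rw [this, ← flipAt_apply]
    rfl

end Prover

/-- Fewer than `S` simulated calls, each of order `S ^ 4`, account for the degree five; the
polynomials added on the way only complete the bounds to powers of `S + 1`. -/
lemma finder_size_le {w n q s j i ℓ S : ℕ} (hn : n ≤ w) (hS : w + q + ℓ ≤ S) (hji : j + i < q)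
    (hs : s ≤ (j + i + (j + i)) * (n * (2 * (n * n) + 1)) + 2 * n + 4) :
    w + (n + 1) + s + (ℓ + (j + i) * (2 * s + 1) + (n + 1)) ≤ 17 * (S + 1) ^ 5 := by
  have hnS : n ≤ S := by omega
  have hs' : s ≤ 4 * (S + 1) ^ 4 := by
    calc s ≤ (j + i + (j + i)) * (n * (2 * (n * n) + 1)) + 2 * n + 4 := hs
      _ ≤ (S + S) * (S * (2 * (S * S) + 1)) + 2 * S + 4 := by gcongr <;> omega
      _ ≤ (S + S) * (S * (2 * (S * S) + 1)) + 2 * S + 4 +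
          (16 * S ^ 3 + 22 * S ^ 2 + 14 * S) := Nat.le_add_right _ _
      _ = _ := by ring
  calc w + (n + 1) + s + (ℓ + (j + i) * (2 * s + 1) + (n + 1))
      ≤ S + (S + 1) + s + (S + S * (2 * s + 1) + (S + 1)) := by gcongr <;> omega
    _ = 5 * S + 2 + s + 2 * S * s := by ring
    _ ≤ 5 * S + 2 + 4 * (S + 1) ^ 4 + 2 * S * (4 * (S + 1) ^ 4) := by gcongr
    _ ≤ 5 * S + 2 + 4 * (S + 1) ^ 4 + 2 * S * (4 * (S + 1) ^ 4) +
        (9 * S ^ 5 + 49 * S ^ 4 + 106 * S ^ 3 + 114 * S ^ 2 + 56 * S + 11) := Nat.le_add_right _ _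
    _ = _ := by ring

/-! ### Claw-freeness makes the odd-odd weight negligible -/

namespace FunctionPairs

variable (F : FunctionPairs) (s : ℕ) (A : Prover (F.keyLen s) (F.domLen s) (F.ranLen s))

/-- The probability that `B` finds a claw for a random key. -/
def clawProb (B : Finder (F.keyLen s) (F.domLen s)) : ℝ :=
  F.keyAvg s fun k => B.prOut k (F.IsClaw s k)

lemma clawProb_nonneg (B : Finder (F.keyLen s) (F.domLen s)) : 0 ≤ F.clawProb s B :=
  Finset.sum_nonneg fun _ _ => mul_nonneg ENNReal.toReal_nonneg (bornProb_nonneg _ _)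

/-- The weight of a pair of queries on claws is at most the success probability of a claw finder
whose size is polynomial in the size of the prover. -/
lemma exists_finder_of_findWeight (b : Fin 2) (j i : ℕ) (hji : j + i < A.queries) :
    ∃ B : Finder (F.keyLen s) (F.domLen s), B.size ≤ 17 * (A.size + 1) ^ 5 ∧
      F.keyAvg s (fun k => ∑ H, unifWeight _ H * F.findWeight s A k b j i H) ≤
        F.clawProb s B := by
  classical
  -- A domain with a single point has no claws, and there is no field with `2 ^ 0` elements.
  rcases Nat.eq_zero_or_pos (F.domLen s) with h0 | h0
  · refine ⟨⟨A.width, A.keyReg, [], fun _ => A.queryReg⟩, ?_, ?_⟩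
    · calc A.width + 0 ≤ A.size := A.width_le_size
        _ ≤ (A.size + 1) ^ 5 := (Nat.le_succ _).trans (Nat.le_self_pow (by norm_num) _)
        _ ≤ _ := Nat.le_mul_of_pos_left _ (by norm_num)
    · refine le_trans (le_of_eq ?_) (F.clawProb_nonneg s _)
      have : IsEmpty (Fin (F.domLen s)) := by rw [h0]; infer_instance
      have hno : ∀ k x, ¬ F.IsClaw s k x := fun k x h => h.1 (Subsingleton.elim _ _)
      simp [findWeight, hno, keyAvg]
  · have : Fact (Nat.Prime 2) := ⟨Nat.prime_two⟩
    let K := GaloisField 2 (F.domLen s)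
    have : Fintype K := Fintype.ofFinite K
    have φ : K ≃ₗ[ZMod 2] Bits (F.domLen s) := LinearEquiv.ofFinrankEq _ _ (by
      rw [GaloisField.finrank 2 h0.ne', Module.finrank_fintype_fun_eq_card, Fintype.card_fin])
    -- The average over keys is taken inside, so that one choice of coefficients serves all keys.
    -- The degree doubles from amplitudes to weights.
    obtain ⟨c, hc⟩ := (kWise_polyOracle φ ⟨0, h0⟩ (j + i + (j + i))).exists_le
      (f := fun H => F.keyAvg s fun k => F.findWeight s A k b j i H) (by
        simp only [keyAvg, Complex.ofReal_sum, Complex.ofReal_mul]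
        refine sum_mem_lowDeg _ fun k _ => ?_
        simpa using mul_mem_lowDeg (d := 0) (const_mem_lowDeg _)
          (F.findWeight_mem_lowDeg s A k b j i))
    obtain ⟨t, O, ht, hlen, hO⟩ := A.exists_simulates φ ⟨0, h0⟩ c
    obtain ⟨B, hB, hprob⟩ := A.exists_finder hO b j i
    refine ⟨B, ?_, ?_⟩
    · rw [hB, hlen]
      refine finder_size_le A.le_width ?_ hji ht
      rw [Prover.size]
      gcongr
    · refine le_trans (le_of_eq ?_) (hc.trans (F.keyAvg_mono s fun k => hprob k (F.IsClaw s k)))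
      simp only [keyAvg, Finset.mul_sum]
      rw [Finset.sum_comm]
      exact Finset.sum_congr rfl fun H _ => Finset.sum_congr rfl fun k _ => mul_left_comm _ _ _

/-- The weight of the final states on the part that is odd in the values at both preimages is
bounded by the success probability of a claw finder. -/
lemma exists_finder_of_clawMass :
    ∃ B : Finder (F.keyLen s) (F.domLen s), B.size ≤ 17 * (A.size + 1) ^ 5 ∧
      F.keyAvg s (F.clawMass s A) ≤ 2 * A.queries ^ 3 * F.clawProb s B := by
  have h := F.exists_finder_of_findWeight s A
  set T : Finset (Fin 2 × ℕ × ℕ) := (Finset.univ ×ˢ Finset.range A.queries ×ˢ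
    Finset.range A.queries).filter fun t => t.2.1 + t.2.2 < A.queries with hT
  rcases Nat.eq_zero_or_pos A.queries with h0 | h0
  · refine ⟨⟨A.width, A.keyReg, [], fun _ => A.queryReg⟩, ?_, ?_⟩
    · calc A.width + 0 ≤ A.size := A.width_le_size
        _ ≤ (A.size + 1) ^ 5 := (Nat.le_succ _).trans (Nat.le_self_pow (by norm_num) _)
        _ ≤ _ := Nat.le_mul_of_pos_left _ (by norm_num)
    · exact F.keyAvg_clawMass_le s A (F.clawProb_nonneg s _) fun b j i hji => by omega
  -- The finder is built for the most successful order of points and pair of query positions, fixed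
  -- nonuniformly.
  · obtain ⟨t, ht, hmax⟩ := T.exists_max_image (fun t => F.keyAvg s fun k =>
      ∑ H, unifWeight _ H * F.findWeight s A k t.1 t.2.1 t.2.2 H) ⟨(0, 0, 0), by simp [hT, h0]⟩
    obtain ⟨B, hB, hprob⟩ := h t.1 t.2.1 t.2.2 (Finset.mem_filter.mp ht).2
    refine ⟨B, hB, F.keyAvg_clawMass_le s A (F.clawProb_nonneg s _) fun b j i hji =>
      (hmax (b, j, i) ?_).trans hprob⟩
    simp only [hT, Finset.mem_filter, Finset.mem_product, Finset.mem_range]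
    exact ⟨⟨Finset.mem_univ _, by omega, by omega⟩, hji⟩

/-- For a claw-free family, the weight of the final states on the part that is odd in the values at
both preimages is negligible. -/
lemma ClawFree.exists_negligible_bound {F : FunctionPairs} (hF : F.ClawFree)
    (A : ∀ s, Prover (F.keyLen s) (F.domLen s) (F.ranLen s))
    (hA : PolyBounded fun s => (A s).size) :
    ∃ η : ℕ → ℝ, Negligible η ∧ ∀ s, 0 < η s ∧ F.keyAvg s (F.clawMass s (A s)) ≤ η s := by
  choose B hB hmass using fun s => F.exists_finder_of_clawMass s (A s)
  have hBpoly : PolyBounded fun s => (B s).size := by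
    obtain ⟨P, hP⟩ := hA
    refine ⟨17 * (P + 1) ^ 5, fun s => (hB s).trans ?_⟩
    have := hP s
    simp only [Polynomial.eval_mul, Polynomial.eval_pow, Polynomial.eval_add, Polynomial.eval_one,
      Polynomial.eval_ofNat]
    gcongr
  have hq : PolyBounded fun s => (A s).queries := by
    obtain ⟨P, hP⟩ := hA
    exact ⟨P, fun s => (A s).queries_le_size.trans (hP s)⟩
  have h1 := ((hF B hBpoly).pow_mul hq 3).const_mul 2
  -- The term `(1 / 2) ^ s` makes the bound positive, so that the Markov thresholds are nonzero even
  -- when `μ s = 0`.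
  refine ⟨_, h1.add negligible_two_pow, fun s => ?_⟩
  have h2 := F.clawProb_nonneg s (B s)
  have h3 := hmass s
  have h4 : (0 : ℝ) < (1 / 2) ^ s := by positivity
  rw [mul_assoc] at h3
  constructor
  · have : 0 ≤ 2 * (((A s).queries : ℝ) ^ 3 * F.clawProb s (B s)) := by positivity
    exact add_pos_of_nonneg_of_pos this h4
  · exact h3.trans (le_add_of_nonneg_right h4.le)

end FunctionPairs

end

/-! ### The structure theorem -/

theorem mainTheorem8 :
    ∃ Ξ : ℝ → ℝ,
      (∀ ε ∈ Set.Icc (0 : ℝ) (1 / 2), Ξ ε ∈ Set.Icc (0 : ℝ) 1) ∧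
      (∀ ε : ℕ → ℝ, (∀ s, ε s ∈ Set.Icc (0 : ℝ) (1 / 2)) → ¬ Negligible ε →
        ¬ Negligible fun s => 1 - Ξ (ε s)) ∧
      (∃ c : ℝ, 0 < c ∧ ∃ C : ℝ, 0 < C ∧
        ∀ μ ∈ Set.Icc (0 : ℝ) (1 / 2), Ξ (1 / 2 - μ) ≤ C * μ ^ c) ∧
      ∀ F : FunctionPairs, F.ClawFree →
      ∀ A : ∀ s, Prover (F.keyLen s) (F.domLen s) (F.ranLen s),
        PolyBounded (fun s => (A s).size) →
      ∀ μ : ℕ → ℝ, (∀ s, μ s ∈ Set.Icc (0 : ℝ) (1 / 2)) →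
        (∀ s, 1 - μ s ≤ F.winProb s (A s)) →
        ¬ Negligible (fun s => 1 / 2 - μ s) →
      ∃ negl : ℕ → ℝ, Negligible negl ∧ ∀ s,
        ∃ Y : Bits (F.keyLen s) → Set (Bits (F.ranLen s)),
          1 - Ξ (1 / 2 - μ s) - negl s ≤
            F.keyAvg s (fun k => (A s).prOut k fun _ y _ _ => y ∈ Y k) ∧
          ∀ k ∈ (F.gen s).support, ∀ y ∈ Y k,
            0 < (A s).prOut k (fun _ y' _ _ => y' = y) ∧
            ∃ x : Fin 2 → Bits (F.domLen s), F.ArePreimages s k y x ∧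
            ∃ Hgood : Set (({x 0, x 1}ᶜ : Set (Bits (F.domLen s))) → ZMod 2),
              1 - Ξ (1 / 2 - μ s) - negl s ≤
                (A s).prOut k (fun H y' _ _ => Set.domRestrict {x 0, x 1}ᶜ H ∈ Hgood ∧ y' = y) /
                  (A s).prOut k (fun _ y' _ _ => y' = y) ∧
              ∀ H' ∈ Hgood, ∀ b : Fin 2,
                1 / (2 * ((A s).queries : ℝ)) * (1 - Ξ (1 / 2 - μ s) - negl s) *
                    (A s).prOut k (fun H y' _ _ => Set.domRestrict {x 0, x 1}ᶜ H = H' ∧ y' = y) ≤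
                  Finset.expect (Finset.range (A s).queries) fun l =>
                    (A s).prExt k l fun H x' => Set.domRestrict {x 0, x 1}ᶜ H = H' ∧ x' = x b := by
  -- At `ε = 1/2 - μ` the argument is `2μ`, the part of `Λ` due to imperfect winning.
  refine ⟨fun ε => extractionLoss (1 - 2 * ε), fun ε _ => ⟨Real.sqrt_nonneg _,
    extractionLoss_le_one _⟩, fun ε hε hnon hneg => hnon ?_, ⟨1 / 8, by norm_num, 4, by norm_num,
    fun μ hμ => ?_⟩, fun F hF A hA μ hμ hwin _ => ?_⟩
  -- Contrapositive: `ε ≤ √(8 (1 - Ξ ε))`, so `ε` would be negligible as well.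
  · have h := (hneg.const_mul 8).sqrt
    refine h.of_abs_le fun s => ?_
    rw [abs_of_nonneg (hε s).1, abs_of_nonneg (Real.sqrt_nonneg _)]
    apply Real.le_sqrt_of_sq_le
    have := extractionLoss_le rfl (hε s)
    linarith
  · have := extractionLoss_le_rpow hμ.1
    change extractionLoss (1 - 2 * (1 / 2 - μ)) ≤ _
    rwa [show 1 - 2 * (1 / 2 - μ) = 2 * μ by ring]
  · obtain ⟨η, hη, hbound⟩ := hF.exists_negligible_bound A hA
    -- The error of `extractionLoss_add_le` for `t = 2√η`; it remains negligible under iterated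
    -- roots.
    refine ⟨fun s => √(2 * √√(2 * √(η s))),
      ((hη.sqrt.const_mul 2).sqrt.sqrt.const_mul 2).sqrt, fun s => ?_⟩
    have hle : 1 - extractionLoss (1 - 2 * (1 / 2 - μ s)) - √(2 * √√(2 * √(η s))) ≤
        1 - extractionLoss (2 * μ s + 2 * √(η s)) := by
      rw [show 1 - 2 * (1 / 2 - μ s) = 2 * μ s by ring]
      have := extractionLoss_add_le (a := 2 * μ s) (t := 2 * √(η s))
        (mul_nonneg zero_le_two (hμ s).1) (by positivity)
      linarith
    obtain ⟨Y, hY, hgood⟩ := F.exists_goodOutputs s (A s) (hμ s).1 (hwin s) (hbound s).1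
      (hbound s).2
    refine ⟨Y, hle.trans hY, fun k _ y hy => ?_⟩
    obtain ⟨hpos, x, hx, Hgood, h1, h2⟩ := hgood k y hy
    refine ⟨hpos, x, hx, Hgood, hle.trans h1, fun H' hH' b => le_trans ?_ (h2 H' hH' b)⟩
    have := (A s).prOut_nonneg k
      fun H y' _ _ => Set.domRestrict {x 0, x 1}ᶜ H = H' ∧ y' = y
    gcongr
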